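/- **Homotopy words.** An *r-curve* is a continuous curve $\gamma:[0,\infty]\to\hat{\mathbb C}$ with $\gamma([0,\infty))\subset\mathbb C$, $\gamma(\infty)=\infty$ and $\Re\gamma(t)\to+\infty$ as $t\to\infty$. Let $V\subset\mathbb C$ be finite and let $\gamma$ be an r-curve with $\gamma(0)\in V$ and $\gamma((0,\infty))\subset\mathbb C\setminus V$. Choose $r$ smaller than all $\Re v$ ($v\in V$) and all $\Re\gamma(t)$, and put $H_r=\{z\in\mathbb{C}\setminus V:\Re z>r\}\cup\{\infty\}\subset\hat{\mathbb C}$. Homotopies of curves in $H_r$ fix both endpoints, and an endpoint may lie in $V$ as long as the interior of the curve stays in $H_r$. For $w\in V$ let $\sigma_w$ be the horizontal ray from $w$ to $\infty$ on the right, modified so as to pass the points of $V$ on it along small upper half-circles, and let $g_w\in\pi_1(H_r,\infty)$ be the class of the loop that comes from $\infty$ along $\sigma_w$ to a point near $w$, turns once clockwise around $w$ along a small circle, and returns along $\sigma_w$. The words $v_1^{\pm1}\cdots v_m^{\pm1}$ in the free group $F(V)$ with $[\gamma]=[\sigma_{\gamma(0)}]\,g_{v_1}^{\pm1}\cdots g_{v_m}^{\pm1}$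 in $H_r$ differ by left multiplication by powers of $\gamma(0)$; $W(V,\gamma)$ denotes the shortest of them and $|W(V,\gamma)|$ the length of its reduced form. **Setting for legs.** Let $f_0(z)=e^z+\kappa$ with $\kappa$ not escaping under $f_0$. A *ray tail* of $f_0$ is a continuous curve $\gamma:[0,\infty)\to I(f_0)$ into the escaping set such that every $f_0^k\circ\gamma$ is injective and tends to $\infty$, and $f_0^k(\gamma(t))\to\infty$ uniformly in $t$ as $k\to\infty$; a *dynamic ray* is a maximal injective curve $(0,\infty)\to I(f_0)$ whose restrictions to all $[t,\infty)$, $t>0$, are ray tails. Let $a_0$ lie on a dynamic ray of $f_0$ whose external address is not (pre-)periodic, let $R_0$ be the part of the ray from $a_0$ to $\infty$, and put $a_n=f_0^n(a_0)$, $R_n=f_0^n(R_0)$, $\mathcal O_n=\{a_0,\dots,a_n\}$, $S_0=\bigcup_{n\ge0}R_n$. (The external address is the sequence $(s_n)$ of integers such that $R_n$ lies near $\infty$ in the strip $2\pi(s_n-\frac12)<\Im z<2\pi(s_n+\frac12)$.) Let $U\subset\mathbb C\setminus\bigcup_{n>0}R_n$ be a bounded Jordan domain containing $\kappa$ and $a_0$,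 let $c_u$, $u\in[0,1]$, be an isotopy of $\mathbb C$ through quasiconformal maps with $c_0=\mathrm{id}$, $c_u=\mathrm{id}$ outside $U$ and $c_1(\kappa)=a_0$, and let $f=c_1\circ f_0$ (a captured exponential function). A quasiconformal map $\varphi:\mathbb C\to\mathbb C$ is of *id-type* if there is an isotopy $\varphi_u$ of $\mathbb C$, $u\in[0,1]$, from $\varphi_0=\mathrm{id}$ to $\varphi_1=\varphi$ with $|\varphi_u(z)-z|\to0$ uniformly in $u$ as $S_0\ni z\to\infty$. For $\varphi$ of id-type, $\hat\varphi$ denotes the id-type map such that $\varphi\circ f\circ\hat\varphi^{-1}$ is entire, and $W_n^\varphi:=W(\varphi(\mathcal O_n),\varphi(R_n))$. **Theorem.** Let $V\subset\mathbb C$ be finite, let $\gamma$ be an r-curve with $\gamma(0)\in V$ and $\gamma((0,\infty))\subset\mathbb C\setminus V$, and put $n=|V|$. 1. A word as above exists, so that $W(V,\gamma)$ is defined. In parts 2–4 put $m=|W(V,\gamma)|$. 2. Let $p$ be a monic polynomial of degree $d$ whose critical values lie in $V$, let $\tilde V\subset\mathbb C$ be a finite set such that $p(\tilde V)\subset V$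 and $p|_{\tilde V}$ is injective, and let $\tilde\gamma$ be an r-curve with $\tilde\gamma(0)\in\tilde V$ and $p\circ\tilde\gamma=\gamma$. Then $|W(\tilde V,\tilde\gamma)|<6dn^2(m+1)$. 3. Let $0\in V$, $\gamma(0)\ne0$, let $\tilde V\subset\mathbb C$ be a finite set such that $\exp(\tilde V)\subset V$ and $\exp|_{\tilde V}$ is injective, and let $\tilde\gamma$ be an r-curve with $\tilde\gamma(0)\in\tilde V$ and $\exp\circ\tilde\gamma=\gamma$. Then $|W(\tilde V,\tilde\gamma)|<6n^2(m+1)$. 4. Let $p$ be a monic polynomial of degree $d$ and $g=p\circ\exp$. Suppose that $V$ contains the set $S(g)$ of finite singular values of $g$ (the closure of the set of critical and finite asymptotic values) and that $\gamma(0)\notin S(g)$. Let $\tilde V\subset\mathbb C$ be a finite set such that $g(\tilde V)\subset V\setminus S(g)$ and $g|_{\tilde V}$ is injective. Then for every r-curve $\tilde\gamma$ with $\tilde\gamma(0)\in\tilde V$ and $g\circ\tilde\gamma=\gamma$, $$|W(\tilde V,\tilde\gamma)|<42\,d\,n^4(m+1).$$ 5. There is a constant $A>0$ such that for every captured exponential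 function $f$, every id-type map $\varphi$ with pullback $\hat\varphi$, and every integer $n\ge0$, the leg words $W_{n+1}^{\varphi}$ and $W_n^{\hat\varphi}$ are defined and $$|W_n^{\hat\varphi}|<A(n+2)^4\max\{1,|W_{n+1}^{\varphi}|\}.$$ -/

import Mathlib

open Set Filter Topology OnePoint
open scoped unitInterval NNReal

noncomputable section

/-! ### r-curves and pinched homotopies -/

/-- An r-curve `γ : [0, ∞] → Ĉ`, given by its restriction to `[0, ∞)`: it is continuous with values
in `ℂ`, and `Re γ(t) → +∞`. (Then `γ(∞) = ∞` is the continuous extension.) -/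
def IsRCurve (γ : ℝ≥0 → ℂ) : Prop :=
  Continuous γ ∧ Tendsto (fun t => (γ t).re) atTop atTop

/-- `γ` starts at a point of `V` and avoids `V` afterwards. -/
def IsRCurveFrom (V : Finset ℂ) (γ : ℝ≥0 → ℂ) : Prop :=
  IsRCurve γ ∧ γ 0 ∈ V ∧ ∀ t, 0 < t → γ t ∉ V

/-- The extension of `γ` to `[0, ∞]`, reparametrized by `t ↦ t / (1 - t)`, `t ∈ [0, 1]`. -/
def rExtend (γ : ℝ≥0 → ℂ) (t : I) : OnePoint ℂ :=
  if (t : ℝ) < 1 then ((γ (Real.toNNReal ((t : ℝ) / (1 - t))) : ℂ) : OnePoint ℂ) else ∞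

theorem continuous_rExtend {γ : ℝ≥0 → ℂ} (h : IsRCurve γ) : Continuous (rExtend γ) := by
  rw [continuous_iff_continuousAt]
  intro t
  by_cases ht : (t : ℝ) < 1
  · have hev : rExtend γ =ᶠ[𝓝 t]
        fun s : I => ((γ (Real.toNNReal ((s : ℝ) / (1 - s))) : ℂ) : OnePoint ℂ) := by
      have : {s : I | (s : ℝ) < 1} ∈ 𝓝 t :=
        (isOpen_lt continuous_subtype_val continuous_const).mem_nhds ht
      filter_upwards [this] with s hs
      exact if_pos hs
    refine ContinuousAt.congr ?_ hev.symm
    have h1 : ContinuousAt (fun s : I => (s : ℝ) / (1 - s)) t :=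
      ContinuousAt.div continuous_subtype_val.continuousAt
        (continuous_const.sub continuous_subtype_val).continuousAt (by linarith)
    exact (OnePoint.continuous_coe.comp (h.1.comp continuous_real_toNNReal)).continuousAt.comp h1
  · have ht1 : (t : ℝ) = 1 := le_antisymm t.2.2 (not_lt.1 ht)
    have hval : rExtend γ t = ∞ := if_neg ht
    rw [ContinuousAt, hval]
    have hsub : Tendsto (fun s : I => (1 : ℝ) - s) (𝓝[{s : I | (s : ℝ) < 1}] t) (𝓝[>] 0) := by
      refine tendsto_nhdsWithin_iff.2 ⟨?_, ?_⟩
      · have : Tendsto (fun s : I => (1 : ℝ) - s) (𝓝 t) (𝓝 (1 - (t : ℝ))) :=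
          (continuous_const.sub continuous_subtype_val).tendsto t
        rw [ht1, sub_self] at this
        exact this.mono_left nhdsWithin_le_nhds
      · filter_upwards [self_mem_nhdsWithin] with s hs
        simpa using hs
    have hq : Tendsto (fun s : I => (s : ℝ) / (1 - s)) (𝓝[{s : I | (s : ℝ) < 1}] t) atTop := by
      have hs1 : Tendsto (fun s : I => (s : ℝ)) (𝓝[{s : I | (s : ℝ) < 1}] t) (𝓝 1) := by
        have : Tendsto (fun s : I => (s : ℝ)) (𝓝 t) (𝓝 (t : ℝ)) := continuous_subtype_val.tendsto t
        rw [ht1] at this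
        exact this.mono_left nhdsWithin_le_nhds
      simpa [div_eq_mul_inv] using
        hs1.pos_mul_atTop one_pos (tendsto_inv_nhdsGT_zero.comp hsub)
    have hnn : Tendsto Real.toNNReal atTop atTop := Real.tendsto_toNNReal_atTop
    have hcob : Tendsto γ atTop (coclosedCompact ℂ) := by
      rw [coclosedCompact_eq_cocompact, ← Metric.cobounded_eq_cocompact,
        ← tendsto_norm_atTop_iff_cobounded]
      exact tendsto_atTop_mono (fun x => Complex.re_le_norm _) h.2
    have hlt : Tendsto (rExtend γ) (𝓝[{s : I | (s : ℝ) < 1}] t) (𝓝 ∞) := by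
      refine ((OnePoint.tendsto_coe_infty.comp hcob).comp (hnn.comp hq)).congr' ?_
      filter_upwards [self_mem_nhdsWithin] with s hs
      exact (if_pos hs).symm
    have hge : Tendsto (rExtend γ) (𝓝[{s : I | (s : ℝ) < 1}ᶜ] t) (𝓝 ∞) := by
      refine tendsto_const_nhds.congr' ?_
      filter_upwards [self_mem_nhdsWithin] with s hs
      exact (if_neg hs).symm
    have := hlt.sup hge
    rwa [nhdsWithin_union _ _ _ |>.symm, union_compl_self, nhdsWithin_univ] at this

/-- An r-curve starting at `z`, as a path in the Riemann sphere from `z` to `∞`. -/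
def rPath {γ : ℝ≥0 → ℂ} (h : IsRCurve γ) {z : ℂ} (hz : γ 0 = z) : Path (z : OnePoint ℂ) ∞ where
  toFun := rExtend γ
  continuous_toFun := continuous_rExtend h
  source' := by simp [rExtend, hz]
  target' := by simp [rExtend]

/-- Homotopy with (possibly pinched) fixed endpoints in `U ⊆ Ĉ`: at every moment of the homotopy
the curve stays in `U` except possibly at its two endpoints. -/
def PinchedHomotopic (U : Set (OnePoint ℂ)) {x y : OnePoint ℂ} (p q : Path x y) : Prop :=
  ∃ F : p.Homotopy q, ∀ u t : I, t ≠ 0 → t ≠ 1 → F (u, t) ∈ U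

/-- `H_r = (ℍ_r \ V) ∪ {∞}`, where `ℍ_r = {z : Re z > r}`. -/
def puncturedHalfPlane (V : Finset ℂ) (r : ℝ) : Set (OnePoint ℂ) :=
  insert ∞ ((fun z : ℂ => (z : OnePoint ℂ)) '' {z | r < z.re ∧ z ∉ V})

/-! ### The straight curves and the generators of the fundamental group -/

/-- `ρ` may serve as the common radius of the disks around the points of `V`: the closed disks of
radius `ρ` centred at the points of `V` are disjoint. -/
def IsDiskRadius (V : Finset ℂ) (ρ : ℝ) : Prop :=
  0 < ρ ∧ ∀ u ∈ V, ∀ w ∈ V, u ≠ w → 2 * ρ < dist u w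

/-- The horizontal ray `w + s`, `s ≥ 0`, in which the diameters of the disks of radius `ρ` around
the points of `V` lying on the ray to the right of `w` are replaced by the upper half-circles.
(`Real.sqrt` vanishes on negative numbers, so each summand is nonzero only inside one disk.) -/
def straightCurve (V : Finset ℂ) (ρ : ℝ) (w : ℂ) (s : ℝ) : ℂ :=
  w + (s : ℂ) + ((∑ u ∈ V with u.im = w.im ∧ w.re < u.re,
    Real.sqrt (ρ ^ 2 - (w.re + s - u.re) ^ 2) : ℝ) : ℂ) * Complex.I

theorem continuous_straightCurve (V : Finset ℂ) (ρ : ℝ) (w : ℂ) :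
    Continuous (straightCurve V ρ w) := by
  unfold straightCurve
  fun_prop

theorem isRCurve_straightCurve (V : Finset ℂ) (ρ : ℝ) (w : ℂ) (b : ℝ) :
    IsRCurve (fun s : ℝ≥0 => straightCurve V ρ w (b + s)) := by
  refine ⟨(continuous_straightCurve V ρ w).comp (by fun_prop), ?_⟩
  have : (fun s : ℝ≥0 => (straightCurve V ρ w (b + s)).re) = fun s : ℝ≥0 => (w.re + b) + (s : ℝ) := by
    funext s
    simp [straightCurve, add_assoc]
  rw [this]
  exact tendsto_atTop_add_const_left _ _ (NNReal.tendsto_coe_atTop.2 tendsto_id)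

theorem straightCurve_eq {V : Finset ℂ} {ρ : ℝ} (hρ : IsDiskRadius V ρ) {w : ℂ} (hw : w ∈ V)
    {b : ℝ} (hb : b ≤ ρ) : straightCurve V ρ w b = w + b := by
  have h0 : (∑ u ∈ V with u.im = w.im ∧ w.re < u.re,
      Real.sqrt (ρ ^ 2 - (w.re + b - u.re) ^ 2)) = 0 := by
    refine Finset.sum_eq_zero fun u hu => ?_
    rw [Finset.mem_filter] at hu
    obtain ⟨huV, him, hre⟩ := hu
    have hne : u ≠ w := fun h => by simp [h] at hre
    have hd := hρ.2 u huV w hw hne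
    rw [Complex.dist_of_im_eq him, Real.dist_eq, abs_of_pos (by linarith)] at hd
    apply Real.sqrt_eq_zero_of_nonpos
    nlinarith [hρ.1]
  simp only [straightCurve, h0, Complex.ofReal_zero, zero_mul, add_zero]

section Generators

variable (V : Finset ℂ) {ρ : ℝ} (hρ : IsDiskRadius V ρ)

/-- The curve `γ_str` from `w ∈ V` to `∞`. -/
def straightPath {w : ℂ} (hw : w ∈ V) : Path (w : OnePoint ℂ) ∞ :=
  rPath (isRCurve_straightCurve V ρ w 0) (by
    simp only [NNReal.coe_zero, add_zero]
    simpa using straightCurve_eq hρ hw hρ.1.le)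

/-- The part `a` of the straight curve of `w` from `w + ρ` to `∞`. -/
def armPath {w : ℂ} (hw : w ∈ V) : Path ((w + ρ : ℂ) : OnePoint ℂ) ∞ :=
  rPath (isRCurve_straightCurve V ρ w ρ) (by
    simp only [NNReal.coe_zero, add_zero]
    exact straightCurve_eq hρ hw le_rfl)

/-- The clockwise loop `c(t) = w + ρ e^{-2πit}`. -/
def clockwiseCircle (ρ : ℝ) (w : ℂ) : Path ((w + ρ : ℂ) : OnePoint ℂ) ((w + ρ : ℂ) : OnePoint ℂ) where
  toFun t := ((w + ρ * Complex.exp (-(2 * Real.pi * Complex.I * (t : ℝ))) : ℂ) : OnePoint ℂ)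
  continuous_toFun := OnePoint.continuous_coe.comp (by fun_prop)
  source' := by simp
  target' := by simp [Complex.exp_neg, Complex.exp_two_pi_mul_I]

/-- The loop `a⁻¹ · c · a` based at `∞`, which represents the generator `g_w`. -/
def generatorLoop {w : ℂ} (hw : w ∈ V) : Path (∞ : OnePoint ℂ) ∞ :=
  ((armPath V hρ hw).symm.trans (clockwiseCircle ρ w)).trans (armPath V hρ hw)

/-- The loop `g_{v₁}^{±1} · g_{v₂}^{±1} ⋯` at `∞` spelled by a word. -/
def wordLoop : List (V × Bool) → Path (∞ : OnePoint ℂ) ∞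
  | [] => Path.refl ∞
  | (w, b) :: l =>
    (if b then generatorLoop V hρ w.2 else (generatorLoop V hρ w.2).symm).trans (wordLoop l)

end Generators

/-! ### Homotopy words -/

/-- The word `W ∈ F(V)` describes the homotopy type of the r-curve `γ`: for some (equivalently, any)
admissible half-plane `ℍ_r` and radius `ρ` of the disks, `[γ] = [γ_str] · g_{v₁}^{±1} ⋯ g_{v_m}^{±1}`
in `H_r`, where `v₁^{±1} ⋯ v_m^{±1}` is the reduced form of `W`. -/
def IsHomotopyWord (V : Finset ℂ) (γ : ℝ≥0 → ℂ) (W : FreeGroup V) : Prop :=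
  ∃ (hγ : IsRCurve γ) (h0 : γ 0 ∈ V) (r ρ : ℝ) (hρ : IsDiskRadius V ρ),
    (∀ v ∈ V, r < v.re - ρ) ∧ (∀ t, r < (γ t).re) ∧
      PinchedHomotopic (puncturedHalfPlane V r) (rPath hγ rfl)
        ((straightPath V hρ h0).trans (wordLoop V hρ W.toWord))

/-- `|W(V, γ)|`. Twisting around the starting point is not seen by pinched homotopies, that is
`[γ_str] · g_{γ(0)} = [γ_str]`, so the words of `γ` form a coset of the powers of `γ(0)`;
`W(V, γ)` is its shortest element, the one whose reduced form does not begin with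
`γ(0)` or its inverse. -/
def homotopyWordLength (V : Finset ℂ) (γ : ℝ≥0 → ℂ) : ℕ :=
  sInf {k | ∃ W : FreeGroup V, IsHomotopyWord V γ W ∧ W.norm = k}

/-! ### Singular values -/

/-- Critical values of an entire function. -/
def criticalValues (g : ℂ → ℂ) : Set ℂ := g '' {z | deriv g z = 0}

/-- Finite asymptotic values of an entire function: limits of `g` along curves tending to `∞`. -/
def asymptoticValues (g : ℂ → ℂ) : Set ℂ :=
  {a | ∃ η : ℝ≥0 → ℂ, Continuous η ∧ Tendsto η atTop (cocompact ℂ) ∧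
    Tendsto (fun t => g (η t)) atTop (𝓝 a)}

/-- Finite singular values of an entire function. -/
def singularValues (g : ℂ → ℂ) : Set ℂ := closure (criticalValues g ∪ asymptoticValues g)

/-! ### Quasiconformal maps and isotopies -/

/-- `∂θ/∂z`. -/
def wirtingerDz (θ : ℂ → ℂ) (z : ℂ) : ℂ :=
  (fderiv ℝ θ z 1 - Complex.I * fderiv ℝ θ z Complex.I) / 2

/-- `∂θ/∂z̄`. -/
def wirtingerDzbar (θ : ℂ → ℂ) (z : ℂ) : ℂ :=
  (fderiv ℝ θ z 1 + Complex.I * fderiv ℝ θ z Complex.I) / 2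

/-- The analytic definition of a quasiconformal homeomorphism of `ℂ`: it has locally integrable
distributional derivatives with `|ψ_z̄| ≤ k |ψ_z|` a.e. for some `k < 1`. -/
def IsQuasiconformal (ψ : ℂ ≃ₜ ℂ) : Prop :=
  ∃ (k : ℝ) (ψz ψzbar : ℂ → ℂ), k < 1 ∧
    MeasureTheory.LocallyIntegrable ψz ∧ MeasureTheory.LocallyIntegrable ψzbar ∧
    (∀ θ : ℂ → ℂ, ContDiff ℝ (⊤ : ℕ∞) θ → HasCompactSupport θ →
      ∫ z, ψ z * wirtingerDz θ z = -∫ z, ψz z * θ z ∧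
      ∫ z, ψ z * wirtingerDzbar θ z = -∫ z, ψzbar z * θ z) ∧
    ∀ᵐ z, ‖ψzbar z‖ ≤ k * ‖ψz z‖

/-- A family of homeomorphisms of `ℂ` that is an isotopy. -/
def IsIsotopy (h : I → ℂ ≃ₜ ℂ) : Prop := Continuous fun x : I × ℂ => h x.1 x.2

/-- Id-type maps with respect to a set `S`: quasiconformal maps `φ` joined to the identity by an
isotopy `φ_u` with `|φ_u(z) - z| → 0` uniformly in `u` as `S ∋ z → ∞`. -/
def IsIdType (S : Set ℂ) (φ : ℂ ≃ₜ ℂ) : Prop :=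
  IsQuasiconformal φ ∧ ∃ h : I → ℂ ≃ₜ ℂ, IsIsotopy h ∧ h 0 = Homeomorph.refl ℂ ∧ h 1 = φ ∧
    ∀ ε : ℝ, 0 < ε → ∃ M : ℝ, ∀ z ∈ S, M < ‖z‖ → ∀ u, ‖h u z - z‖ < ε

/-! ### Escape on rays in the exponential family -/

/-- The function `e^z + κ`. -/
def expMap (κ : ℂ) (z : ℂ) : ℂ := Complex.exp z + κ

/-- The escaping set `I(f)`. -/
def escapingSet (f : ℂ → ℂ) : Set ℂ := {z | Tendsto (fun n : ℕ => f^[n] z) atTop (cocompact ℂ)}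

/-- Ray tails `[0, ∞) → I(f)`. -/
def IsRayTail (f : ℂ → ℂ) (γ : ℝ≥0 → ℂ) : Prop :=
  Continuous γ ∧ (∀ t, γ t ∈ escapingSet f) ∧
    (∀ n : ℕ, Function.Injective (fun t => f^[n] (γ t)) ∧
      Tendsto (fun t => f^[n] (γ t)) atTop (cocompact ℂ)) ∧
    ∀ M : ℝ, ∃ N : ℕ, ∀ n, N ≤ n → ∀ t, M < ‖f^[n] (γ t)‖

/-- Injective curves `(0, ∞) → I(f)` all of whose restrictions to `[t, ∞)`, `t > 0`, are ray tails.
(Only the values of `γ` on `(0, ∞)` matter.) -/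
def IsRayCurve (f : ℂ → ℂ) (γ : ℝ → ℂ) : Prop :=
  InjOn γ (Ioi 0) ∧ ∀ t, 0 < t → IsRayTail f (fun x : ℝ≥0 => γ (t + x))

/-- Dynamic rays: maximal curves of this kind. -/
def IsDynamicRay (f : ℂ → ℂ) (γ : ℝ → ℂ) : Prop :=
  IsRayCurve f γ ∧
    ∀ γ' : ℝ → ℂ, IsRayCurve f γ' → γ '' Ioi 0 ⊆ γ' '' Ioi 0 → γ' '' Ioi 0 = γ '' Ioi 0

/-- The tract `T_k` of `e^z + κ` over `ℍ_r` (for `κ ∉ ℍ_r`): the component of the preimage of `ℍ_r`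
between the lines `Im z = 2π(k - 1/2)` and `Im z = 2π(k + 1/2)`. -/
def tract (κ : ℂ) (r : ℝ) (k : ℤ) : Set ℂ :=
  {z | r < (expMap κ z).re ∧ 2 * Real.pi * (k - 1 / 2) < z.im ∧ z.im < 2 * Real.pi * (k + 1 / 2)}

/-- A ray tail of `e^z + κ` has external address `s`: for every `n`, its `n`-th image is contained
near `∞` in the tract `T_{s_n}`. -/
def HasExternalAddress (κ : ℂ) (γ : ℝ≥0 → ℂ) (s : ℕ → ℤ) : Prop :=
  ∃ r : ℝ, κ.re ≤ r ∧ ∀ n : ℕ, ∀ᶠ t in atTop, (expMap κ)^[n] (γ t) ∈ tract κ r (s n)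

/-- Periodic or pre-periodic sequences. -/
def IsPreperiodicSeq (s : ℕ → ℤ) : Prop := ∃ N q : ℕ, 0 < q ∧ ∀ n, N ≤ n → s (n + q) = s n

/-- Bounded Jordan domains: bounded complementary components of Jordan curves. -/
def IsBoundedJordanDomain (U : Set ℂ) : Prop :=
  Bornology.IsBounded U ∧ ∃ J : Circle → ℂ, Continuous J ∧ Function.Injective J ∧
    ∃ z ∈ (range J)ᶜ, U = connectedComponentIn (range J)ᶜ z

/-! ### Captured exponential functions -/

/-- The data defining a captured exponential function `f = c ∘ f₀`, with `f₀(z) = e^z + κ`. -/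
structure CapturedExponential where
  /-- The singular value of `f₀`. -/
  κ : ℂ
  κ_not_escaping : κ ∉ escapingSet (expMap κ)
  /-- A dynamic ray of `f₀`, and the parameter of the point `a₀` on it. -/
  ray : ℝ → ℂ
  isDynamicRay : IsDynamicRay (expMap κ) ray
  t₀ : ℝ
  t₀_pos : 0 < t₀
  /-- The external address of `a₀`. -/
  s : ℕ → ℤ
  hasExternalAddress : HasExternalAddress κ (fun x => ray (t₀ + x)) s
  not_preperiodic : ¬ IsPreperiodicSeq s
  /-- The domain supporting the capture. -/
  U : Set ℂ
  isBoundedJordanDomain : IsBoundedJordanDomain U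
  U_disjoint : ∀ n : ℕ, 0 < n → ∀ x : ℝ≥0, (expMap κ)^[n] (ray (t₀ + x)) ∉ U
  κ_mem : κ ∈ U
  a₀_mem : ray t₀ ∈ U
  /-- The isotopy `c_u` from the identity to the capture. -/
  c : I → ℂ ≃ₜ ℂ
  isIsotopy : IsIsotopy c
  isQuasiconformal : ∀ u, IsQuasiconformal (c u)
  c_zero : c 0 = Homeomorph.refl ℂ
  c_eq_self : ∀ u, ∀ z ∉ U, c u z = z
  c_one : c 1 κ = ray t₀

namespace CapturedExponential

variable (E : CapturedExponential)

/-- The captured exponential function `f = c₁ ∘ f₀`. -/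
def f (z : ℂ) : ℂ := E.c 1 (expMap E.κ z)

/-- The ray tail `R_n` from `a_n` to `∞`: it is the image under `f₀ⁿ` of the part `R_0` from `a_0` to
`∞` of the given dynamic ray. -/
def R (n : ℕ) (x : ℝ≥0) : ℂ := (expMap E.κ)^[n] (E.ray (E.t₀ + x))

/-- The orbit `a_n = f₀ⁿ(a₀)`. -/
def a (n : ℕ) : ℂ := E.R n 0

/-- The standard spider `S₀ = ⋃ R_n`. -/
def standardSpider : Set ℂ := ⋃ n, range (E.R n)

/-- `φ(𝒪_n)`, where `𝒪_n = {a_0, …, a_n}`. -/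
def markedPoints (φ : ℂ ≃ₜ ℂ) (n : ℕ) : Finset ℂ :=
  (Finset.range (n + 1)).image fun i => φ (E.a i)

/-- The leg `φ(R_n)`. -/
def leg (φ : ℂ ≃ₜ ℂ) (n : ℕ) : ℝ≥0 → ℂ := fun x => φ (E.R n x)

/-- The words of the leg `φ(R_n)`. -/
def IsLegWord (φ : ℂ ≃ₜ ℂ) (n : ℕ) (W : FreeGroup (E.markedPoints φ n)) : Prop :=
  IsHomotopyWord (E.markedPoints φ n) (E.leg φ n) W

/-- The length `|W_n^φ|` of the leg homotopy word. -/
def legWordLength (φ : ℂ ≃ₜ ℂ) (n : ℕ) : ℕ :=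
  homotopyWordLength (E.markedPoints φ n) (E.leg φ n)

/-- `φ̂` is the pullback of the id-type map `φ`: the (unique) id-type map such that `φ ∘ f ∘ φ̂⁻¹` is
entire. -/
def IsPullback (φ φhat : ℂ ≃ₜ ℂ) : Prop :=
  IsIdType E.standardSpider φhat ∧ Differentiable ℂ fun z => φ (E.f (φhat.symm z))

end CapturedExponential

end

/-! Attach to every point v of V a slit: the ray going from v to the left with a small positive
slope δ, generic so that the points of V lie on distinct slit lines. The complement of the slits in
a half-plane Re z > r can be pushed to ∞ along rays of direction 1 + δ i, and it contains the
straight curves with their half-circles. Hence a piece of curve that misses the slits carries no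
information, while crossing the slit of v upwards or downwards contributes the letter g_v or its
inverse (`crossing_up`, `crossing_down`). A curve with N crossings therefore has a word of length at
most N (`exists_isHomotopyWord_of_crossings`). Twisting around the starting point is invisible,
because any two curves from v in a small punctured disk around v are homotopic with v as an
endpoint: interpolate their logarithms (`pinchedHomotopic_of_punctured_disk`). Words exist because a
polynomial approximation makes the number of crossings finite.

Conversely, a word of length m is realized by a polygonal path of 5 m + 2 segments, five for each
letter and two for the straight curve (`IsHomotopyWord.exists_polygonal`). Let g be one of the maps
through which curves are lifted. The homotopy from γ to the polygon can be moved off ∞ and lifted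
through g, which is a covering outside V; the lift extends continuously to the start because that
point is isolated in its fibre. The lifted curve then has a word no longer than the number of
crossings of the lifted polygon with the slits upstairs. If the lift of one segment crosses one slit
at most D times, the length is at most (5 m + 2) |V'| D (`homotopyWordLength_lift_le`).

It remains to find D. The lift of a segment lies in a level set of Re (c g). For a polynomial of
degree d, the restriction of this condition to a slit line is a real polynomial equation of degree
d, nontrivial for all but finitely many slopes, so D = d. For the exponential the level set is K e^x
cos(y + θ) = c, and a concavity argument on the slit line gives D = 2. For g = p ∘ exp the lift is
done in two steps: exp ∘ γ' is an r-curve after rotation by a d-th root of unity, and the two bounds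
compose.

For captured exponential functions, φ ∘ f ∘ φhat⁻¹ is entire and topologically conjugate to an
exponential, hence of the form exp(α z + β) + φ(a_0); the asymptotics along the leg of R_0 force α =
1 (`CapturedExponential.exists_eq_exp`). The exponential estimate then applies, and it even gives a
bound quadratic in n + 2. -/

noncomputable section

/-! ### The algebra of pinched homotopies -/

/-! ### Homotopies of curves in the sphere whose endpoints may be punctures. -/

section PinchedAlgebra

variable {U : Set (OnePoint ℂ)} {x y z w : OnePoint ℂ}

/-- The path `p` stays in `U` except possibly at its endpoints. -/
def InteriorIn (U : Set (OnePoint ℂ)) (p : Path x y) : Prop := ∀ t : I, t ≠ 0 → t ≠ 1 → p t ∈ U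

theorem pinchedHomotopic_of_map {p q : Path x y} (F : I × I → OnePoint ℂ) (hF : Continuous F)
    (h0 : ∀ t, F (0, t) = p t) (h1 : ∀ t, F (1, t) = q t) (hs : ∀ u, F (u, 0) = x)
    (ht : ∀ u, F (u, 1) = y) (hU : ∀ u t : I, t ≠ 0 → t ≠ 1 → F (u, t) ∈ U) :
    PinchedHomotopic U p q := by
  refine ⟨⟨⟨⟨F, hF⟩, h0, h1⟩, ?_⟩, hU⟩
  rintro u t (rfl | rfl)
  · simp [hs]
  · simp [ht]

/-- Two paths which are images of two paths in a convex set are homotopic. -/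
theorem pinchedHomotopic_of_convex {E : Type*} [AddCommGroup E] [Module ℝ E] [TopologicalSpace E]
    [IsTopologicalAddGroup E] [ContinuousSMul ℝ E] {p q : Path x y} (Φ : E → OnePoint ℂ)
    {S T : Set E} (hT : Convex ℝ T) (hS : Convex ℝ S) (hΦ : ContinuousOn Φ T) (hU : MapsTo Φ S U)
    {k l : I → E} (hk : Continuous k) (hl : Continuous l) (h0 : k 0 = l 0) (h1 : k 1 = l 1)
    (hkT : ∀ t, k t ∈ T) (hlT : ∀ t, l t ∈ T) (hkS : ∀ t, t ≠ 0 → t ≠ 1 → k t ∈ S)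
    (hlS : ∀ t, t ≠ 0 → t ≠ 1 → l t ∈ S) (hp : ∀ t, p t = Φ (k t)) (hq : ∀ t, q t = Φ (l t)) :
    PinchedHomotopic U p q := by
  have hmem : ∀ {A : Set E}, Convex ℝ A → ∀ (u : I) {a b : E}, a ∈ A → b ∈ A →
      (1 - (u : ℝ)) • a + (u : ℝ) • b ∈ A := fun hA u a b ha hb =>
    hA ha hb (by linarith [u.2.2]) u.2.1 (by ring)
  refine pinchedHomotopic_of_map
    (fun x : I × I => Φ ((1 - (x.1 : ℝ)) • k x.2 + (x.1 : ℝ) • l x.2)) ?_ ?_ ?_ ?_ ?_ ?_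
  · refine hΦ.comp_continuous (by fun_prop) fun x => hmem hT _ (hkT _) (hlT _)
  · intro t; simp [hp]
  · intro t; simp [hq]
  · intro u
    simp only [← h0, ← add_smul]
    simp [← hp]
  · intro u
    simp only [← h1, ← add_smul]
    simp [← hp]
  · intro u t h0 h1
    exact hU (hmem hS _ (hkS t h0 h1) (hlS t h0 h1))

namespace PinchedHomotopic

theorem interior_left {p q : Path x y} (h : PinchedHomotopic U p q) : InteriorIn U p := by
  obtain ⟨F, hF⟩ := h
  intro t h0 h1
  simpa using hF 0 t h0 h1

theorem refl {p : Path x y} (hp : InteriorIn U p) : PinchedHomotopic U p p :=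
  ⟨Path.Homotopy.refl p, fun _ t h0 h1 => hp t h0 h1⟩

theorem symm {p q : Path x y} (h : PinchedHomotopic U p q) : PinchedHomotopic U q p := by
  obtain ⟨F, hF⟩ := h
  exact ⟨F.symm, fun u t h0 h1 => hF _ t h0 h1⟩

theorem trans {p q s : Path x y} (h : PinchedHomotopic U p q) (h' : PinchedHomotopic U q s) :
    PinchedHomotopic U p s := by
  obtain ⟨F, hF⟩ := h
  obtain ⟨G, hG⟩ := h'
  refine ⟨F.trans G, fun u t h0 h1 => ?_⟩
  rw [Path.Homotopy.trans_apply]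
  split_ifs
  · exact hF _ t h0 h1
  · exact hG _ t h0 h1

theorem hcomp {p p' : Path x y} {q q' : Path y z} (hy : y ∈ U) (h : PinchedHomotopic U p p')
    (h' : PinchedHomotopic U q q') : PinchedHomotopic U (p.trans q) (p'.trans q') := by
  obtain ⟨F, hF⟩ := h
  obtain ⟨G, hG⟩ := h'
  refine ⟨F.hcomp G, fun u t h0 h1 => ?_⟩
  rw [Path.Homotopy.hcomp_apply]
  split_ifs with ht
  · by_cases h : (t : ℝ) = 1 / 2
    · have : F.eval u ⟨2 * t, (unitInterval.mul_pos_mem_iff zero_lt_two).2 ⟨t.2.1, ht⟩⟩ = y := by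
        convert (F.eval u).target using 2
        exact Subtype.ext (show 2 * (t : ℝ) = 1 by linarith)
      dsimp only
      rw [this]; exact hy
    · refine hF _ _ ?_ ?_
      · intro h2
        have h3 : 2 * (t : ℝ) = 0 := congrArg Subtype.val h2
        exact h0 (Subtype.ext (show (t : ℝ) = 0 by linarith))
      · intro h2
        have h3 : 2 * (t : ℝ) = 1 := congrArg Subtype.val h2
        exact h (by linarith)
  · refine hG _ _ ?_ ?_
    · simp only [ne_eq, Subtype.ext_iff, Icc.coe_zero]
      intro h2; exact ht (by dsimp only; linarith)
    · simp only [ne_eq, Subtype.ext_iff, Icc.coe_one] at h1 ⊢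
      intro h2; exact h1 (by linarith)

theorem symm₂ {p q : Path x y} (h : PinchedHomotopic U p q) :
    PinchedHomotopic U p.symm q.symm := by
  obtain ⟨F, hF⟩ := h
  refine ⟨F.symm₂, fun u t h0 h1 => hF u _ ?_ ?_⟩
  · simpa [unitInterval.symm_eq_zero] using h1
  · simpa [unitInterval.symm_eq_one] using h0

end PinchedHomotopic

namespace InteriorIn

theorem mem {p : Path x y} (hp : InteriorIn U p) (hx : x ∈ U) (hy : y ∈ U) (t : I) : p t ∈ U := by
  by_cases h0 : t = 0
  · subst h0; simpa using hx
  by_cases h1 : t = 1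
  · subst h1; simpa using hy
  exact hp t h0 h1

theorem of_mem {p : Path x y} (hp : ∀ t, p t ∈ U) : InteriorIn U p := fun t _ _ => hp t

theorem trans {p : Path x y} {q : Path y z} (hp : InteriorIn U p) (hy : y ∈ U)
    (hq : InteriorIn U q) : InteriorIn U (p.trans q) :=
  (PinchedHomotopic.hcomp hy (.refl hp) (.refl hq)).interior_left

theorem symm {p : Path x y} (hp : InteriorIn U p) : InteriorIn U p.symm :=
  (PinchedHomotopic.refl hp).symm₂.interior_left

theorem refl (hx : x ∈ U) : InteriorIn U (Path.refl x) := fun _ _ _ => hx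

end InteriorIn

namespace PinchedHomotopic

/-- Paths with the same image curve, run through in two ways that only meet the endpoints
at the right times, are homotopic. -/
theorem of_reparam {p : Path x y} (hp : InteriorIn U p) (f : I → I) (hf : Continuous f)
    (hf₀ : f 0 = 0) (hf₁ : f 1 = 1) (h0 : x ∈ U ∨ ∀ t, t ≠ 0 → f t ≠ 0)
    (h1 : y ∈ U ∨ ∀ t, t ≠ 1 → f t ≠ 1) :
    PinchedHomotopic U p (p.reparam f hf hf₀ hf₁) := by
  refine ⟨Path.Homotopy.reparam p f hf hf₀ hf₁, fun u t ht0 ht1 => ?_⟩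
  change p _ ∈ U
  set s : I := ⟨(unitInterval.symm u : ℝ) * t + u * f t, _⟩ with hs
  have hsv : (s : ℝ) = (1 - u) * t + u * f t := rfl
  have t0 : (0 : ℝ) < t := lt_of_le_of_ne t.2.1 (fun h => ht0 (Subtype.ext h.symm))
  have t1 : (t : ℝ) < 1 := lt_of_le_of_ne t.2.2 (fun h => ht1 (Subtype.ext h))
  by_cases hs0 : s = 0
  · rcases h0 with h0 | h0
    · simpa [hs0] using h0
    · exfalso
      have f0 : (0 : ℝ) < f t := lt_of_le_of_ne (f t).2.1 (fun h => h0 t ht0 (Subtype.ext h.symm))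
      have : (s : ℝ) = 0 := by rw [hs0]; rfl
      rcases eq_or_lt_of_le u.2.1 with hu | hu
      · rw [hsv, ← hu] at this; linarith
      · have h2 := u.2.2
        nlinarith [mul_pos hu f0, mul_nonneg (sub_nonneg.2 h2) t0.le]
  by_cases hs1 : s = 1
  · rcases h1 with h1 | h1
    · simpa [hs1] using h1
    · exfalso
      have f0 : (f t : ℝ) < 1 := lt_of_le_of_ne (f t).2.2 (fun h => h1 t ht1 (Subtype.ext h))
      have : (s : ℝ) = 1 := by rw [hs1]; rfl
      rcases eq_or_lt_of_le u.2.1 with hu | hu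
      · rw [hsv, ← hu] at this; linarith
      · have h2 := u.2.2
        nlinarith [mul_pos hu (sub_pos.2 f0), mul_nonneg (sub_nonneg.2 h2) (sub_pos.2 t1).le]
  exact hp s hs0 hs1

/-- Rebracketing is a reparametrization that takes the values 0 and 1 only at 0 and 1, so `x` and
`w` may be punctures. -/
theorem assoc {p : Path x y} {q : Path y z} {s : Path z w} (hp : InteriorIn U p) (hy : y ∈ U)
    (hq : InteriorIn U q) (hz : z ∈ U) (hs : InteriorIn U s) :
    PinchedHomotopic U ((p.trans q).trans s) (p.trans (q.trans s)) := by
  rw [Path.Homotopy.trans_assoc_reparam]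
  refine (of_reparam (hp.trans hy (hq.trans hz hs)) _ _ _ _ (.inr fun t ht => ?_)
    (.inr fun t ht => ?_)).symm
  · simp only [ne_eq, Subtype.ext_iff, Icc.coe_zero, Path.Homotopy.transAssocReparamAux] at ht ⊢
    have := lt_of_le_of_ne t.2.1 (Ne.symm ht)
    split_ifs <;> intro h <;> linarith
  · simp only [ne_eq, Subtype.ext_iff, Icc.coe_one, Path.Homotopy.transAssocReparamAux] at ht ⊢
    have := lt_of_le_of_ne t.2.2 ht
    split_ifs <;> intro h <;> linarith

/-- Here the reparametrization reaches 1 already at time 1/2, so the end `y` has to lie in `U`; the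
start `x` need not. -/
theorem trans_refl {p : Path x y} (hp : InteriorIn U p) (hy : y ∈ U) :
    PinchedHomotopic U (p.trans (Path.refl y)) p := by
  rw [Path.Homotopy.trans_refl_reparam]
  refine (of_reparam hp _ _ _ _ (.inr fun t ht => ?_) (.inl hy)).symm
  simp only [ne_eq, Subtype.ext_iff, Icc.coe_zero, Path.Homotopy.transReflReparamAux] at ht ⊢
  have := lt_of_le_of_ne t.2.1 (Ne.symm ht)
  split_ifs <;> intro h <;> linarith

theorem trans_symm_self {p : Path x y} (hp : InteriorIn U p) (hx : x ∈ U) (hy : y ∈ U) :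
    PinchedHomotopic U (p.trans p.symm) (Path.refl x) :=
  PinchedHomotopic.symm ⟨Path.Homotopy.reflTransSymm p, fun _ _ _ _ => hp.mem hx hy _⟩

/-- `(b a) a⁻¹ = b`. -/
theorem trans_cancel_right {a : Path x y} {b : Path z x} (hb : InteriorIn U b) (hx : x ∈ U)
    (ha : InteriorIn U a) (hy : y ∈ U) :
    PinchedHomotopic U ((b.trans a).trans a.symm) b :=
  (assoc hb hx ha hy ha.symm).trans
    ((hcomp hx (refl hb) (trans_symm_self ha hx hy)).trans (trans_refl hb hx))

/-- Used to strip a common ray off the ends of curves that start at a puncture, where the groupoid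
of `U` is not available. -/
theorem cancel_right {a : Path x y} {b c : Path z x} (hb : InteriorIn U b) (hc : InteriorIn U c)
    (hx : x ∈ U) (ha : InteriorIn U a) (hy : y ∈ U)
    (h : PinchedHomotopic U (b.trans a) (c.trans a)) : PinchedHomotopic U b c :=
  (trans_cancel_right hb hx ha hy).symm.trans
    ((hcomp hy h (refl ha.symm)).trans (trans_cancel_right hc hx ha hy))

end PinchedHomotopic

end PinchedAlgebra

/-! ### Homotopy classes of paths in a subset of the sphere -/

section PathClass

variable {U : Set (OnePoint ℂ)} {x y z : OnePoint ℂ}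

/-- The class of a path in `U` in the fundamental groupoid of `U`. -/
def pathClass (p : Path x y) (hp : ∀ t, p t ∈ U) :
    Path.Homotopic.Quotient (⟨x, p.source ▸ hp 0⟩ : U) ⟨y, p.target ▸ hp 1⟩ :=
  .mk ⟨⟨fun t => ⟨p t, hp t⟩, by fun_prop⟩, Subtype.ext p.source, Subtype.ext p.target⟩

/-- For endpoints in `U` a pinched homotopy is an ordinary homotopy in the subspace `U`. This turns
chains of homotopies into computations in the fundamental groupoid; only curves starting at a
puncture need pinched homotopies directly. -/
theorem pathClass_eq_iff {p q : Path x y} (hp : ∀ t, p t ∈ U) (hq : ∀ t, q t ∈ U) :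
    pathClass p hp = pathClass q hq ↔ PinchedHomotopic U p q := by
  rw [pathClass, pathClass, Path.Homotopic.Quotient.eq]
  constructor
  · rintro ⟨F⟩
    refine pinchedHomotopic_of_map (fun x => (F x : OnePoint ℂ)) (by fun_prop) ?_ ?_ ?_ ?_
      fun u t _ _ => (F (u, t)).2
    · intro t; simp
    · intro t; simp
    · intro u; simp
    · intro u; simp
  · rintro ⟨F, hF⟩
    have hmem : ∀ x, F x ∈ U := by
      rintro ⟨u, t⟩
      by_cases h0 : t = 0
      · subst h0
        have := hp 0
        simpa using this
      by_cases h1 : t = 1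
      · subst h1
        have := hp 1
        simpa using this
      exact hF u t h0 h1
    refine ⟨⟨⟨⟨fun x => ⟨F x, hmem x⟩, by fun_prop⟩, ?_, ?_⟩, ?_⟩⟩
    · intro t; simp
    · intro t; simp
    · rintro u t (rfl | rfl) <;> simp

theorem pathClass_trans {p : Path x y} {q : Path y z} (hp : ∀ t, p t ∈ U) (hq : ∀ t, q t ∈ U)
    (h : ∀ t, p.trans q t ∈ U) :
    pathClass (p.trans q) h = (pathClass p hp).trans (pathClass q hq) := by
  rw [pathClass, pathClass, pathClass, ← Path.Homotopic.Quotient.mk_trans]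
  congr 1
  ext t
  simp only [Path.trans_apply, Path.coe_mk_mk]
  split_ifs <;> rfl

theorem pathClass_symm {p : Path x y} (hp : ∀ t, p t ∈ U) (h : ∀ t, p.symm t ∈ U) :
    pathClass p.symm h = (pathClass p hp).symm := rfl

theorem Path.trans_mem {p : Path x y} {q : Path y z} (hp : ∀ t, p t ∈ U) (hq : ∀ t, q t ∈ U)
    (t : I) : p.trans q t ∈ U := by
  rw [Path.trans_apply]
  split_ifs
  exacts [hp _, hq _]

theorem Path.symm_mem {p : Path x y} (hp : ∀ t, p t ∈ U) (t : I) : p.symm t ∈ U := hp _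

end PathClass

section QuotientAlgebra

variable {X : Type*} [TopologicalSpace X] {x y z : X}

theorem quotient_symm_trans_cancel (a : Path.Homotopic.Quotient x y)
    (b : Path.Homotopic.Quotient y z) : a.symm.trans (a.trans b) = b := by
  rw [← Path.Homotopic.Quotient.trans_assoc, Path.Homotopic.Quotient.symm_trans,
    Path.Homotopic.Quotient.refl_trans]

theorem quotient_trans_symm_cancel (a : Path.Homotopic.Quotient x y)
    (b : Path.Homotopic.Quotient x z) : a.trans (a.symm.trans b) = b := by
  rw [← Path.Homotopic.Quotient.trans_assoc, Path.Homotopic.Quotient.trans_symm,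
    Path.Homotopic.Quotient.refl_trans]

theorem quotient_trans_symm_rev (a : Path.Homotopic.Quotient x y)
    (b : Path.Homotopic.Quotient y z) : (a.trans b).symm = b.symm.trans a.symm := by
  induction a using Path.Homotopic.Quotient.ind
  induction b using Path.Homotopic.Quotient.ind
  rw [← Path.Homotopic.Quotient.mk_trans, ← Path.Homotopic.Quotient.mk_symm, Path.trans_symm]
  rfl

end QuotientAlgebra

/-! ### Paths in the plane as paths in the sphere -/

/-- A path in `ℂ` seen as a path in the sphere. -/
def spherePath {x y : ℂ} (p : Path x y) : Path (x : OnePoint ℂ) y := p.map OnePoint.continuous_coe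

@[simp] theorem spherePath_apply {x y : ℂ} (p : Path x y) (t : I) : spherePath p t = (p t : ℂ) := rfl

theorem spherePath_trans {x y z : ℂ} (p : Path x y) (q : Path y z) :
    spherePath (p.trans q) = (spherePath p).trans (spherePath q) := Path.map_trans _ _ _

theorem spherePath_symm {x y : ℂ} (p : Path x y) : spherePath p.symm = (spherePath p).symm :=
  (Path.map_symm _ _).symm

theorem coe_mem_puncturedHalfPlane {V : Finset ℂ} {r : ℝ} {z : ℂ} :
    (z : OnePoint ℂ) ∈ puncturedHalfPlane V r ↔ r < z.re ∧ z ∉ V := by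
  simp [puncturedHalfPlane]

theorem infty_mem_puncturedHalfPlane {V : Finset ℂ} {r : ℝ} :
    (∞ : OnePoint ℂ) ∈ puncturedHalfPlane V r := by
  simp [puncturedHalfPlane]

theorem pinchedHomotopic_spherePath {U : Set (OnePoint ℂ)} {x y : ℂ} {p q : Path x y} {S : Set ℂ}
    (hS : Convex ℝ S) (hU : ∀ z ∈ S, (z : OnePoint ℂ) ∈ U) (hp : ∀ t, t ≠ 0 → t ≠ 1 → p t ∈ S)
    (hq : ∀ t, t ≠ 0 → t ≠ 1 → q t ∈ S) :
    PinchedHomotopic U (spherePath p) (spherePath q) :=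
  pinchedHomotopic_of_convex (fun z : ℂ => (z : OnePoint ℂ)) convex_univ hS
    OnePoint.continuous_coe.continuousOn hU p.continuous q.continuous (by simp) (by simp)
    (fun _ => mem_univ _) (fun _ => mem_univ _) hp hq (fun _ => rfl) (fun _ => rfl)

/-- The part over `[a, b]` of a curve. -/
def pathOn {X : Type*} [TopologicalSpace X] {f : ℝ → X} (hf : Continuous f) {a b : ℝ} {x y : X}
    (ha : f a = x) (hb : f b = y) : Path x y where
  toFun t := f (a + t * (b - a))
  continuous_toFun := hf.comp (by fun_prop)
  source' := by simp [ha]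
  target' := by simp [hb]

theorem pathOn_apply {X : Type*} [TopologicalSpace X] {f : ℝ → X} (hf : Continuous f) {a b : ℝ}
    {x y : X} (ha : f a = x) (hb : f b = y) (t : I) :
    pathOn hf ha hb t = f (a + t * (b - a)) := rfl

theorem pathOn_mem_Icc {a b : ℝ} (hab : a ≤ b) (t : I) : a + t * (b - a) ∈ Icc a b := by
  have h0 := t.2.1
  have h1 := t.2.2
  constructor <;> nlinarith

theorem pathOn_mem_Ioo {a b : ℝ} (hab : a < b) {t : I} (h0 : t ≠ 0) (h1 : t ≠ 1) :
    a + t * (b - a) ∈ Ioo a b := by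
  have h0' : (0 : ℝ) < t := lt_of_le_of_ne t.2.1 (fun h => h0 (Subtype.ext h.symm))
  have h1' : (t : ℝ) < 1 := lt_of_le_of_ne t.2.2 (fun h => h1 (Subtype.ext h))
  constructor <;> nlinarith

/-- Both sides run along `f` over `[a, c]` and differ only in timing, so the homotopy takes place in
the interval of parameters. Only the open interval has to map into `U`, which lets the curve start
at a puncture. -/
theorem pathOn_trans_pinchedHomotopic {U : Set (OnePoint ℂ)} {f : ℝ → ℂ} (hf : Continuous f)
    {a b c : ℝ} {x y z : ℂ} (ha : f a = x) (hb : f b = y) (hc : f c = z)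
    (hab : a < b) (hbc : b < c) (hU : ∀ t ∈ Ioo a c, (f t : OnePoint ℂ) ∈ U) :
    PinchedHomotopic U (spherePath (pathOn hf ha hc))
      ((spherePath (pathOn hf ha hb)).trans (spherePath (pathOn hf hb hc))) := by
  have hid : Continuous (fun t : ℝ => t) := continuous_id
  let k (a b : ℝ) : Path a b := pathOn hid rfl rfl
  refine pinchedHomotopic_of_convex (fun t : ℝ => (f t : OnePoint ℂ)) convex_univ
    (convex_Ioo a c) (OnePoint.continuous_coe.comp hf).continuousOn hU
    (k := k a c) (l := (k a b).trans (k b c))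
    (Path.continuous _) (Path.continuous _) (by simp) (by simp) (fun _ => mem_univ _)
    (fun _ => mem_univ _) ?_ ?_ ?_ ?_
  · intro t h0 h1
    exact pathOn_mem_Ioo (hab.trans hbc) h0 h1
  · intro t h0 h1
    rw [Path.trans_apply]
    split_ifs with h
    · have := pathOn_mem_Icc hab.le
        ⟨2 * t, (unitInterval.mul_pos_mem_iff zero_lt_two).2 ⟨t.2.1, h⟩⟩
      refine ⟨?_, lt_of_le_of_lt this.2 hbc⟩
      have h0' : (0 : ℝ) < t := lt_of_le_of_ne t.2.1 (fun h => h0 (Subtype.ext h.symm))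
      simp only [k, pathOn_apply]
      nlinarith
    · have := pathOn_mem_Icc hbc.le
        ⟨2 * t - 1, unitInterval.two_mul_sub_one_mem_iff.2 ⟨(not_le.1 h).le, t.2.2⟩⟩
      refine ⟨lt_of_lt_of_le hab this.1, ?_⟩
      have h1' : (t : ℝ) < 1 := lt_of_le_of_ne t.2.2 (fun h => h1 (Subtype.ext h))
      simp only [k, pathOn_apply]
      nlinarith
  · intro t; rfl
  · intro t
    rw [Path.trans_apply, Path.trans_apply]
    split_ifs <;> rfl

/-- The straight segment from `x` to `y`. -/
def linePath (x y : ℂ) : Path x y where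
  toFun t := x + (t : ℝ) * (y - x)
  continuous_toFun := by fun_prop
  source' := by simp
  target' := by simp

theorem linePath_apply (x y : ℂ) (t : I) : linePath x y t = x + (t : ℝ) * (y - x) := rfl

theorem linePath_mem {S : Set ℂ} (hS : Convex ℝ S) {x y : ℂ} (hx : x ∈ S) (hy : y ∈ S) (t : I) :
    linePath x y t ∈ S := by
  have := hS hx hy (sub_nonneg.2 t.2.2) t.2.1 (by ring)
  convert this using 1
  simp [linePath_apply]; ring

theorem linePath_symm (x y : ℂ) : (linePath x y).symm = linePath y x := by
  ext t
  simp only [Path.symm_apply, Function.comp, linePath_apply, unitInterval.coe_symm_eq]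
  push_cast; ring

/-! ### Families of r-curves -/

theorem tendsto_nhds_infty_of_norm {α : Type*} {l : Filter α} {f : α → OnePoint ℂ}
    (h : ∀ B : ℝ, ∀ᶠ a in l, ∀ z : ℂ, f a = z → B < ‖z‖) : Tendsto f l (𝓝 ∞) := by
  rw [(OnePoint.hasBasis_nhds_infty (X := ℂ)).tendsto_right_iff]
  rintro s ⟨-, hs⟩
  obtain ⟨B, hB⟩ := hs.isBounded.subset_closedBall (0 : ℂ)
  filter_upwards [h B] with a ha
  rcases hfa : f a with _ | z
  · right; rfl
  · left
    refine ⟨z, fun hz => ?_, rfl⟩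
    have := ha z hfa
    have h2 := hB hz
    rw [mem_closedBall_zero_iff] at h2
    linarith

theorem tendsto_div_one_sub : Tendsto (fun s : I => Real.toNNReal ((s : ℝ) / (1 - s)))
    (𝓝[{s : I | (s : ℝ) < 1}] 1) atTop := by
  refine Real.tendsto_toNNReal_atTop.comp ?_
  have hsub : Tendsto (fun s : I => (1 : ℝ) - s) (𝓝[{s : I | (s : ℝ) < 1}] 1) (𝓝[>] 0) := by
    refine tendsto_nhdsWithin_iff.2 ⟨?_, ?_⟩
    · have : Tendsto (fun s : I => (1 : ℝ) - s) (𝓝 1) (𝓝 (1 - ((1 : I) : ℝ))) :=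
        (continuous_const.sub continuous_subtype_val).tendsto _
      simp only [Icc.coe_one, sub_self] at this
      exact this.mono_left nhdsWithin_le_nhds
    · filter_upwards [self_mem_nhdsWithin] with s hs
      simpa using hs
  have hs1 : Tendsto (fun s : I => (s : ℝ)) (𝓝[{s : I | (s : ℝ) < 1}] 1) (𝓝 1) := by
    have : Tendsto (fun s : I => (s : ℝ)) (𝓝 1) (𝓝 ((1 : I) : ℝ)) :=
      continuous_subtype_val.tendsto _
    exact this.mono_left nhdsWithin_le_nhds
  simpa [div_eq_mul_inv] using hs1.pos_mul_atTop one_pos (tendsto_inv_nhdsGT_zero.comp hsub)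

theorem rExtend_of_lt {γ : ℝ≥0 → ℂ} {t : I} (ht : (t : ℝ) < 1) :
    rExtend γ t = (γ (Real.toNNReal ((t : ℝ) / (1 - t))) : ℂ) := if_pos ht

theorem rExtend_one {γ : ℝ≥0 → ℂ} : rExtend γ 1 = ∞ := by simp [rExtend]

theorem rExtend_mem {U : Set (OnePoint ℂ)} {γ : ℝ≥0 → ℂ} (hinf : ∞ ∈ U)
    (h : ∀ t, 0 < t → (γ t : OnePoint ℂ) ∈ U) {t : I} (ht : t ≠ 0) : rExtend γ t ∈ U := by
  by_cases h1 : (t : ℝ) < 1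
  · rw [rExtend_of_lt h1]
    refine h _ ?_
    have : (0 : ℝ) < t := lt_of_le_of_ne t.2.1 (fun h => ht (Subtype.ext h.symm))
    simpa using div_pos this (by linarith)
  · rw [rExtend, if_neg h1]; exact hinf

theorem interiorIn_rPath {U : Set (OnePoint ℂ)} {γ : ℝ≥0 → ℂ} (hγ : IsRCurve γ) {z : ℂ}
    (hz : γ 0 = z) (hinf : ∞ ∈ U) (h : ∀ t, 0 < t → (γ t : OnePoint ℂ) ∈ U) :
    InteriorIn U (rPath hγ hz) := fun _ h0 _ => rExtend_mem hinf h h0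

/-- A continuous family of r-curves with real parts tending uniformly to `+∞`. -/
structure IsRFamily (ψ : I → ℝ≥0 → ℂ) : Prop where
  cont : Continuous fun x : I × ℝ≥0 => ψ x.1 x.2
  escape : ∃ m : ℝ≥0 → ℝ, Tendsto m atTop atTop ∧ ∀ u t, m t ≤ (ψ u t).re

theorem IsRFamily.isRCurve {ψ : I → ℝ≥0 → ℂ} (h : IsRFamily ψ) (u : I) : IsRCurve (ψ u) := by
  refine ⟨h.cont.comp (by fun_prop : Continuous fun t : ℝ≥0 => (u, t)), ?_⟩
  obtain ⟨m, hm, hle⟩ := h.escape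
  exact tendsto_atTop_mono (hle u) hm

/-- The delicate points are those over `∞`: there the lower bound `m`, common to all members of the
family, makes the escape uniform in the parameter. -/
theorem IsRFamily.continuous_rExtend {ψ : I → ℝ≥0 → ℂ} (h : IsRFamily ψ) :
    Continuous fun x : I × I => rExtend (ψ x.1) x.2 := by
  rw [continuous_iff_continuousAt]
  rintro ⟨u, t⟩
  by_cases ht : (t : ℝ) < 1
  · have hev : (fun x : I × I => rExtend (ψ x.1) x.2) =ᶠ[𝓝 (u, t)]
        fun x : I × I => ((ψ x.1 (Real.toNNReal ((x.2 : ℝ) / (1 - x.2))) : ℂ) : OnePoint ℂ) := by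
      have : {x : I × I | (x.2 : ℝ) < 1} ∈ 𝓝 (u, t) :=
        (isOpen_lt (by fun_prop) continuous_const).mem_nhds ht
      filter_upwards [this] with s hs
      exact if_pos hs
    refine ContinuousAt.congr ?_ hev.symm
    have h1 : ContinuousAt (fun x : I × I => (x.2 : ℝ) / (1 - x.2)) (u, t) :=
      ContinuousAt.div (by fun_prop) (by fun_prop) (by dsimp only; linarith)
    have h2 : ContinuousAt (fun x : I × I => (x.1, Real.toNNReal ((x.2 : ℝ) / (1 - x.2)))) (u, t) :=
      continuousAt_fst.prodMk (continuous_real_toNNReal.continuousAt.comp h1)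
    exact (OnePoint.continuous_coe.comp h.cont).continuousAt.comp h2
  · obtain rfl : t = 1 := Subtype.ext (le_antisymm t.2.2 (not_lt.1 ht))
    rw [ContinuousAt]
    simp only [rExtend_one]
    refine tendsto_nhds_infty_of_norm fun B => ?_
    obtain ⟨m, hm, hle⟩ := h.escape
    have h1 := (hm.comp tendsto_div_one_sub).eventually (eventually_gt_atTop B)
    rw [eventually_nhdsWithin_iff] at h1
    have h2 : Tendsto (fun x : I × I => x.2) (𝓝 (u, 1)) (𝓝 1) := continuous_snd.tendsto _
    filter_upwards [h2.eventually h1] with x hx z hz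
    by_cases hx1 : (x.2 : ℝ) < 1
    · rw [rExtend_of_lt hx1, OnePoint.coe_eq_coe] at hz
      subst hz
      exact (hx hx1).trans_le ((hle _ _).trans (Complex.re_le_norm _))
    · rw [rExtend, if_neg hx1] at hz
      exact absurd hz (OnePoint.infty_ne_coe _)

theorem IsRFamily.pinchedHomotopic {U : Set (OnePoint ℂ)} {ψ : I → ℝ≥0 → ℂ} (h : IsRFamily ψ)
    (hinf : ∞ ∈ U) {z : ℂ} (hz : ∀ u, ψ u 0 = z) (hU : ∀ u t, 0 < t → (ψ u t : OnePoint ℂ) ∈ U)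
    {α β : ℝ≥0 → ℂ} (hα : IsRCurve α) (hβ : IsRCurve β) (hα0 : α 0 = z) (hβ0 : β 0 = z)
    (h0 : ψ 0 = α) (h1 : ψ 1 = β) :
    PinchedHomotopic U (rPath hα hα0) (rPath hβ hβ0) := by
  subst h0 h1
  refine pinchedHomotopic_of_map (fun x : I × I => rExtend (ψ x.1) x.2) h.continuous_rExtend
    (fun _ => rfl) (fun _ => rfl) (fun u => ?_) (fun _ => rExtend_one)
    fun u t h0 _ => rExtend_mem hinf (hU u) h0
  simp [rExtend, hz]

/-- The family fills a square. Two of its sides give `a` followed by the last curve, the other two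
give the first curve followed by the constant path at `∞`; paths in a square with the same ends are
homotopic. -/
theorem IsRFamily.pinchedHomotopic_moving {U : Set (OnePoint ℂ)} {ψ : I → ℝ≥0 → ℂ}
    (h : IsRFamily ψ) (hinf : ∞ ∈ U) (hU : ∀ u t, (ψ u t : OnePoint ℂ) ∈ U) {x y : ℂ} (a : Path x y)
    (ha : ∀ u, ψ u 0 = a u) {α β : ℝ≥0 → ℂ} (hα : IsRCurve α) (hβ : IsRCurve β) (hα0 : α 0 = x)
    (hβ0 : β 0 = y) (h0 : ψ 0 = α) (h1 : ψ 1 = β) :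
    PinchedHomotopic U ((spherePath a).trans (rPath hβ hβ0)) (rPath hα hα0) := by
  subst h0 h1
  have hx : (x : OnePoint ℂ) ∈ U := by
    have := hU 0 0
    rwa [ha, a.source] at this
  have hmem : ∀ u t, rExtend (ψ u) t ∈ U := fun u t => by
    by_cases ht : t = 0
    · subst ht
      rw [rExtend, if_pos (by simp)]
      exact hU _ _
    · exact rExtend_mem hinf (fun t _ => hU u t) ht
  refine PinchedHomotopic.trans ?_ (PinchedHomotopic.trans_refl
    (InteriorIn.of_mem fun t => hmem 0 t) hinf)
  have hid : Continuous fun t : ℝ => t := continuous_id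
  have hproj : Continuous (projIcc (0 : ℝ) 1 zero_le_one) := continuous_projIcc
  let p0 : Path (0 : ℝ) 1 := ⟨⟨fun t => t, by fun_prop⟩, rfl, rfl⟩
  refine pinchedHomotopic_of_convex (E := ℝ × ℝ) (S := univ) (T := univ)
    (fun x : ℝ × ℝ => rExtend (ψ (projIcc 0 1 zero_le_one x.1)) (projIcc 0 1 zero_le_one x.2))
    convex_univ convex_univ
    (h.continuous_rExtend.comp (by fun_prop :
      Continuous fun x : ℝ × ℝ => (projIcc (0 : ℝ) 1 zero_le_one x.1,
        projIcc (0 : ℝ) 1 zero_le_one x.2))).continuousOn (fun x _ => hmem _ _)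
    (k := (p0.prod (Path.refl (0 : ℝ))).trans ((Path.refl (1 : ℝ)).prod p0))
    (l := ((Path.refl (0 : ℝ)).prod p0).trans (p0.prod (Path.refl (1 : ℝ))))
    (Path.continuous _) (Path.continuous _) (by simp) (by simp) (fun _ => mem_univ _)
    (fun _ => mem_univ _) (fun _ _ _ => mem_univ _) (fun _ _ _ => mem_univ _) ?_ ?_
  · intro t
    rw [Path.trans_apply, Path.trans_apply]
    split_ifs with ht
    · simp only [spherePath_apply, Path.prod_coe, Path.refl_apply]
      rw [rExtend, if_pos (by simp)]
      simp only [projIcc_left, zero_div, Real.toNNReal_zero, ha]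
      congr 2
      exact (projIcc_val zero_le_one _).symm
    · simp only [Path.prod_coe, Path.refl_apply, projIcc_right]
      change rExtend (ψ 1) _ = rExtend (ψ 1) _
      congr 1
      exact (projIcc_val zero_le_one _).symm
  · intro t
    rw [Path.trans_apply, Path.trans_apply]
    split_ifs with ht
    · simp only [Path.prod_coe, Path.refl_apply, projIcc_left]
      change rExtend (ψ 0) _ = rExtend (ψ 0) _
      congr 1
      exact (projIcc_val zero_le_one _).symm
    · simp only [Path.prod_coe, Path.refl_apply, projIcc_right]
      exact rExtend_one.symm

end

/-! ### Reading words off the crossings with slits. -/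

noncomputable section

/-! ### Slanted rays and slits -/

/-- The direction `1 + δ i` of the rays. -/
def rayDir (δ : ℝ) : ℂ := 1 + δ * Complex.I

/-- The linear function whose level lines have direction `1 + δ i`. -/
def slantHeight (δ : ℝ) : ℂ →ₗ[ℝ] ℝ := Complex.imLm - δ • Complex.reLm

theorem slantHeight_apply (δ : ℝ) (z : ℂ) : slantHeight δ z = z.im - δ * z.re := by
  simp [slantHeight]

@[simp] theorem rayDir_re (δ : ℝ) : (rayDir δ).re = 1 := by simp [rayDir]

@[simp] theorem rayDir_im (δ : ℝ) : (rayDir δ).im = δ := by simp [rayDir]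

theorem slantHeight_add_ray (δ s : ℝ) (z : ℂ) :
    slantHeight δ (z + s * rayDir δ) = slantHeight δ z := by
  simp [slantHeight_apply]; ring

theorem add_ray_re (δ s : ℝ) (z : ℂ) : (z + s * rayDir δ).re = z.re + s := by
  simp

/-- The union of the rays to the left from the points of `V`. -/
def slits (V : Finset ℂ) (δ : ℝ) : Set ℂ :=
  {z | ∃ w ∈ V, slantHeight δ z = slantHeight δ w ∧ z.re ≤ w.re}

theorem subset_slits {V : Finset ℂ} {δ : ℝ} {z : ℂ} (hz : z ∈ V) : z ∈ slits V δ :=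
  ⟨z, hz, rfl, le_rfl⟩

theorem add_ray_notMem_slits {V : Finset ℂ} {δ s : ℝ} {z : ℂ} (hz : z ∉ slits V δ) (hs : 0 ≤ s) :
    z + s * rayDir δ ∉ slits V δ := by
  rintro ⟨w, hw, h1, h2⟩
  rw [slantHeight_add_ray] at h1
  rw [add_ray_re] at h2
  exact hz ⟨w, hw, h1, by linarith⟩

theorem notMem_slits_of_re {V : Finset ℂ} {δ : ℝ} {z : ℂ} (hz : ∀ w ∈ V, w.re < z.re) :
    z ∉ slits V δ := by
  rintro ⟨w, hw, -, h2⟩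
  exact absurd (hz w hw) (not_lt.2 h2)

theorem isRCurve_ray (δ : ℝ) (x : ℂ) : IsRCurve fun s : ℝ≥0 => x + (s : ℝ) * rayDir δ := by
  refine ⟨by fun_prop, ?_⟩
  simp only [add_ray_re]
  exact tendsto_atTop_add_const_left _ _ (NNReal.tendsto_coe_atTop.2 tendsto_id)

/-- The ray `x + s (1 + δ i)` from `x` to `∞`. -/
def rayPath (δ : ℝ) (x : ℂ) : Path (x : OnePoint ℂ) ∞ := rPath (isRCurve_ray δ x) (by simp)

/-- The complement of the slits in the half-plane `Re z > r`. -/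
def slitPlane (V : Finset ℂ) (δ r : ℝ) : Set ℂ := {z | r < z.re ∧ z ∉ slits V δ}

theorem slitPlane_mem {V : Finset ℂ} {δ r : ℝ} {z : ℂ} (hz : z ∈ slitPlane V δ r) :
    (z : OnePoint ℂ) ∈ puncturedHalfPlane V r :=
  coe_mem_puncturedHalfPlane.2 ⟨hz.1, fun h => hz.2 (subset_slits h)⟩

theorem add_ray_mem_slitPlane {V : Finset ℂ} {δ r s : ℝ} {z : ℂ} (hz : z ∈ slitPlane V δ r)
    (hs : 0 ≤ s) : z + s * rayDir δ ∈ slitPlane V δ r :=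
  ⟨by rw [add_ray_re]; linarith [hz.1], add_ray_notMem_slits hz.2 hs⟩

theorem rPath_mem {V : Finset ℂ} {r : ℝ} {γ : ℝ≥0 → ℂ} (hγ : IsRCurve γ) {z : ℂ} (hz : γ 0 = z)
    (h : ∀ t, (γ t : OnePoint ℂ) ∈ puncturedHalfPlane V r) (t : I) :
    rPath hγ hz t ∈ puncturedHalfPlane V r := by
  refine InteriorIn.mem (interiorIn_rPath hγ hz infty_mem_puncturedHalfPlane fun t _ => h t) ?_
    infty_mem_puncturedHalfPlane t
  rw [← hz]; exact h 0

theorem rayPath_mem {V : Finset ℂ} {δ r : ℝ} {x : ℂ} (hx : x ∈ slitPlane V δ r) (t : I) :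
    rayPath δ x t ∈ puncturedHalfPlane V r :=
  rPath_mem _ _ (fun t => slitPlane_mem (add_ray_mem_slitPlane hx t.2)) t

/-- A path in the slit plane followed by a ray is homotopic to a ray. -/
theorem trans_rayPath {V : Finset ℂ} {δ r : ℝ} {x y : ℂ} (a : Path x y)
    (ha : ∀ t, a t ∈ slitPlane V δ r) :
    PinchedHomotopic (puncturedHalfPlane V r) ((spherePath a).trans (rayPath δ y))
      (rayPath δ x) := by
  have hfam : IsRFamily fun u s => a u + ((s : ℝ≥0) : ℝ) * rayDir δ := by
    refine ⟨by fun_prop, fun s => r + s,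
      tendsto_atTop_add_const_left _ _ (NNReal.tendsto_coe_atTop.2 tendsto_id), fun u t => ?_⟩
    rw [add_ray_re]
    linarith [(ha u).1]
  exact hfam.pinchedHomotopic_moving infty_mem_puncturedHalfPlane
    (fun u t => slitPlane_mem (add_ray_mem_slitPlane (ha u) t.2)) a (fun u => by simp)
    _ _ _ _ (by simp) (by simp)

/-- An r-curve in the slit plane is homotopic to a ray. -/
theorem rPath_pinchedHomotopic_rayPath {V : Finset ℂ} {δ r : ℝ} {γ : ℝ≥0 → ℂ} (hγ : IsRCurve γ)
    {z : ℂ} (hz : γ 0 = z) (h : ∀ t, γ t ∈ slitPlane V δ r) :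
    PinchedHomotopic (puncturedHalfPlane V r) (rPath hγ hz) (rayPath δ z) := by
  have hc := hγ.1
  -- Two families are needed because `γ (u t)` alone does not escape for `u = 0`. The first one adds
  -- the term `t (1 + δ i)`; the second one, run backwards, freezes `γ` at its starting point while
  -- that term provides the escape.
  have h1 : IsRFamily fun u t => γ t + ((u * t : ℝ) : ℂ) * rayDir δ := by
    refine ⟨by fun_prop, fun t => (γ t).re, hγ.2, fun u t => ?_⟩
    rw [add_ray_re]
    exact le_add_of_nonneg_right (mul_nonneg u.2.1 t.2)
  have h2 : IsRFamily fun u t => γ (Real.toNNReal u * t) + ((t : ℝ≥0) : ℝ) * rayDir δ := by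
    refine ⟨by fun_prop, fun s => r + s,
      tendsto_atTop_add_const_left _ _ (NNReal.tendsto_coe_atTop.2 tendsto_id), fun u t => ?_⟩
    rw [add_ray_re]
    linarith [(h (Real.toNNReal u * t)).1]
  have e1 := h1.pinchedHomotopic (U := puncturedHalfPlane V r) infty_mem_puncturedHalfPlane
    (z := z) (fun u => by simp [hz])
    (fun u t _ => slitPlane_mem (add_ray_mem_slitPlane (h t) (mul_nonneg u.2.1 t.2)))
    hγ (h1.isRCurve 1) hz (by simp [hz]) (by simp) rfl
  have e2 := h2.pinchedHomotopic (U := puncturedHalfPlane V r) infty_mem_puncturedHalfPlane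
    (z := z) (fun u => by simp [hz])
    (fun u t _ => slitPlane_mem (add_ray_mem_slitPlane (h _) t.2))
    (isRCurve_ray δ z) (h1.isRCurve 1) (by simp) (by simp [hz]) (by simp [hz]) (by simp)
  exact e1.trans e2.symm

/-! ### Admissible slopes and radii -/

/-- The slope `δ` of the rays is generic for `V` and small, and `ρ` is small compared to `δ`. -/
structure IsAdmissible (V : Finset ℂ) (δ ρ : ℝ) : Prop where
  pos : 0 < δ
  lt_one : δ < 1
  disk : IsDiskRadius V ρ
  gap : ∀ u ∈ V, ∀ w ∈ V, u ≠ w → 4 * ρ < |slantHeight δ u - slantHeight δ w|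
  -- Keeps the slit of a higher point `u` above the straight curve of `w`: half-circles rise by at
  -- most `ρ`, and to the right of `w` the slit has dropped by at most `δ |u.re - w.re|`.
  arm : ∀ u ∈ V, ∀ w ∈ V, w.im < u.im → w.im + ρ + δ * |u.re - w.re| < u.im

/-- Two points have equal slant height for at most one slope, so small positive slopes separate all
points of `V` and avoid the finite set `B`. The other conditions are strict inequalities that hold
for slope and radius 0. The radius is chosen after the slope, and every smaller one works as well,
so that it can be compared with a given radius. -/
theorem exists_isAdmissible (V : Finset ℂ) {B : Set ℝ} (hB : B.Finite) :
    ∃ δ ∉ B, ∃ ρ₀ > 0, ∀ ρ, 0 < ρ → ρ ≤ ρ₀ → IsAdmissible V δ ρ := by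
  have e1 : ∀ᶠ δ in 𝓝[>] (0 : ℝ), 0 < δ := self_mem_nhdsWithin
  have e2 : ∀ᶠ δ in 𝓝[>] (0 : ℝ), δ < 1 :=
    nhdsWithin_le_nhds (eventually_lt_nhds zero_lt_one)
  have e3 : ∀ᶠ δ in 𝓝[>] (0 : ℝ), δ ∉ B := by
    have h1 : ∀ᶠ δ in 𝓝 (0 : ℝ), δ ∉ B \ {0} :=
      (hB.subset sdiff_subset).isClosed.isOpen_compl.mem_nhds (by simp)
    filter_upwards [nhdsWithin_le_nhds h1, e1] with δ h2 h3 h4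
    exact h2 ⟨h4, h3.ne'⟩
  have e4 : ∀ᶠ δ in 𝓝[>] (0 : ℝ), ∀ u ∈ V, ∀ w ∈ V, u ≠ w →
      slantHeight δ u ≠ slantHeight δ w := by
    rw [Finset.eventually_all]
    intro u _
    rw [Finset.eventually_all]
    intro w _
    by_cases h : u = w
    · simp [h]
    by_cases him : u.im = w.im
    · filter_upwards [e1] with δ hδ _ heq
      rw [slantHeight_apply, slantHeight_apply, him] at heq
      have : δ * (u.re - w.re) = 0 := by linarith
      rcases mul_eq_zero.1 this with h' | h'
      · exact hδ.ne' h'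
      · exact h (Complex.ext (by linarith) him)
    · have hc : Continuous fun δ : ℝ => slantHeight δ u - slantHeight δ w := by
        simp only [slantHeight_apply]; fun_prop
      have h0 : slantHeight 0 u - slantHeight 0 w ≠ 0 := by
        simp only [slantHeight_apply]
        intro h; exact him (by linarith)
      have := hc.continuousAt.eventually_ne h0
      filter_upwards [nhdsWithin_le_nhds this] with δ hδ _ heq
      exact hδ (by linarith)
  have e5 : ∀ᶠ δ in 𝓝[>] (0 : ℝ), ∀ u ∈ V, ∀ w ∈ V, w.im < u.im →
      w.im + δ * |u.re - w.re| < u.im := by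
    rw [Finset.eventually_all]
    intro u _
    rw [Finset.eventually_all]
    intro w _
    by_cases h : w.im < u.im
    · have hc : Continuous fun δ : ℝ => w.im + δ * |u.re - w.re| := by fun_prop
      have := hc.continuousAt.eventually_lt (x₀ := 0) continuousAt_const (by simpa using h)
      filter_upwards [nhdsWithin_le_nhds this] with δ hδ _ using hδ
    · simp [h]
  obtain ⟨δ, h1, h2, h3, h4, h5⟩ := (e1.and (e2.and (e3.and (e4.and e5)))).exists
  refine ⟨δ, h3, ?_⟩
  have f1 : ∀ᶠ ρ in 𝓝[>] (0 : ℝ), ∀ u ∈ V, ∀ w ∈ V, u ≠ w → 2 * ρ < dist u w := by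
    rw [Finset.eventually_all]
    intro u _
    rw [Finset.eventually_all]
    intro w _
    by_cases h : u = w
    · simp [h]
    have hc : Continuous fun ρ : ℝ => 2 * ρ := by fun_prop
    have := hc.continuousAt.eventually_lt (x₀ := 0) continuousAt_const
      (by simpa using dist_pos.2 h : 2 * (0 : ℝ) < dist u w)
    filter_upwards [nhdsWithin_le_nhds this] with δ hδ _ using hδ
  have f2 : ∀ᶠ ρ in 𝓝[>] (0 : ℝ), ∀ u ∈ V, ∀ w ∈ V, u ≠ w →
      4 * ρ < |slantHeight δ u - slantHeight δ w| := by
    rw [Finset.eventually_all]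
    intro u hu
    rw [Finset.eventually_all]
    intro w hw
    by_cases h : u = w
    · simp [h]
    have hc : Continuous fun ρ : ℝ => 4 * ρ := by fun_prop
    have := hc.continuousAt.eventually_lt (x₀ := 0) continuousAt_const
      (by simpa using sub_ne_zero.2 (h4 u hu w hw h) :
        4 * (0 : ℝ) < |slantHeight δ u - slantHeight δ w|)
    filter_upwards [nhdsWithin_le_nhds this] with δ hδ _ using hδ
  have f3 : ∀ᶠ ρ in 𝓝[>] (0 : ℝ), ∀ u ∈ V, ∀ w ∈ V, w.im < u.im →
      w.im + ρ + δ * |u.re - w.re| < u.im := by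
    rw [Finset.eventually_all]
    intro u hu
    rw [Finset.eventually_all]
    intro w hw
    by_cases h : w.im < u.im
    · have hc : Continuous fun ρ : ℝ => w.im + ρ + δ * |u.re - w.re| := by fun_prop
      have := hc.continuousAt.eventually_lt (x₀ := 0) continuousAt_const
        (by simpa using h5 u hu w hw h)
      filter_upwards [nhdsWithin_le_nhds this] with δ hδ _ using hδ
    · simp [h]
  have f := f1.and (f2.and f3)
  obtain ⟨ρ₀, hρ₀, hsub⟩ := (mem_nhdsGT_iff_exists_Ioc_subset (α := ℝ)).1 f
  refine ⟨ρ₀, hρ₀, fun ρ hρ hle => ?_⟩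
  obtain ⟨g1, g2, g3⟩ := hsub ⟨hρ, hle⟩
  exact ⟨h1, h2, ⟨hρ, g1⟩, g2, g3⟩

/-! ### The straight curves -/

/-- The height of the half-circles of the straight curve of `w` over the abscissa `x`. -/
def bumpHeight (V : Finset ℂ) (ρ : ℝ) (w : ℂ) (x : ℝ) : ℝ :=
  ∑ u ∈ V with u.im = w.im ∧ w.re < u.re, Real.sqrt (ρ ^ 2 - (x - u.re) ^ 2)

theorem straightCurve_re (V : Finset ℂ) (ρ : ℝ) (w : ℂ) (s : ℝ) :
    (straightCurve V ρ w s).re = w.re + s := by simp [straightCurve]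

theorem straightCurve_im (V : Finset ℂ) (ρ : ℝ) (w : ℂ) (s : ℝ) :
    (straightCurve V ρ w s).im = w.im + bumpHeight V ρ w (w.re + s) := by
  simp [straightCurve, bumpHeight]

theorem bumpHeight_nonneg (V : Finset ℂ) (ρ : ℝ) (w : ℂ) (x : ℝ) : 0 ≤ bumpHeight V ρ w x :=
  Finset.sum_nonneg fun _ _ => Real.sqrt_nonneg _

/-- The disks are disjoint, so at most one summand is nonzero over a given abscissa. -/
theorem bumpHeight_cases {V : Finset ℂ} {ρ : ℝ} (hρ : IsDiskRadius V ρ) (w : ℂ) (x : ℝ) :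
    bumpHeight V ρ w x = 0 ∨ ∃ u ∈ V, u.im = w.im ∧ w.re < u.re ∧ |x - u.re| < ρ ∧
      bumpHeight V ρ w x = Real.sqrt (ρ ^ 2 - (x - u.re) ^ 2) := by
  by_cases h : ∃ u ∈ V, (u.im = w.im ∧ w.re < u.re) ∧ |x - u.re| < ρ
  · right
    obtain ⟨u, hu, ⟨h1, h2⟩, h3⟩ := h
    refine ⟨u, hu, h1, h2, h3, ?_⟩
    refine Finset.sum_eq_single_of_mem u (Finset.mem_filter.2 ⟨hu, h1, h2⟩) fun v hv hne => ?_
    rw [Finset.mem_filter] at hv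
    apply Real.sqrt_eq_zero_of_nonpos
    have hd := hρ.2 u hu v hv.1 hne.symm
    rw [Complex.dist_of_im_eq (h1.trans hv.2.1.symm), Real.dist_eq] at hd
    have : ρ ≤ |x - v.re| := by
      have := abs_sub_abs_le_abs_sub (u.re - v.re) (u.re - x)
      rw [abs_sub_comm u.re x] at this
      have e : u.re - v.re - (u.re - x) = x - v.re := by ring
      rw [e] at this
      linarith
    have := sq_le_sq' (by linarith [abs_nonneg (x - v.re), hρ.1]) this
    rw [sq_abs] at this
    linarith
  · left
    push Not at h
    refine Finset.sum_eq_zero fun v hv => ?_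
    rw [Finset.mem_filter] at hv
    apply Real.sqrt_eq_zero_of_nonpos
    have h1 := h v hv.1 hv.2
    have := sq_le_sq' (by linarith [abs_nonneg (x - v.re), hρ.1]) h1
    rw [sq_abs] at this
    linarith

theorem bumpHeight_le {V : Finset ℂ} {ρ : ℝ} (hρ : IsDiskRadius V ρ) (w : ℂ) (x : ℝ) :
    bumpHeight V ρ w x ≤ ρ := by
  rcases bumpHeight_cases hρ w x with h | ⟨u, -, -, -, -, h⟩
  · rw [h]; exact hρ.1.le
  · rw [h]
    refine Real.sqrt_le_iff.2 ⟨hρ.1.le, ?_⟩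
    nlinarith [sq_nonneg (x - u.re)]

theorem bumpHeight_self {V : Finset ℂ} {ρ : ℝ} (hρ : 0 < ρ) {u w : ℂ} (hu : u ∈ V)
    (him : u.im = w.im) (hre : w.re < u.re) : ρ ≤ bumpHeight V ρ w u.re := by
  have := Finset.single_le_sum (f := fun v : ℂ => Real.sqrt (ρ ^ 2 - (u.re - v.re) ^ 2))
    (s := V.filter fun v => v.im = w.im ∧ w.re < v.re) (fun _ _ => Real.sqrt_nonneg _)
    (Finset.mem_filter.2 ⟨hu, him, hre⟩)
  simpa [bumpHeight, Real.sqrt_sq hρ.le] using this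

/-- A point of `V` to the right of `w` at the same height lies under a half-circle of height `ρ`. A
point of `V` at another height would have to lie on a half-circle, at distance `ρ` from a centre in
`V`, but points of `V` are more than `2 ρ` apart. -/
theorem straightCurve_notMem {V : Finset ℂ} {ρ : ℝ} (hρ : IsDiskRadius V ρ) {w : ℂ} {s : ℝ}
    (hs : 0 < s) : straightCurve V ρ w s ∉ V := by
  intro hv
  set v := straightCurve V ρ w s with hvdef
  have hre : v.re = w.re + s := straightCurve_re V ρ w s
  have him : v.im = w.im + bumpHeight V ρ w v.re := by rw [hre]; exact straightCurve_im V ρ w s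
  by_cases h : v.im = w.im
  · have := bumpHeight_self hρ.1 hv h (by linarith)
    linarith [hρ.1]
  · rcases bumpHeight_cases hρ w v.re with h0 | ⟨u, hu, h1, h2, h3, h4⟩
    · exact h (by rw [him, h0, add_zero])
    · have hne : u ≠ v := fun e => h (e ▸ h1)
      have hd := hρ.2 u hu v hv hne
      have hsq : (v.im - u.im) ^ 2 = ρ ^ 2 - (v.re - u.re) ^ 2 := by
        rw [h1, him, h4, add_sub_cancel_left, Real.sq_sqrt]
        nlinarith [abs_lt.1 h3]
      have hd2 : dist u v ^ 2 = ρ ^ 2 := by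
        rw [Complex.dist_eq, Complex.sq_norm, Complex.normSq_apply]
        simp only [Complex.sub_re, Complex.sub_im]
        linarith
      nlinarith [hρ.1]

/-- Slits descend to the left. Those of points below `w` stay below the curve; one at the height of
`w` meets the horizontal line only at its end point, where the curve makes a half-circle; those of
higher points pass above by `arm`. -/
theorem straightCurve_mem_slitPlane {V : Finset ℂ} {δ ρ r : ℝ} (h : IsAdmissible V δ ρ) {w : ℂ}
    (hw : w ∈ V) {s : ℝ} (hs : 0 < s) (hr : r < w.re) : straightCurve V ρ w s ∈ slitPlane V δ r := by
  have hre : (straightCurve V ρ w s).re = w.re + s := straightCurve_re V ρ w s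
  have him := straightCurve_im V ρ w s
  refine ⟨by linarith, ?_⟩
  rintro ⟨v, hv, h1, h2⟩
  rw [slantHeight_apply, slantHeight_apply, hre, him] at h1
  rw [hre] at h2
  have hb0 := bumpHeight_nonneg V ρ w (w.re + s)
  have hb1 := bumpHeight_le h.disk w (w.re + s)
  have hδ := h.pos
  rcases lt_trichotomy v.im w.im with h3 | h3 | h3
  · nlinarith
  · have hprod : 0 ≤ δ * (v.re - (w.re + s)) := mul_nonneg hδ.le (by linarith)
    have hprod0 : δ * (v.re - (w.re + s)) = 0 := by nlinarith
    have hvre : v.re = w.re + s := by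
      rcases mul_eq_zero.1 hprod0 with h' | h'
      · exact absurd h' hδ.ne'
      · linarith
    have := bumpHeight_self h.disk.1 hv h3 (by linarith)
    rw [hvre] at this
    nlinarith [h.disk.1]
  · have := h.arm v hv w hw h3
    have h5 : v.re - w.re ≤ |v.re - w.re| := le_abs_self _
    nlinarith

end

noncomputable section

/-! ### Crossing a slit -/

/-- The part of the half-plane `Re z > r` to the left of `w` in a strip around the slit of `w`. -/
def slitStrip (δ ρ r : ℝ) (w : ℂ) : Set ℂ :=
  {z | z.re ∈ Ioo r w.re ∧
    slantHeight δ z ∈ Ioo (slantHeight δ w - 2 * ρ) (slantHeight δ w + 2 * ρ)}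

theorem convex_slitStrip (δ ρ r : ℝ) (w : ℂ) : Convex ℝ (slitStrip δ ρ r w) :=
  ((convex_Ioo r w.re).linear_preimage Complex.reLm).inter
    ((convex_Ioo _ _).linear_preimage (slantHeight δ))

theorem isOpen_slitStrip (δ ρ r : ℝ) (w : ℂ) : IsOpen (slitStrip δ ρ r w) := by
  have h : Continuous (slantHeight δ) := LinearMap.continuous_of_finiteDimensional _
  exact (isOpen_Ioo.preimage Complex.continuous_re).inter (isOpen_Ioo.preimage h)

/-- The heights of distinct slit lines differ by more than `4 ρ`, so no other slit line lies within
`2 ρ` of that of `w`. -/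
theorem eq_of_slantHeight {V : Finset ℂ} {δ ρ : ℝ} (h : IsAdmissible V δ ρ) {v w z : ℂ}
    (hv : v ∈ V) (hw : w ∈ V) (h1 : slantHeight δ z = slantHeight δ v)
    (h2 : |slantHeight δ z - slantHeight δ w| ≤ 2 * ρ) : v = w := by
  by_contra hne
  have := h.gap v hv w hw hne
  rw [h1] at h2
  linarith [h.disk.1]

theorem slitStrip_abs {δ ρ r : ℝ} {w z : ℂ} (hz : z ∈ slitStrip δ ρ r w) :
    |slantHeight δ z - slantHeight δ w| ≤ 2 * ρ :=
  abs_le.2 ⟨by linarith [hz.2.1], by linarith [hz.2.2]⟩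

theorem slitStrip_mem {V : Finset ℂ} {δ ρ r : ℝ} (h : IsAdmissible V δ ρ) {w z : ℂ} (hw : w ∈ V)
    (hz : z ∈ slitStrip δ ρ r w) : (z : OnePoint ℂ) ∈ puncturedHalfPlane V r := by
  refine coe_mem_puncturedHalfPlane.2 ⟨hz.1.1, fun hv => ?_⟩
  have := eq_of_slantHeight h hv hw rfl (slitStrip_abs hz)
  exact absurd hz.1.2 (by rw [this]; exact lt_irrefl _)

theorem slitStrip_mem_slitPlane {V : Finset ℂ} {δ ρ r : ℝ} (h : IsAdmissible V δ ρ) {w z : ℂ}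
    (hw : w ∈ V) (hz : z ∈ slitStrip δ ρ r w) (hne : slantHeight δ z ≠ slantHeight δ w) :
    z ∈ slitPlane V δ r := by
  refine ⟨hz.1.1, ?_⟩
  rintro ⟨v, hv, h1, -⟩
  have := eq_of_slantHeight h hv hw h1 (slitStrip_abs hz)
  exact hne (this ▸ h1)

/-- The parametrized clockwise circle. -/
def circleCurve (ρ : ℝ) (w : ℂ) (θ : ℝ) : ℂ :=
  w + ρ * Complex.exp (-(2 * Real.pi * Complex.I * θ))

theorem continuous_circleCurve (ρ : ℝ) (w : ℂ) : Continuous (circleCurve ρ w) := by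
  unfold circleCurve; fun_prop

theorem circleCurve_eq (ρ : ℝ) (w : ℂ) (θ : ℝ) : circleCurve ρ w θ =
    w + ρ * (Real.cos (2 * Real.pi * θ) - Real.sin (2 * Real.pi * θ) * Complex.I) := by
  rw [circleCurve, Complex.ofReal_cos, Complex.ofReal_sin, ← Complex.cos_neg,
    ← neg_neg (Complex.sin _), ← Complex.sin_neg, neg_mul, sub_neg_eq_add, ← Complex.exp_mul_I]
  congr 3
  push_cast; ring

theorem circleCurve_re (ρ : ℝ) (w : ℂ) (θ : ℝ) :
    (circleCurve ρ w θ).re = w.re + ρ * Real.cos (2 * Real.pi * θ) := by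
  rw [circleCurve_eq]; simp [-Complex.ofReal_cos, -Complex.ofReal_sin]

theorem circleCurve_im (ρ : ℝ) (w : ℂ) (θ : ℝ) :
    (circleCurve ρ w θ).im = w.im - ρ * Real.sin (2 * Real.pi * θ) := by
  rw [circleCurve_eq]; simp [-Complex.ofReal_cos, -Complex.ofReal_sin, sub_eq_add_neg]

theorem slantHeight_circleCurve (δ ρ : ℝ) (w : ℂ) (θ : ℝ) :
    slantHeight δ (circleCurve ρ w θ) = slantHeight δ w -
      ρ * (Real.sin (2 * Real.pi * θ) + δ * Real.cos (2 * Real.pi * θ)) := by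
  rw [slantHeight_apply, slantHeight_apply, circleCurve_re, circleCurve_im]; ring

theorem circleCurve_zero (ρ : ℝ) (w : ℂ) : circleCurve ρ w 0 = w + ρ := by simp [circleCurve]

theorem circleCurve_one (ρ : ℝ) (w : ℂ) : circleCurve ρ w 1 = w + ρ := by
  simp [circleCurve, Complex.exp_neg, Complex.exp_two_pi_mul_I]

theorem circleCurve_abs {δ ρ : ℝ} (hδ : 0 < δ) (hδ1 : δ < 1) (hρ : 0 < ρ) (w : ℂ) (θ : ℝ) :
    |slantHeight δ (circleCurve ρ w θ) - slantHeight δ w| ≤ 2 * ρ := by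
  rw [slantHeight_circleCurve]
  have h1 := Real.abs_sin_le_one (2 * Real.pi * θ)
  have h2 := Real.abs_cos_le_one (2 * Real.pi * θ)
  rw [abs_le] at h1 h2 ⊢
  constructor <;> nlinarith [mul_le_mul_of_nonneg_left h1.1 hρ.le,
    mul_le_mul_of_nonneg_left h1.2 hρ.le, mul_le_mul_of_nonneg_left h2.1 (mul_pos hρ hδ).le,
    mul_le_mul_of_nonneg_left h2.2 (mul_pos hρ hδ).le, mul_pos hρ hδ]

theorem circleCurve_mem {V : Finset ℂ} {ρ r : ℝ} (hρ : IsDiskRadius V ρ) {w : ℂ} (hw : w ∈ V)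
    (hr : r < w.re - ρ) (θ : ℝ) : (circleCurve ρ w θ : OnePoint ℂ) ∈ puncturedHalfPlane V r := by
  refine coe_mem_puncturedHalfPlane.2 ⟨?_, fun hv => ?_⟩
  · rw [circleCurve_re]
    nlinarith [Real.neg_one_le_cos (2 * Real.pi * θ), hρ.1]
  · have hd : dist (circleCurve ρ w θ) w = ρ := by
      rw [Complex.dist_eq, circleCurve, add_sub_cancel_left, norm_mul, Complex.norm_exp]
      simp [abs_of_pos hρ.1]
    by_cases h : circleCurve ρ w θ = w
    · rw [h, dist_self] at hd
      exact hρ.1.ne hd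
    · have := hρ.2 _ hv w hw h
      linarith [hρ.1]

/-- The slit leaves `w` at an angle between `π` and `5 π / 4`, so it meets the clockwise circle at a
parameter between 3/8 and 1/2. The arc left out here, `[3/8, 5/8]`, contains the crossing and lies
in the convex strip. -/
theorem circleCurve_mem_slitPlane {V : Finset ℂ} {δ ρ r : ℝ} (h : IsAdmissible V δ ρ) {w : ℂ}
    (hw : w ∈ V) (hr : r < w.re - ρ) {θ : ℝ} (hθ : θ ∈ Icc 0 (3 / 8) ∨ θ ∈ Icc (5 / 8) 1) :
    circleCurve ρ w θ ∈ slitPlane V δ r := by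
  have hρ := h.disk.1
  refine ⟨(coe_mem_puncturedHalfPlane.1 (circleCurve_mem h.disk hw hr θ)).1, ?_⟩
  rintro ⟨v, hv, h1, h2⟩
  obtain rfl := eq_of_slantHeight h hv hw h1 (circleCurve_abs h.pos h.lt_one hρ w θ)
  rw [slantHeight_circleCurve] at h1
  rw [circleCurve_re] at h2
  set φ := 2 * Real.pi * θ with hφ
  have hπ := Real.pi_pos
  have hcos : Real.cos φ ≤ 0 := by nlinarith
  have hsin : Real.sin φ + δ * Real.cos φ = 0 := by
    have : ρ * (Real.sin φ + δ * Real.cos φ) = 0 := by linarith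
    exact (mul_eq_zero.1 this).resolve_left hρ.ne'
  have hsq := Real.sin_sq_add_cos_sq φ
  have hcos' : Real.cos φ < 0 := by
    refine lt_of_le_of_ne hcos fun h0 => ?_
    rw [h0] at hsin hsq
    have : Real.sin φ = 0 := by linarith
    rw [this] at hsq; norm_num at hsq
  -- On the slit `sin φ = -δ cos φ` with `cos φ < 0`, so `sin φ > 0` and `sin φ + cos φ < 0`. The
  -- first arc violates the latter, the second one the former.
  rcases hθ with hθ | hθ
  · have h3 : 0 ≤ Real.sin (φ + Real.pi / 4) :=
      Real.sin_nonneg_of_nonneg_of_le_pi (by rw [hφ]; have := hθ.1; positivity)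
        (by rw [hφ]; nlinarith [hθ.2])
    rw [Real.sin_add, Real.cos_pi_div_four, Real.sin_pi_div_four, ← add_mul] at h3
    have h4 : 0 ≤ Real.sin φ + Real.cos φ := nonneg_of_mul_nonneg_left h3 (by positivity)
    nlinarith [h.lt_one]
  · have h3 : Real.sin (φ - 2 * Real.pi) ≤ 0 :=
      Real.sin_nonpos_of_nonpos_of_neg_pi_le (by rw [hφ]; nlinarith [hθ.2])
        (by rw [hφ]; nlinarith [hθ.1])
    rw [Real.sin_sub_two_pi] at h3
    nlinarith [h.pos]

theorem circleCurve_mem_slitStrip {δ ρ r : ℝ} (hδ : 0 < δ) (hδ1 : δ < 1) (hρ : 0 < ρ) {w : ℂ}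
    (hr : r < w.re - ρ) {θ : ℝ} (hθ : θ ∈ Icc (3 / 8 : ℝ) (5 / 8)) :
    circleCurve ρ w θ ∈ slitStrip δ ρ r w := by
  have hπ := Real.pi_pos
  have hcos : Real.cos (2 * Real.pi * θ) < 0 :=
    Real.cos_neg_of_pi_div_two_lt_of_lt (by nlinarith [hθ.1]) (by nlinarith [hθ.2])
  have h1 := Real.neg_one_le_cos (2 * Real.pi * θ)
  have h2 := Real.abs_sin_le_one (2 * Real.pi * θ)
  rw [abs_le] at h2
  refine ⟨?_, ?_⟩
  · rw [circleCurve_re]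
    constructor <;> nlinarith
  · rw [slantHeight_circleCurve]
    have e1 : ρ * Real.sin (2 * Real.pi * θ) ≤ ρ := by nlinarith
    have e2 : -ρ ≤ ρ * Real.sin (2 * Real.pi * θ) := by nlinarith
    have e3 : -ρ < ρ * (δ * Real.cos (2 * Real.pi * θ)) := by
      have : -1 < δ * Real.cos (2 * Real.pi * θ) := by nlinarith
      nlinarith
    have e4 : ρ * (δ * Real.cos (2 * Real.pi * θ)) < 0 :=
      mul_neg_of_pos_of_neg hρ (mul_neg_of_pos_of_neg hδ hcos)
    constructor <;> linarith

theorem slantHeight_circleCurve_lower {δ ρ : ℝ} (hδ1 : δ < 1) (hρ : 0 < ρ) (w : ℂ) :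
    slantHeight δ (circleCurve ρ w (3 / 8)) < slantHeight δ w := by
  rw [slantHeight_circleCurve, show 2 * Real.pi * (3 / 8) = Real.pi - Real.pi / 4 by ring,
    Real.sin_pi_sub, Real.cos_pi_sub, Real.sin_pi_div_four, Real.cos_pi_div_four]
  have : 0 < ρ * (√2 / 2 * (1 - δ)) :=
    mul_pos hρ (mul_pos (by positivity) (by linarith))
  linarith

theorem slantHeight_circleCurve_upper {δ ρ : ℝ} (hδ : 0 < δ) (hρ : 0 < ρ) (w : ℂ) :
    slantHeight δ w < slantHeight δ (circleCurve ρ w (5 / 8)) := by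
  rw [slantHeight_circleCurve, show 2 * Real.pi * (5 / 8) = Real.pi / 4 + Real.pi by ring,
    Real.sin_add_pi, Real.cos_add_pi, Real.sin_pi_div_four, Real.cos_pi_div_four]
  have : 0 < ρ * (√2 / 2 * (1 + δ)) := by positivity
  linarith

section Generator

variable {V : Finset ℂ} {δ ρ r : ℝ}

theorem armPath_mem (hρ : IsDiskRadius V ρ) {w : ℂ} (hw : w ∈ V) (hr : r < w.re - ρ) (t : I) :
    armPath V hρ hw t ∈ puncturedHalfPlane V r := by
  refine rPath_mem _ _ (fun t => coe_mem_puncturedHalfPlane.2 ⟨?_, straightCurve_notMem hρ ?_⟩) t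
  · rw [straightCurve_re]
    linarith [hρ.1, t.2]
  · exact add_pos_of_pos_of_nonneg hρ.1 t.2

theorem clockwiseCircle_eq (w : ℂ) : clockwiseCircle ρ w =
    spherePath (pathOn (continuous_circleCurve ρ w) (circleCurve_zero ρ w)
      (circleCurve_one ρ w)) := by
  ext t
  change ((_ : ℂ) : OnePoint ℂ) = ((_ : ℂ) : OnePoint ℂ)
  simp [circleCurve, pathOn_apply]

theorem clockwiseCircle_mem (hρ : IsDiskRadius V ρ) {w : ℂ} (hw : w ∈ V) (hr : r < w.re - ρ)
    (t : I) : clockwiseCircle ρ w t ∈ puncturedHalfPlane V r := by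
  rw [clockwiseCircle_eq]
  exact circleCurve_mem hρ hw hr _

theorem generatorLoop_mem (hρ : IsDiskRadius V ρ) {w : ℂ} (hw : w ∈ V) (hr : r < w.re - ρ)
    (t : I) : generatorLoop V hρ hw t ∈ puncturedHalfPlane V r := by
  have ha := armPath_mem hρ hw hr
  exact Path.trans_mem (Path.trans_mem (Path.symm_mem ha) (clockwiseCircle_mem hρ hw hr)) ha t

theorem armPath_pinchedHomotopic (h : IsAdmissible V δ ρ) {w : ℂ} (hw : w ∈ V)
    (hr : r < w.re - ρ) :
    PinchedHomotopic (puncturedHalfPlane V r) (armPath V h.disk hw) (rayPath δ (w + ρ)) :=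
  rPath_pinchedHomotopic_rayPath _ _ fun t => straightCurve_mem_slitPlane h hw
    (add_pos_of_pos_of_nonneg h.disk.1 t.2) (by linarith [h.disk.1])

/-- A path that crosses the slit of `w` upwards represents the generator `g_w`. -/
theorem crossing_up (h : IsAdmissible V δ ρ) {w : ℂ} (hw : w ∈ V) (hr : r < w.re - ρ) {y x : ℂ}
    (a : Path y x) (ha : ∀ t, a t ∈ slitStrip δ ρ r w) (hy : slantHeight δ y < slantHeight δ w)
    (hx : slantHeight δ w < slantHeight δ x) :
    PinchedHomotopic (puncturedHalfPlane V r) ((spherePath a).trans (rayPath δ x))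
      ((rayPath δ y).trans (generatorLoop V h.disk hw)) := by
  have hρ := h.disk.1
  have hyS : y ∈ slitStrip δ ρ r w := by simpa using ha 0
  have hxS : x ∈ slitStrip δ ρ r w := by simpa using ha 1
  -- The circle is cut at `y₁` below and `x₁` above the slit: `E₁` and `E₃` miss all slits, and `E₂`
  -- crosses inside the convex strip, just as `a` does.
  set y₁ := circleCurve ρ w (3 / 8) with hy₁
  set x₁ := circleCurve ρ w (5 / 8) with hx₁
  have hcont := continuous_circleCurve ρ w
  let E₁ : Path (w + ρ) y₁ := pathOn hcont (circleCurve_zero ρ w) hy₁.symm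
  let E₂ : Path y₁ x₁ := pathOn hcont hy₁.symm hx₁.symm
  let E₃ : Path x₁ (w + ρ) := pathOn hcont hx₁.symm (circleCurve_one ρ w)
  have hE₁ : ∀ t, E₁ t ∈ slitPlane V δ r := fun t =>
    circleCurve_mem_slitPlane h hw hr (.inl (pathOn_mem_Icc (by norm_num) t))
  have hE₃ : ∀ t, E₃ t ∈ slitPlane V δ r := fun t =>
    circleCurve_mem_slitPlane h hw hr (.inr (pathOn_mem_Icc (by norm_num) t))
  have hE₂ : ∀ t, E₂ t ∈ slitStrip δ ρ r w := fun t =>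
    circleCurve_mem_slitStrip h.pos h.lt_one hρ hr (pathOn_mem_Icc (by norm_num) t)
  have hy₁S : y₁ ∈ slitStrip δ ρ r w := by simpa using hE₂ 0
  have hx₁S : x₁ ∈ slitStrip δ ρ r w := by simpa using hE₂ 1
  have hy₁h := slantHeight_circleCurve_lower h.lt_one hρ w
  have hx₁h := slantHeight_circleCurve_upper h.pos hρ w
  let S₁ : Path y y₁ := linePath y y₁
  let S₂ : Path x₁ x := linePath x₁ x
  have hS₁' : ∀ t, S₁ t ∈ slitStrip δ ρ r w := linePath_mem (convex_slitStrip δ ρ r w) hyS hy₁S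
  have hS₂' : ∀ t, S₂ t ∈ slitStrip δ ρ r w := linePath_mem (convex_slitStrip δ ρ r w) hx₁S hxS
  have hS₁ : ∀ t, S₁ t ∈ slitPlane V δ r := fun t => slitStrip_mem_slitPlane h hw (hS₁' t)
    (ne_of_lt (linePath_mem ((convex_Iio (slantHeight δ w)).linear_preimage (slantHeight δ))
      hy hy₁h t))
  have hS₂ : ∀ t, S₂ t ∈ slitPlane V δ r := fun t => slitStrip_mem_slitPlane h hw (hS₂' t)
    (ne_of_gt (linePath_mem ((convex_Ioi (slantHeight δ w)).linear_preimage (slantHeight δ))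
      hx₁h hx t))
  have hyP : y ∈ slitPlane V δ r := by simpa using hS₁ 0
  have hxP : x ∈ slitPlane V δ r := by simpa using hS₂ 1
  have hy₁P : y₁ ∈ slitPlane V δ r := by simpa using hS₁ 1
  have hx₁P : x₁ ∈ slitPlane V δ r := by simpa using hS₂ 0
  have hwP : w + ρ ∈ slitPlane V δ r := by simpa using hE₁ 0
  have mP : ∀ {p q : ℂ} (c : Path p q), (∀ t, c t ∈ slitPlane V δ r) →
      ∀ t, spherePath c t ∈ puncturedHalfPlane V r := fun c hc t => slitPlane_mem (hc t)
  have mS : ∀ {p q : ℂ} (c : Path p q), (∀ t, c t ∈ slitStrip δ ρ r w) →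
      ∀ t, spherePath c t ∈ puncturedHalfPlane V r := fun c hc t => slitStrip_mem h hw (hc t)
  have harm := armPath_mem h.disk hw hr
  have hcirc := clockwiseCircle_mem h.disk hw hr
  have c1 : pathClass _ hcirc = (pathClass _ (mP E₁ hE₁)).trans
      ((pathClass _ (mS E₂ hE₂)).trans (pathClass _ (mP E₃ hE₃))) := by
    rw [← pathClass_trans (mS E₂ hE₂) (mP E₃ hE₃) (Path.trans_mem (mS E₂ hE₂) (mP E₃ hE₃)),
      ← pathClass_trans _ _ (Path.trans_mem (mP E₁ hE₁)
        (Path.trans_mem (mS E₂ hE₂) (mP E₃ hE₃))), pathClass_eq_iff, clockwiseCircle_eq]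
    have hU : ∀ t, (circleCurve ρ w t : OnePoint ℂ) ∈ puncturedHalfPlane V r :=
      circleCurve_mem h.disk hw hr
    refine (pathOn_trans_pinchedHomotopic hcont _ hy₁.symm _ (by norm_num) (by norm_num)
      fun t _ => hU t).trans ?_
    exact PinchedHomotopic.hcomp (hU _) (.refl (.of_mem (mP E₁ hE₁)))
      (pathOn_trans_pinchedHomotopic hcont _ hx₁.symm _ (by norm_num) (by norm_num)
        fun t _ => hU t)
  have c2 : pathClass _ harm = pathClass _ (rayPath_mem hwP) :=
    (pathClass_eq_iff _ _).2 (armPath_pinchedHomotopic h hw hr)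
  have ray : ∀ {p q : ℂ} (c : Path p q) (hc : ∀ t, c t ∈ slitPlane V δ r)
      (hp : p ∈ slitPlane V δ r) (hq : q ∈ slitPlane V δ r),
      (pathClass _ (mP c hc)).trans (pathClass _ (rayPath_mem hq)) =
        pathClass _ (rayPath_mem hp) := fun c hc hp hq => by
    rw [← pathClass_trans _ _ (Path.trans_mem (mP c hc) (rayPath_mem hq)), pathClass_eq_iff]
    exact trans_rayPath c hc
  have c3 := ray E₁ hE₁ hwP hy₁P
  have c4 := ray E₃ hE₃ hx₁P hwP
  have c5 := ray S₁ hS₁ hyP hy₁P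
  have c6 := ray S₂ hS₂ hx₁P hxP
  -- Paths with the same ends in the convex strip are homotopic.
  have c7 : pathClass _ (mS a ha) = (pathClass _ (mS S₁ hS₁')).trans
      ((pathClass _ (mS E₂ hE₂)).trans (pathClass _ (mS S₂ hS₂'))) := by
    rw [← pathClass_trans _ _ (Path.trans_mem (mS E₂ hE₂) (mS S₂ hS₂')),
      ← pathClass_trans _ _ (Path.trans_mem (mS S₁ hS₁')
        (Path.trans_mem (mS E₂ hE₂) (mS S₂ hS₂'))), pathClass_eq_iff]
    rw [← spherePath_trans, ← spherePath_trans]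
    have hm : ∀ t, (S₁.trans (E₂.trans S₂)) t ∈ slitStrip δ ρ r w := fun t => by
      rw [Path.trans_apply]
      split_ifs
      · exact hS₁' _
      · rw [Path.trans_apply]
        split_ifs
        exacts [hE₂ _, hS₂' _]
    exact pinchedHomotopic_spherePath (convex_slitStrip δ ρ r w)
      (fun z hz => slitStrip_mem h hw hz) (fun t _ _ => ha t) (fun t _ _ => hm t)
  have harms : ∀ t, (armPath V h.disk hw).symm t ∈ puncturedHalfPlane V r := Path.symm_mem harm
  rw [← pathClass_eq_iff (Path.trans_mem (mS a ha) (rayPath_mem hxP))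
    (Path.trans_mem (rayPath_mem hyP) (generatorLoop_mem h.disk hw hr)),
    pathClass_trans (mS a ha) (rayPath_mem hxP),
    pathClass_trans (rayPath_mem hyP) (generatorLoop_mem h.disk hw hr)]
  have c8 : pathClass _ (generatorLoop_mem h.disk hw hr) =
      ((pathClass _ harm).symm.trans (pathClass _ hcirc)).trans (pathClass _ harm) := by
    rw [← pathClass_symm harm harms, ← pathClass_trans harms hcirc (Path.trans_mem harms hcirc),
      ← pathClass_trans _ harm (Path.trans_mem (Path.trans_mem harms hcirc) harm)]
    rfl
  -- Rays absorb paths in the slit plane: (ray of `y`)·(arm)⁻¹·`E₁` is `S₁`, and `E₃`·(arm) is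
  -- `S₂`·(ray of `x`). So both sides are `S₁`·`E₂`·`S₂`·(ray of `x`).
  rw [c8, c7, c1, c2, ← c5, ← c3]
  simp only [Path.Homotopic.Quotient.trans_assoc, quotient_trans_symm_rev,
    quotient_symm_trans_cancel, quotient_trans_symm_cancel]
  rw [c6, c3, c4]

/-- This is `crossing_up` for the reversed path, with the inverses moved to the other side in the
groupoid. -/
theorem crossing_down (h : IsAdmissible V δ ρ) {w : ℂ} (hw : w ∈ V) (hr : r < w.re - ρ) {y x : ℂ}
    (a : Path x y) (ha : ∀ t, a t ∈ slitStrip δ ρ r w) (hy : slantHeight δ y < slantHeight δ w)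
    (hx : slantHeight δ w < slantHeight δ x) :
    PinchedHomotopic (puncturedHalfPlane V r) ((spherePath a).trans (rayPath δ y))
      ((rayPath δ x).trans (generatorLoop V h.disk hw).symm) := by
  have hxS : x ∈ slitStrip δ ρ r w := by simpa using ha 0
  have hyS : y ∈ slitStrip δ ρ r w := by simpa using ha 1
  have hxP := slitStrip_mem_slitPlane h hw hxS hx.ne'
  have hyP := slitStrip_mem_slitPlane h hw hyS hy.ne
  have hma : ∀ t, spherePath a t ∈ puncturedHalfPlane V r := fun t => slitStrip_mem h hw (ha t)
  have hmg := generatorLoop_mem h.disk hw hr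
  have hmas : ∀ t, (spherePath a).symm t ∈ puncturedHalfPlane V r := Path.symm_mem hma
  have hmgs : ∀ t, (generatorLoop V h.disk hw).symm t ∈ puncturedHalfPlane V r := Path.symm_mem hmg
  have hup := crossing_up h hw hr a.symm (fun t => ha _) hy hx
  rw [spherePath_symm, ← pathClass_eq_iff (Path.trans_mem hmas (rayPath_mem hxP))
    (Path.trans_mem (rayPath_mem hyP) hmg), pathClass_trans hmas (rayPath_mem hxP),
    pathClass_trans (rayPath_mem hyP) hmg, pathClass_symm hma] at hup
  rw [← pathClass_eq_iff (Path.trans_mem hma (rayPath_mem hyP))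
    (Path.trans_mem (rayPath_mem hxP) hmgs), pathClass_trans hma (rayPath_mem hyP),
    pathClass_trans (rayPath_mem hxP) hmgs, pathClass_symm hmg]
  have h2 := congrArg (fun c => (pathClass _ hma).trans (c.trans (pathClass _ hmg).symm)) hup
  simp only [Path.Homotopic.Quotient.trans_assoc, quotient_trans_symm_cancel] at h2
  rw [h2, Path.Homotopic.Quotient.trans_symm, Path.Homotopic.Quotient.trans_refl]

end Generator

end

noncomputable section

/-! ### Loops spelled by words -/

section WordLoop

variable {V : Finset ℂ} {ρ r : ℝ}

/-- The loop spelled by one letter. -/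
def letterLoop (V : Finset ℂ) {ρ : ℝ} (hρ : IsDiskRadius V ρ) (x : V × Bool) :
    Path (∞ : OnePoint ℂ) ∞ :=
  if x.2 then generatorLoop V hρ x.1.2 else (generatorLoop V hρ x.1.2).symm

theorem wordLoop_cons (hρ : IsDiskRadius V ρ) (x : V × Bool) (l : List (V × Bool)) :
    wordLoop V hρ (x :: l) = (letterLoop V hρ x).trans (wordLoop V hρ l) := rfl

theorem letterLoop_mem (hρ : IsDiskRadius V ρ) (hr : ∀ v ∈ V, r < v.re - ρ) (x : V × Bool) (t : I) :
    letterLoop V hρ x t ∈ puncturedHalfPlane V r := by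
  have := generatorLoop_mem hρ x.1.2 (hr _ x.1.2)
  rw [letterLoop]
  split_ifs
  exacts [this t, Path.symm_mem this t]

theorem wordLoop_mem (hρ : IsDiskRadius V ρ) (hr : ∀ v ∈ V, r < v.re - ρ) (l : List (V × Bool))
    (t : I) : wordLoop V hρ l t ∈ puncturedHalfPlane V r := by
  induction l generalizing t with
  | nil => exact infty_mem_puncturedHalfPlane
  | cons x l ih =>
    rw [wordLoop_cons]
    exact Path.trans_mem (letterLoop_mem hρ hr x) ih t

/-- The class of the loop spelled by a word. -/
def wordClass (hρ : IsDiskRadius V ρ) (hr : ∀ v ∈ V, r < v.re - ρ) (l : List (V × Bool)) :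
    Path.Homotopic.Quotient (⟨∞, infty_mem_puncturedHalfPlane⟩ : puncturedHalfPlane V r)
      ⟨∞, infty_mem_puncturedHalfPlane⟩ :=
  pathClass _ (wordLoop_mem hρ hr l)

theorem wordClass_cons (hρ : IsDiskRadius V ρ) (hr : ∀ v ∈ V, r < v.re - ρ) (x : V × Bool)
    (l : List (V × Bool)) : wordClass hρ hr (x :: l) =
      (pathClass _ (letterLoop_mem hρ hr x)).trans (wordClass hρ hr l) :=
  pathClass_trans (letterLoop_mem hρ hr x) (wordLoop_mem hρ hr l) _

theorem wordClass_append (hρ : IsDiskRadius V ρ) (hr : ∀ v ∈ V, r < v.re - ρ)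
    (l l' : List (V × Bool)) : wordClass hρ hr (l ++ l') =
      (wordClass hρ hr l).trans (wordClass hρ hr l') := by
  induction l with
  | nil => exact (Path.Homotopic.Quotient.refl_trans _).symm
  | cons x l ih =>
    rw [List.cons_append, wordClass_cons, wordClass_cons, ih,
      Path.Homotopic.Quotient.trans_assoc]

theorem letterLoop_not (hρ : IsDiskRadius V ρ) (w : V) (b : Bool) :
    letterLoop V hρ (w, !b) = (letterLoop V hρ (w, b)).symm := by
  cases b <;> simp [letterLoop]

theorem wordClass_eq_of_red (hρ : IsDiskRadius V ρ) (hr : ∀ v ∈ V, r < v.re - ρ)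
    {l l' : List (V × Bool)} (h : FreeGroup.Red l l') : wordClass hρ hr l = wordClass hρ hr l' := by
  induction h with
  | refl => rfl
  | tail _ hstep ih =>
    rw [ih]
    obtain ⟨⟩ := hstep
    rename_i L₁ L₂ w b _
    rw [wordClass_append, wordClass_append, wordClass_cons, wordClass_cons]
    congr 1
    have h1 := letterLoop_mem hρ hr (w, b)
    have h2 : pathClass _ (letterLoop_mem hρ hr (w, !b)) = (pathClass _ h1).symm := by
      rw [← pathClass_symm h1 (Path.symm_mem h1), pathClass_eq_iff, letterLoop_not]
      exact .refl (.of_mem (Path.symm_mem h1))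
    rw [h2, quotient_trans_symm_cancel]

/-- Counting crossings produces unreduced words, whereas `IsHomotopyWord` refers to the reduced
form. -/
theorem wordLoop_reduce (hρ : IsDiskRadius V ρ) (hr : ∀ v ∈ V, r < v.re - ρ)
    (l : List (V × Bool)) : PinchedHomotopic (puncturedHalfPlane V r) (wordLoop V hρ l)
      (wordLoop V hρ (FreeGroup.mk l).toWord) := by
  rw [← pathClass_eq_iff (wordLoop_mem hρ hr _) (wordLoop_mem hρ hr _), FreeGroup.toWord_mk]
  exact wordClass_eq_of_red hρ hr FreeGroup.reduce.red

end WordLoop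

/-! ### Counting crossings -/

section Crossings

variable {V : Finset ℂ} {δ ρ r : ℝ}

/-- In the convex strip only the sides of the end points matter. With both ends on one side, the
segment between them misses the slit and no letter appears; otherwise one of the two crossing lemmas
applies. -/
theorem exists_crossing_letter (h : IsAdmissible V δ ρ) (hr : ∀ v ∈ V, r < v.re - ρ) {w : ℂ}
    (hw : w ∈ V) {x y : ℂ} (a : Path x y) (ha : ∀ t, a t ∈ slitStrip δ ρ r w)
    (hx : x ∉ slits V δ) (hy : y ∉ slits V δ) :
    PinchedHomotopic (puncturedHalfPlane V r) ((spherePath a).trans (rayPath δ y)) (rayPath δ x) ∨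
    ∃ c : V × Bool, PinchedHomotopic (puncturedHalfPlane V r) ((spherePath a).trans (rayPath δ y))
      ((rayPath δ x).trans (letterLoop V h.disk c)) := by
  have hxS : x ∈ slitStrip δ ρ r w := by simpa using ha 0
  have hyS : y ∈ slitStrip δ ρ r w := by simpa using ha 1
  have hxne : slantHeight δ x ≠ slantHeight δ w := fun e => hx ⟨w, hw, e, hxS.1.2.le⟩
  have hyne : slantHeight δ y ≠ slantHeight δ w := fun e => hy ⟨w, hw, e, hyS.1.2.le⟩
  have hconv := convex_slitStrip δ ρ r w
  have hyP := slitStrip_mem_slitPlane h hw hyS hyne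
  have hline : (∀ t, linePath x y t ∈ slitPlane V δ r) →
      PinchedHomotopic (puncturedHalfPlane V r) ((spherePath a).trans (rayPath δ y))
        (rayPath δ x) := fun hl => by
    refine PinchedHomotopic.trans (PinchedHomotopic.hcomp (slitPlane_mem hyP) ?_
      (.refl (.of_mem (rayPath_mem hyP)))) (trans_rayPath _ hl)
    exact pinchedHomotopic_spherePath hconv (fun z hz => slitStrip_mem h hw hz)
      (fun t _ _ => ha t) (fun t _ _ => linePath_mem hconv hxS hyS t)
  rcases lt_or_gt_of_ne hxne with h1 | h1 <;> rcases lt_or_gt_of_ne hyne with h2 | h2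
  · left
    exact hline fun t => slitStrip_mem_slitPlane h hw (linePath_mem hconv hxS hyS t)
      (ne_of_lt (linePath_mem ((convex_Iio (slantHeight δ w)).linear_preimage (slantHeight δ))
        h1 h2 t))
  · right
    refine ⟨(⟨w, hw⟩, true), ?_⟩
    simpa [letterLoop] using crossing_up h hw (hr w hw) a ha h1 h2
  · right
    refine ⟨(⟨w, hw⟩, false), ?_⟩
    simpa [letterLoop] using crossing_down h hw (hr w hw) a ha h2 h1
  · left
    exact hline fun t => slitStrip_mem_slitPlane h hw (linePath_mem hconv hxS hyS t)
      (ne_of_gt (linePath_mem ((convex_Ioi (slantHeight δ w)).linear_preimage (slantHeight δ))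
        h1 h2 t))

/-- A path with at most `n` crossings of the slits is spelled by a word of length at most `n`. -/
theorem exists_word_of_crossings (h : IsAdmissible V δ ρ) (hr : ∀ v ∈ V, r < v.re - ρ) {f : ℝ → ℂ}
    (hf : Continuous f) {b : ℝ} {y : ℂ} (hb : f b = y) (hyS : y ∉ slits V δ) (n : ℕ) {a : ℝ}
    (hab : a ≤ b) {x : ℂ} (ha : f a = x) (hxS : x ∉ slits V δ)
    (hU : ∀ t ∈ Icc a b, r < (f t).re ∧ f t ∉ V)
    (hfin : {t ∈ Icc a b | f t ∈ slits V δ}.Finite)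
    (hcard : {t ∈ Icc a b | f t ∈ slits V δ}.ncard ≤ n) :
    ∃ l : List (V × Bool), l.length ≤ n ∧ PinchedHomotopic (puncturedHalfPlane V r)
      ((spherePath (pathOn hf ha hb)).trans (rayPath δ y))
      ((rayPath δ x).trans (wordLoop V h.disk l)) := by
  have hxP : x ∈ slitPlane V δ r := ⟨ha ▸ (hU a ⟨le_rfl, hab⟩).1, hxS⟩
  have hyP : y ∈ slitPlane V δ r := ⟨hb ▸ (hU b ⟨hab, le_rfl⟩).1, hyS⟩
  rcases Set.eq_empty_or_nonempty {t ∈ Icc a b | f t ∈ slits V δ} with hT | hT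
  · refine ⟨[], Nat.zero_le _, ?_⟩
    refine (trans_rayPath _ fun t => ⟨(hU _ (pathOn_mem_Icc hab t)).1, fun hs => ?_⟩).trans
      (PinchedHomotopic.trans_refl (.of_mem (rayPath_mem hxP)) infty_mem_puncturedHalfPlane).symm
    have : a + t * (b - a) ∈ {t ∈ Icc a b | f t ∈ slits V δ} := ⟨pathOn_mem_Icc hab t, hs⟩
    rw [hT] at this
    exact this
  induction n generalizing a x with
  | zero =>
    exfalso
    have := (Set.ncard_pos hfin).2 hT
    omega
  | succ n ih =>
    -- The earliest crossing is split off. Being one of finitely many it is isolated, so a short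
    -- piece around `t₀` stays in the strip of `w` and contains no other crossing.
    obtain ⟨t₀, ht₀, hmin⟩ := hfin.exists_minimal hT
    replace hmin : ∀ t ∈ {t ∈ Icc a b | f t ∈ slits V δ}, t₀ ≤ t := fun t ht =>
      (le_total t₀ t).elim id fun hle => hmin ht hle
    obtain ⟨hI, hs⟩ := ht₀
    have hne_a : a ≠ t₀ := fun e => hxS (by rw [← ha, e]; exact hs)
    have hne_b : t₀ ≠ b := fun e => hyS (by rw [← hb, ← e]; exact hs)
    have hat : a < t₀ := lt_of_le_of_ne hI.1 hne_a
    have htb : t₀ < b := lt_of_le_of_ne hI.2 hne_b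
    obtain ⟨w, hw, hw1, hw2⟩ := id hs
    have hre : (f t₀).re < w.re := by
      refine lt_of_le_of_ne hw2 fun e => (hU t₀ hI).2 ?_
      have : f t₀ = w := by
        refine Complex.ext e ?_
        rw [slantHeight_apply, slantHeight_apply, e] at hw1
        linarith
      rw [this]; exact hw
    have hstrip : f t₀ ∈ slitStrip δ ρ r w := by
      have := h.disk.1
      refine ⟨⟨(hU t₀ hI).1, hre⟩, ?_⟩
      rw [hw1]
      constructor <;> linarith
    have e1 : ∀ᶠ t in 𝓝 t₀, f t ∈ slitStrip δ ρ r w :=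
      hf.continuousAt.eventually ((isOpen_slitStrip δ ρ r w).mem_nhds hstrip)
    have e2 : ∀ᶠ t in 𝓝 t₀, t ∉ {t ∈ Icc a b | f t ∈ slits V δ} \ {t₀} :=
      (hfin.subset sdiff_subset).isClosed.isOpen_compl.mem_nhds (by simp)
    have e3 : ∀ᶠ t in 𝓝 t₀, t ∈ Ioo a b := Ioo_mem_nhds hat htb
    obtain ⟨ε, hε, hball⟩ := Metric.eventually_nhds_iff.1 (e1.and (e2.and e3))
    have hball' : ∀ t ∈ Icc (t₀ - ε / 2) (t₀ + ε / 2), f t ∈ slitStrip δ ρ r w ∧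
        t ∉ {t ∈ Icc a b | f t ∈ slits V δ} \ {t₀} ∧ t ∈ Ioo a b := fun t ht => by
      refine hball ?_
      rw [Real.dist_eq, abs_lt]
      constructor <;> linarith [ht.1, ht.2]
    set s₁ := t₀ - ε / 2 with hs₁
    set s₂ := t₀ + ε / 2 with hs₂
    have h01 : s₁ < t₀ := by linarith
    have h02 : t₀ < s₂ := by linarith
    have m1 := hball' s₁ ⟨le_rfl, by linarith⟩
    have m2 := hball' s₂ ⟨by linarith, le_rfl⟩
    have n1 : f s₁ ∉ slits V δ := fun hh => m1.2.1 ⟨⟨⟨m1.2.2.1.le, m1.2.2.2.le⟩, hh⟩, h01.ne⟩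
    have n2 : f s₂ ∉ slits V δ := fun hh => m2.2.1 ⟨⟨⟨m2.2.2.1.le, m2.2.2.2.le⟩, hh⟩, h02.ne'⟩
    have p1 : f s₁ ∈ slitPlane V δ r := ⟨m1.1.1.1, n1⟩
    have p2 : f s₂ ∈ slitPlane V δ r := ⟨m2.1.1.1, n2⟩
    have hsub : {t ∈ Icc s₂ b | f t ∈ slits V δ} ⊆ {t ∈ Icc a b | f t ∈ slits V δ} \ {t₀} := by
      rintro t ⟨⟨ht1, ht2⟩, ht3⟩
      exact ⟨⟨⟨by linarith, ht2⟩, ht3⟩, fun e => by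
        rw [mem_singleton_iff] at e; linarith⟩
    have hfin' : {t ∈ Icc s₂ b | f t ∈ slits V δ}.Finite :=
      (hfin.subset sdiff_subset).subset hsub
    have hcard' : {t ∈ Icc s₂ b | f t ∈ slits V δ}.ncard ≤ n := by
      have h1 := Set.ncard_le_ncard hsub (hfin.subset sdiff_subset)
      have h2 := Set.ncard_sdiff_singleton_lt_of_mem
        (show t₀ ∈ {t ∈ Icc a b | f t ∈ slits V δ} from ⟨hI, hs⟩) hfin
      omega
    have hU' : ∀ t ∈ Icc s₂ b, r < (f t).re ∧ f t ∉ V := fun t ht =>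
      hU t ⟨by linarith [ht.1], ht.2⟩
    obtain ⟨l, hl, hlw⟩ : ∃ l : List (V × Bool), l.length ≤ n ∧
        PinchedHomotopic (puncturedHalfPlane V r)
          ((spherePath (pathOn hf rfl hb)).trans (rayPath δ y))
          ((rayPath δ (f s₂)).trans (wordLoop V h.disk l)) := by
      rcases Set.eq_empty_or_nonempty {t ∈ Icc s₂ b | f t ∈ slits V δ} with hT' | hT'
      · refine ⟨[], Nat.zero_le _, ?_⟩
        refine (trans_rayPath _ fun t =>
          ⟨(hU' _ (pathOn_mem_Icc m2.2.2.2.le t)).1, fun hs => ?_⟩).trans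
          (PinchedHomotopic.trans_refl (.of_mem (rayPath_mem p2))
            infty_mem_puncturedHalfPlane).symm
        have : s₂ + t * (b - s₂) ∈ {t ∈ Icc s₂ b | f t ∈ slits V δ} :=
          ⟨pathOn_mem_Icc m2.2.2.2.le t, hs⟩
        rw [hT'] at this
        exact this
      · exact ih m2.2.2.2.le rfl n2 hU' hfin' hcard' p2 hT'
    let A : Path x (f s₁) := pathOn hf ha rfl
    let M : Path (f s₁) (f s₂) := pathOn hf rfl rfl
    let B : Path (f s₂) y := pathOn hf rfl hb
    have hA : ∀ t, A t ∈ slitPlane V δ r := fun t => by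
      have ht := pathOn_mem_Icc m1.2.2.1.le t
      have ht' : a + t * (s₁ - a) ∈ Icc a b := ⟨ht.1, by linarith [ht.2]⟩
      refine ⟨(hU _ ht').1, fun hh => ?_⟩
      have := hmin _ ⟨ht', hh⟩
      linarith [ht.2]
    have hM : ∀ t, M t ∈ slitStrip δ ρ r w := fun t =>
      (hball' _ (pathOn_mem_Icc (by linarith) t)).1
    have mA : ∀ t, spherePath A t ∈ puncturedHalfPlane V r := fun t => slitPlane_mem (hA t)
    have mM : ∀ t, spherePath M t ∈ puncturedHalfPlane V r := fun t => slitStrip_mem h hw (hM t)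
    have mB : ∀ t, spherePath B t ∈ puncturedHalfPlane V r := fun t =>
      coe_mem_puncturedHalfPlane.2 (hU' _ (pathOn_mem_Icc m2.2.2.2.le t))
    have mF : ∀ t, spherePath (pathOn hf ha hb) t ∈ puncturedHalfPlane V r := fun t =>
      coe_mem_puncturedHalfPlane.2 (hU _ (pathOn_mem_Icc hab t))
    have cF : pathClass _ mF = (pathClass _ mA).trans ((pathClass _ mM).trans (pathClass _ mB)) := by
      rw [← pathClass_trans mM mB (Path.trans_mem mM mB),
        ← pathClass_trans mA _ (Path.trans_mem mA (Path.trans_mem mM mB)), pathClass_eq_iff]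
      refine (pathOn_trans_pinchedHomotopic hf ha rfl hb m1.2.2.1 m1.2.2.2 fun t ht =>
        coe_mem_puncturedHalfPlane.2 (hU t ⟨ht.1.le, ht.2.le⟩)).trans ?_
      refine PinchedHomotopic.hcomp (slitPlane_mem p1) (.refl (.of_mem mA)) ?_
      exact pathOn_trans_pinchedHomotopic hf rfl rfl hb (by linarith) m2.2.2.2 fun t ht =>
        coe_mem_puncturedHalfPlane.2 (hU t ⟨by linarith [ht.1, m1.2.2.1], ht.2.le⟩)
    have cB : (pathClass _ mB).trans (pathClass _ (rayPath_mem hyP)) =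
        (pathClass _ (rayPath_mem p2)).trans (wordClass h.disk hr l) := by
      rw [← pathClass_trans _ _ (Path.trans_mem mB (rayPath_mem hyP)), wordClass,
        ← pathClass_trans _ _ (Path.trans_mem (rayPath_mem p2) (wordLoop_mem h.disk hr l)),
        pathClass_eq_iff]
      exact hlw
    have cA : (pathClass _ mA).trans (pathClass _ (rayPath_mem p1)) =
        pathClass _ (rayPath_mem hxP) := by
      rw [← pathClass_trans _ _ (Path.trans_mem mA (rayPath_mem p1)), pathClass_eq_iff]
      exact trans_rayPath A hA
    -- The piece before `s₁` is absorbed by a ray and the piece after `s₂` contributes `l`. Only the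
    -- middle piece `M` remains to be evaluated; it puts at most one letter in front of `l`.
    have goal : ∀ l' : List (V × Bool), l'.length ≤ n + 1 →
        (pathClass _ mM).trans ((pathClass _ (rayPath_mem p2)).trans (wordClass h.disk hr l)) =
          (pathClass _ (rayPath_mem p1)).trans (wordClass h.disk hr l') →
        ∃ l : List (V × Bool), l.length ≤ n + 1 ∧ PinchedHomotopic (puncturedHalfPlane V r)
          ((spherePath (pathOn hf ha hb)).trans (rayPath δ y))
          ((rayPath δ x).trans (wordLoop V h.disk l)) := fun l' hl' he => by
      refine ⟨l', hl', ?_⟩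
      rw [← pathClass_eq_iff (Path.trans_mem mF (rayPath_mem hyP))
        (Path.trans_mem (rayPath_mem hxP) (wordLoop_mem h.disk hr l')),
        pathClass_trans mF (rayPath_mem hyP), pathClass_trans (rayPath_mem hxP)
        (wordLoop_mem h.disk hr l'), cF, Path.Homotopic.Quotient.trans_assoc,
        Path.Homotopic.Quotient.trans_assoc, cB, he, ← Path.Homotopic.Quotient.trans_assoc, cA]
      rfl
    rcases exists_crossing_letter h hr hw M hM n1 n2 with hc | ⟨c, hc⟩
    · refine goal l (by omega) ?_
      rw [← pathClass_eq_iff (Path.trans_mem mM (rayPath_mem p2)) (rayPath_mem p1),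
        pathClass_trans mM (rayPath_mem p2)] at hc
      rw [← Path.Homotopic.Quotient.trans_assoc, hc]
    · refine goal (c :: l) (by simpa using hl) ?_
      have hml := letterLoop_mem h.disk hr c
      rw [← pathClass_eq_iff (Path.trans_mem mM (rayPath_mem p2))
        (Path.trans_mem (rayPath_mem p1) hml),
        pathClass_trans mM (rayPath_mem p2), pathClass_trans (rayPath_mem p1) hml] at hc
      rw [← Path.Homotopic.Quotient.trans_assoc, hc, wordClass_cons,
        Path.Homotopic.Quotient.trans_assoc]

end Crossings

end

noncomputable section

/-! ### Curves starting at a puncture -/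

/-- A continuous map of `ℝ` onto `(0, 1]`. -/
def expToUnit (s : ℝ) : I := ⟨min 1 (Real.exp s), by positivity, min_le_left _ _⟩

theorem continuous_expToUnit : Continuous expToUnit := by
  unfold expToUnit; fun_prop

theorem expToUnit_ne_zero (s : ℝ) : expToUnit s ≠ 0 := fun h => by
  have h1 : min 1 (Real.exp s) = 0 := congrArg Subtype.val h
  have : 0 < min 1 (Real.exp s) := lt_min one_pos (Real.exp_pos s)
  linarith

theorem unit_pos {t : I} (ht : t ≠ 0) : (0 : ℝ) < t :=
  lt_of_le_of_ne t.2.1 (fun h => ht (Subtype.ext h.symm))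

theorem unit_lt_one {t : I} (ht : t ≠ 1) : (t : ℝ) < 1 :=
  lt_of_le_of_ne t.2.2 (fun h => ht (Subtype.ext h))

theorem expToUnit_log {t : I} (ht : t ≠ 0) : expToUnit (Real.log t) = t := by
  refine Subtype.ext ?_
  change min 1 (Real.exp (Real.log t)) = t
  rw [Real.exp_log (unit_pos ht), min_eq_right t.2.2]

/-- In the variable `s = log t` the curve on `(0, 1]` becomes part of a curve on `ℝ` avoiding 0,
which lifts through the covering `exp`. Nothing is claimed as `t → 0`, where the logarithm may
spiral. -/
theorem exists_log_lift {α : I → ℂ} (hα : Continuous α) (hne : ∀ t, t ≠ 0 → α t ≠ 0) {c : ℂ}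
    (hc : Complex.exp c = α 1) :
    ∃ l : ℝ → ℂ, Continuous l ∧ l 0 = c ∧ ∀ t : I, t ≠ 0 → Complex.exp (l (Real.log t)) = α t := by
  let f : C(ℝ, ℂ) := ⟨fun s => α (expToUnit s), hα.comp continuous_expToUnit⟩
  have h0 : expToUnit 0 = 1 := Subtype.ext (by simp [expToUnit])
  obtain ⟨F, ⟨hF0, hF⟩, -⟩ := Complex.isCoveringMapOn_exp.existsUnique_continuousMap_lifts f
    (a₀ := 0) (e₀ := c) (by simp [f, h0, hc]) fun s => hne _ (expToUnit_ne_zero s)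
  refine ⟨F, F.continuous, hF0, fun t ht => ?_⟩
  have := congrFun hF (Real.log t)
  simp only [Function.comp_apply, f, ContinuousMap.coe_mk, expToUnit_log ht] at this
  exact this

/-- A map on `I × I` that is continuous where the second coordinate is nonzero and tends to `v`
as the second coordinate tends to zero is continuous. -/
theorem continuous_of_pinched {F : I × I → ℂ} {v : ℂ} (h0 : ∀ u, F (u, 0) = v)
    (hF : ∀ u t : I, t ≠ 0 → ContinuousAt F (u, t))
    (hlim : ∀ ε > 0, ∀ᶠ t : I in 𝓝 0, ∀ u, ‖F (u, t) - v‖ < ε) : Continuous F := by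
  rw [continuous_iff_continuousAt]
  rintro ⟨u, t⟩
  by_cases ht : t = 0
  · subst ht
    rw [Metric.continuousAt_iff']
    intro ε hε
    have h2 : Tendsto (fun x : I × I => x.2) (𝓝 (u, 0)) (𝓝 0) := continuous_snd.tendsto _
    filter_upwards [h2.eventually (hlim ε hε)] with x hx
    rw [h0, dist_eq_norm]
    exact hx x.1
  · exact hF u t ht

/-- Any two curves from `v` to `x` in a small disk around `v` that leave `v` immediately are
homotopic. -/
theorem pinchedHomotopic_of_punctured_disk {U : Set (OnePoint ℂ)} {v x : ℂ} {R : ℝ}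
    (hU : ∀ z : ℂ, z ≠ v → ‖z - v‖ < R → (z : OnePoint ℂ) ∈ U) {a b : Path v x}
    (ha : ∀ t, t ≠ 0 → a t ≠ v) (hb : ∀ t, t ≠ 0 → b t ≠ v) (haR : ∀ t, ‖a t - v‖ < R)
    (hbR : ∀ t, ‖b t - v‖ < R) : PinchedHomotopic U (spherePath a) (spherePath b) := by
  have hx : x - v ≠ 0 := sub_ne_zero.2 (by simpa using ha 1 one_ne_zero)
  obtain ⟨l, hl, hl0, hle⟩ := exists_log_lift (α := fun t => a t - v) (by fun_prop)
    (fun t ht => sub_ne_zero.2 (ha t ht)) (c := Complex.log (x - v))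
    (by simp [Complex.exp_log hx])
  obtain ⟨m, hm, hm0, hme⟩ := exists_log_lift (α := fun t => b t - v) (by fun_prop)
    (fun t ht => sub_ne_zero.2 (hb t ht)) (c := Complex.log (x - v))
    (by simp [Complex.exp_log hx])
  -- The logarithms of `a - v` and `b - v` agree at time 1 and are interpolated. The modulus is at
  -- most the larger of the two moduli, so the homotopy stays in the disk and tends to `v` uniformly
  -- as `t → 0`, however differently the two curves wind.
  let E : I × I → ℂ := fun p => Complex.exp ((1 - ((p.1 : ℝ) : ℂ)) * l (Real.log p.2) +
    ((p.1 : ℝ) : ℂ) * m (Real.log p.2))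
  have hbound : ∀ u t : I, t ≠ 0 → ‖E (u, t)‖ ≤ max ‖a t - v‖ ‖b t - v‖ := by
    intro u t ht
    simp only [E, Complex.norm_exp]
    rw [← hle t ht, ← hme t ht, Complex.norm_exp, Complex.norm_exp,
      ← Real.exp_monotone.map_max, Real.exp_le_exp]
    have h1 : ((1 - ((u : ℝ) : ℂ)) * l (Real.log t) + ((u : ℝ) : ℂ) * m (Real.log t)).re =
        (1 - (u : ℝ)) * (l (Real.log t)).re + u * (m (Real.log t)).re := by simp
    rw [h1]
    have h2 := mul_le_mul_of_nonneg_left (le_max_left (l (Real.log t)).re (m (Real.log t)).re)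
      (sub_nonneg.2 u.2.2)
    have h3 := mul_le_mul_of_nonneg_left (le_max_right (l (Real.log t)).re (m (Real.log t)).re)
      u.2.1
    linarith
  let F : I × I → ℂ := fun p => if p.2 = 0 then v else v + E p
  have hF : Continuous F := by
    refine continuous_of_pinched (v := v) (fun u => by simp [F]) ?_ ?_
    · intro u t ht
      have hev : (fun p => v + E p) =ᶠ[𝓝 (u, t)] F := by
        have : {p : I × I | p.2 ≠ 0} ∈ 𝓝 (u, t) :=
          (isOpen_ne.preimage continuous_snd).mem_nhds ht
        filter_upwards [this] with p hp
        simp only [F, if_neg (show ¬ p.2 = 0 from hp)]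
      refine ContinuousAt.congr ?_ hev
      have hlog : ContinuousAt (fun p : I × I => Real.log p.2) (u, t) :=
        ContinuousAt.log (by fun_prop) (unit_pos ht).ne'
      have h1 : ContinuousAt (fun p : I × I => l (Real.log p.2)) (u, t) :=
        hl.continuousAt.comp hlog
      have h2 : ContinuousAt (fun p : I × I => m (Real.log p.2)) (u, t) :=
        hm.continuousAt.comp hlog
      have h3 : ContinuousAt (fun p : I × I => ((p.1 : ℝ) : ℂ)) (u, t) := by fun_prop
      exact continuousAt_const.add ((((continuousAt_const.sub h3).mul h1).add (h3.mul h2)).cexp)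
    · intro ε hε
      have h1 : ∀ᶠ t : I in 𝓝 0, ‖a t - v‖ < ε := by
        have : ContinuousAt (fun t : I => ‖a t - v‖) 0 := by fun_prop
        refine this.eventually (gt_mem_nhds ?_)
        simpa using hε
      have h2 : ∀ᶠ t : I in 𝓝 0, ‖b t - v‖ < ε := by
        have : ContinuousAt (fun t : I => ‖b t - v‖) 0 := by fun_prop
        refine this.eventually (gt_mem_nhds ?_)
        simpa using hε
      filter_upwards [h1, h2] with t h1 h2 u
      by_cases ht : t = 0
      · simpa [F, ht] using hε
      · simp only [F, if_neg ht, add_sub_cancel_left]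
        exact (hbound u t ht).trans_lt (max_lt h1 h2)
  refine pinchedHomotopic_of_map (fun p => (F p : OnePoint ℂ)) (OnePoint.continuous_coe.comp hF)
    ?_ ?_ ?_ ?_ ?_
  · intro t
    by_cases ht : t = 0
    · simp [F, ht]
    · simp [F, ht, E, hle t ht]
  · intro t
    by_cases ht : t = 0
    · simp [F, ht]
    · simp [F, ht, E, hme t ht]
  · intro u; simp [F]
  · intro u
    simp only [F, one_ne_zero, if_false, E, Icc.coe_one, Real.log_one, hl0, hm0]
    rw [← add_mul, sub_add_cancel, one_mul, Complex.exp_log hx, add_sub_cancel]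
  · intro u t h0 _
    simp only [F, if_neg h0]
    refine hU _ ?_ ?_
    · simp [E, Complex.exp_ne_zero]
    · rw [add_sub_cancel_left]
      exact (hbound u t h0).trans_lt (max_lt (haR t) (hbR t))

/-! ### Splitting r-curves -/

/-- The part of `γ` over `[0, T]`. -/
def rInitial {γ : ℝ≥0 → ℂ} (hγ : IsRCurve γ) (T : ℝ≥0) {x y : ℂ} (hx : γ 0 = x) (hy : γ T = y) :
    Path x y where
  toFun t := γ (Real.toNNReal t * T)
  continuous_toFun := hγ.1.comp (by fun_prop)
  source' := by simp [hx]
  target' := by simp [hy]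

theorem rInitial_apply {γ : ℝ≥0 → ℂ} (hγ : IsRCurve γ) (T : ℝ≥0) {x y : ℂ} (hx : γ 0 = x)
    (hy : γ T = y) (t : I) : rInitial hγ T hx hy t = γ (Real.toNNReal t * T) := rfl

theorem IsRCurve.shift {γ : ℝ≥0 → ℂ} (hγ : IsRCurve γ) (T : ℝ≥0) :
    IsRCurve fun s => γ (T + s) := by
  refine ⟨hγ.1.comp (by fun_prop), hγ.2.comp ?_⟩
  exact tendsto_atTop_mono (fun s => le_add_self) tendsto_id

/-- Since `rExtend` reads the curve at `s / (1 - s)`, the times `p₁ t` and `p₂ t` are the solutions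
`s` of `s / (1 - s) = t T` and of `s / (1 - s) = T + t / (1 - t)`. With them, the two sides differ
only in timing. -/
theorem rPath_split {U : Set (OnePoint ℂ)} (hinf : ∞ ∈ U) {γ : ℝ≥0 → ℂ} (hγ : IsRCurve γ) {T : ℝ≥0}
    (hT : 0 < T) {x y : ℂ} (hx : γ 0 = x) (hy : γ T = y)
    (hU : ∀ t, 0 < t → (γ t : OnePoint ℂ) ∈ U) :
    PinchedHomotopic U (rPath hγ hx)
      ((spherePath (rInitial hγ T hx hy)).trans (rPath (hγ.shift T) (by simp [hy]))) := by
  have hT' : (0 : ℝ) < T := hT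
  let p₀ : Path (0 : ℝ) 1 := ⟨⟨fun t => t, by fun_prop⟩, rfl, rfl⟩
  let p₁ : Path (0 : ℝ) (T / (1 + T)) :=
    ⟨⟨fun t => t * T / (1 + t * T), by
      refine Continuous.div (by fun_prop) (by fun_prop) fun t => ?_
      have := mul_nonneg t.2.1 hT'.le
      positivity⟩, by simp, by simp⟩
  let p₂ : Path ((T : ℝ) / (1 + T)) 1 :=
    ⟨⟨fun t => (T * (1 - t) + t) / (1 + T * (1 - t)), by
      refine Continuous.div (by fun_prop) (by fun_prop) fun t => ?_
      have := mul_nonneg hT'.le (sub_nonneg.2 t.2.2)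
      positivity⟩, by simp, by simp⟩
  have p₁_lt : ∀ t, p₁ t < 1 := fun t => by
    have := mul_nonneg t.2.1 hT'.le
    change (t * T / (1 + t * T) : ℝ) < 1
    rw [div_lt_one (by positivity)]; linarith
  have p₁_nonneg : ∀ t, 0 ≤ p₁ t := fun t => by
    have := mul_nonneg t.2.1 hT'.le
    change (0 : ℝ) ≤ t * T / (1 + t * T)
    positivity
  have p₁_pos : ∀ t, (0 : ℝ) < (t : I) → 0 < p₁ t := fun t ht => by
    change (0 : ℝ) < t * T / (1 + t * T)
    positivity
  have p₂_lt : ∀ t : I, (t : ℝ) < 1 → p₂ t < 1 := fun t ht => by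
    have := mul_nonneg hT'.le (sub_nonneg.2 t.2.2)
    change ((T * (1 - t) + t) / (1 + T * (1 - t)) : ℝ) < 1
    rw [div_lt_one (by positivity)]; linarith
  have p₂_pos : ∀ t, 0 < p₂ t := fun t => by
    have := mul_nonneg hT'.le (sub_nonneg.2 t.2.2)
    change (0 : ℝ) < (T * (1 - t) + t) / (1 + T * (1 - t))
    refine div_pos ?_ (by positivity)
    rcases eq_or_lt_of_le t.2.1 with h | h
    · rw [← h]; simpa using hT'
    · positivity
  have hmemΦ : ∀ s ∈ Ioo (0 : ℝ) 1, rExtend γ (projIcc 0 1 zero_le_one s) ∈ U := fun s hs => by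
    refine rExtend_mem hinf hU fun h => ?_
    have := congrArg Subtype.val h
    rw [projIcc_of_mem zero_le_one ⟨hs.1.le, hs.2.le⟩] at this
    exact hs.1.ne' this
  refine pinchedHomotopic_of_convex (E := ℝ) (S := Ioo 0 1) (T := univ)
    (fun s : ℝ => rExtend γ (projIcc 0 1 zero_le_one s)) convex_univ (convex_Ioo 0 1)
    ((continuous_rExtend hγ).comp continuous_projIcc).continuousOn hmemΦ
    (k := p₀) (l := p₁.trans p₂) (Path.continuous _) (Path.continuous _) (by simp) (by simp)
    (fun _ => mem_univ _) (fun _ => mem_univ _) ?_ ?_ ?_ ?_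
  · intro t h0 h1
    exact ⟨unit_pos h0, unit_lt_one h1⟩
  · intro t h0 h1
    rw [Path.trans_apply]
    split_ifs with h
    · exact ⟨p₁_pos _ (mul_pos two_pos (unit_pos h0)), p₁_lt _⟩
    · refine ⟨p₂_pos _, p₂_lt _ ?_⟩
      have := unit_lt_one h1
      change 2 * (t : ℝ) - 1 < 1
      linarith
  · intro t
    change rExtend γ t = rExtend γ (projIcc 0 1 zero_le_one (t : ℝ))
    rw [projIcc_val]
  · intro t
    rw [Path.trans_apply, Path.trans_apply]
    split_ifs with h
    · set s : I := ⟨2 * t, _⟩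
      have hs : p₁ s = s * T / (1 + s * T) := rfl
      have hmem : p₁ s ∈ Icc (0 : ℝ) 1 := ⟨p₁_nonneg s, (p₁_lt s).le⟩
      have hsT := mul_nonneg s.2.1 hT'.le
      rw [spherePath_apply, rInitial_apply, projIcc_of_mem zero_le_one hmem,
        rExtend_of_lt (p₁_lt s)]
      congr 2
      have hval : p₁ s / (1 - p₁ s) = s * T := by
        rw [hs]; field_simp; ring
      change _ = Real.toNNReal (p₁ s / (1 - p₁ s))
      rw [hval, Real.toNNReal_mul s.2.1, Real.toNNReal_coe]
    · set s : I := ⟨2 * t - 1, _⟩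
      have hs : p₂ s = (T * (1 - s) + s) / (1 + T * (1 - s)) := rfl
      change rExtend (fun s => γ (T + s)) s = _
      rcases eq_or_lt_of_le s.2.2 with hs1 | hs1
      · have : s = 1 := Subtype.ext hs1
        rw [this, rExtend_one]
        simp only [Path.target, projIcc_right]
        exact rExtend_one.symm
      · have hmem : p₂ s ∈ Icc (0 : ℝ) 1 := ⟨(p₂_pos s).le, (p₂_lt s hs1).le⟩
        rw [projIcc_of_mem zero_le_one hmem, rExtend_of_lt hs1,
          rExtend_of_lt (t := ⟨p₂ s, hmem⟩) (p₂_lt s hs1)]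
        congr 2
        have h1 : (0 : ℝ) < 1 - s := by linarith
        have hden : (0 : ℝ) < 1 + T * (1 - s) := by positivity
        have hval : p₂ s / (1 - p₂ s) = T + s / (1 - s) := by
          rw [hs]
          have e : (1 : ℝ) - ((T : ℝ) * (1 - (s : ℝ)) + (s : ℝ)) / (1 + (T : ℝ) * (1 - (s : ℝ))) =
              (1 - (s : ℝ)) / (1 + (T : ℝ) * (1 - (s : ℝ))) := by
            rw [eq_div_iff hden.ne', sub_mul, div_mul_cancel₀ _ hden.ne']; ring
          rw [e, div_div_div_cancel_right₀ hden.ne']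
          field_simp
        change _ = Real.toNNReal (p₂ s / (1 - p₂ s))
        rw [hval, Real.toNNReal_add hT'.le (div_nonneg s.2.1 h1.le), Real.toNNReal_coe]

end

noncomputable section

/-! ### Words from crossings -/

section Production

variable {V : Finset ℂ} {δ ρ r : ℝ}

theorem punctured_disk_mem (hρ : IsDiskRadius V ρ) {v : ℂ} (hv : v ∈ V) (hr : r < v.re - ρ) (z : ℂ)
    (hz : z ≠ v) (hd : ‖z - v‖ < ρ) : (z : OnePoint ℂ) ∈ puncturedHalfPlane V r := by
  refine coe_mem_puncturedHalfPlane.2 ⟨?_, fun hzV => ?_⟩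
  · have := abs_le.1 ((Complex.abs_re_le_norm (z - v)).trans hd.le)
    rw [Complex.sub_re] at this
    linarith [this.1]
  · have := hρ.2 z hzV v hv hz
    rw [dist_eq_norm] at this
    linarith [hρ.1]

theorem abs_slantHeight_le (hδ : 0 < δ) (hδ1 : δ < 1) (z v : ℂ) :
    |slantHeight δ z - slantHeight δ v| ≤ 2 * ‖z - v‖ := by
  rw [← map_sub, slantHeight_apply]
  have h1 := Complex.abs_re_le_norm (z - v)
  have h2 := Complex.abs_im_le_norm (z - v)
  have h3 : |δ * (z - v).re| ≤ ‖z - v‖ := by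
    rw [abs_mul, abs_of_pos hδ]
    nlinarith [abs_nonneg (z - v).re]
  calc |(z - v).im - δ * (z - v).re| ≤ |(z - v).im| + |δ * (z - v).re| := abs_sub _ _
    _ ≤ 2 * ‖z - v‖ := by linarith

/-- Near `v` only the slit of `v` matters. -/
theorem mem_slits_near (h : IsAdmissible V δ ρ) {v z : ℂ} (hv : v ∈ V) (hd : ‖z - v‖ < ρ)
    (hz : z ∈ slits V δ) : slantHeight δ z = slantHeight δ v ∧ z.re ≤ v.re := by
  obtain ⟨w, hw, h1, h2⟩ := hz
  have := eq_of_slantHeight h hw hv h1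
    ((abs_slantHeight_le h.pos h.lt_one z v).trans (by linarith))
  rw [← this]
  exact ⟨h1, h2⟩

/-- The curve is straight up to `v + ρ / 2`, and the rest lies in the slit plane, where it can be
replaced by a ray. -/
theorem straightPath_pinchedHomotopic (h : IsAdmissible V δ ρ) {v : ℂ} (hv : v ∈ V)
    (hr : r < v.re - ρ) :
    PinchedHomotopic (puncturedHalfPlane V r) (straightPath V h.disk hv)
      ((spherePath (linePath v (v + (ρ / 2 : ℝ)))).trans (rayPath δ (v + (ρ / 2 : ℝ)))) := by
  have hρ := h.disk.1
  have hc := isRCurve_straightCurve V ρ v 0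
  have hT : 0 < Real.toNNReal (ρ / 2) := by simpa using hρ
  have hTv : ((Real.toNNReal (ρ / 2) : ℝ≥0) : ℝ) = ρ / 2 := Real.coe_toNNReal _ (by positivity)
  have hy : straightCurve V ρ v (0 + (Real.toNNReal (ρ / 2) : ℝ≥0)) = v + (ρ / 2 : ℝ) := by
    rw [hTv, zero_add]
    exact straightCurve_eq h.disk hv (by linarith)
  have hx : straightCurve V ρ v (0 + ((0 : ℝ≥0) : ℝ)) = v := by
    simpa using straightCurve_eq h.disk hv hρ.le
  have hU : ∀ s : ℝ, 0 < s → straightCurve V ρ v s ∈ slitPlane V δ r := fun s hs =>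
    straightCurve_mem_slitPlane h hv hs (by linarith)
  have h1 := rPath_split (U := puncturedHalfPlane V r) infty_mem_puncturedHalfPlane hc hT hx hy
    fun t ht => slitPlane_mem (hU _ (by simpa using ht))
  have hyP : v + (ρ / 2 : ℝ) ∈ slitPlane V δ r := by
    rw [← hy]; exact hU _ (by simpa using hρ)
  refine h1.trans (PinchedHomotopic.hcomp (slitPlane_mem hyP) ?_ ?_)
  · have : rInitial hc _ hx hy = linePath v (v + (ρ / 2 : ℝ)) := by
      ext t
      rw [rInitial_apply, linePath_apply, straightCurve_eq h.disk hv]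
      · have ht : ((Real.toNNReal (t : ℝ) : ℝ≥0) : ℝ) = t := Real.coe_toNNReal _ t.2.1
        rw [zero_add, NNReal.coe_mul, hTv, ht]
        push_cast; ring
      · have ht : ((Real.toNNReal (t : ℝ) : ℝ≥0) : ℝ) = t := Real.coe_toNNReal _ t.2.1
        rw [zero_add, NNReal.coe_mul, hTv, ht]
        nlinarith [t.2.2, t.2.1]
    rw [this]
    refine .refl fun t h0 _ => ?_
    rw [← this, spherePath_apply, rInitial_apply]
    refine slitPlane_mem (hU _ ?_)
    have : 0 < Real.toNNReal (t : ℝ) * Real.toNNReal (ρ / 2) :=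
      mul_pos (by simpa using unit_pos h0) hT
    rw [zero_add]
    exact_mod_cast this
  · exact rPath_pinchedHomotopic_rayPath _ _ fun t => hU _ (by
      rw [zero_add, NNReal.coe_add, hTv]; positivity)

theorem half_disk_mem_slitPlane (h : IsAdmissible V δ ρ) {v : ℂ} (hv : v ∈ V) (hr : r < v.re - ρ)
    {z : ℂ} (hd : ‖z - v‖ < ρ) (hz : v.re < z.re) : z ∈ slitPlane V δ r :=
  ⟨by linarith [h.disk.1], fun hs => absurd (mem_slits_near h hv hd hs).2 (not_le.2 hz)⟩

/-- A short curve from `v`, followed by a ray, is homotopic to the straight curve. -/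
theorem start_pinchedHomotopic (h : IsAdmissible V δ ρ) {v : ℂ} (hv : v ∈ V) (hr : r < v.re - ρ)
    {x : ℂ} (a : Path v x) (ha : ∀ t, t ≠ 0 → a t ≠ v) (haR : ∀ t, ‖a t - v‖ < ρ / 8)
    (hx : x ∉ slits V δ) :
    PinchedHomotopic (puncturedHalfPlane V r) ((spherePath a).trans (rayPath δ x))
      (straightPath V h.disk hv) := by
  have hρ := h.disk.1
  have hU := punctured_disk_mem (r := r) h.disk hv hr
  have hxR : ‖x - v‖ < ρ / 8 := by simpa using haR 1
  have hxv : x ≠ v := by simpa using ha 1 one_ne_zero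
  have hxP : x ∈ slitPlane V δ r :=
    ⟨(coe_mem_puncturedHalfPlane.1 (hU x hxv (by linarith))).1, hx⟩
  have hdir : ‖rayDir δ‖ ≤ 2 := by
    rw [rayDir]
    refine (norm_add_le _ _).trans ?_
    simp only [norm_one, norm_mul, Complex.norm_real, Complex.norm_I, mul_one]
    rw [Real.norm_eq_abs, abs_of_pos h.pos]; linarith [h.lt_one]
  -- The point `x` may lie to the left of `v`. As `‖x - v‖ < ρ / 8`, a step of `ρ / 4` along the ray
  -- leads to a point `x'` to the right of `v`, still in the disk because `ρ / 8 + 2 (ρ / 4) < ρ`.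
  -- The right half of the disk, where `m` and `x'` lie, meets no slit.
  set x' := x + ((ρ / 4 : ℝ) : ℂ) * rayDir δ with hx'
  have hball : ∀ {z : ℂ} {s : ℝ}, ‖z - v‖ < ρ / 8 → 0 ≤ s → s ≤ ρ / 4 →
      ‖z + (s : ℂ) * rayDir δ - v‖ < ρ := fun {z s} hz h0 h1 => by
    have e : z + (s : ℂ) * rayDir δ - v = (z - v) + (s : ℂ) * rayDir δ := by ring
    rw [e]
    refine (norm_add_le _ _).trans_lt ?_
    rw [norm_mul, Complex.norm_real, Real.norm_eq_abs, abs_of_nonneg h0]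
    nlinarith
  let L : Path x x' := linePath x x'
  have hL : ∀ t, L t = x + ((t * (ρ / 4) : ℝ) : ℂ) * rayDir δ := fun t => by
    simp only [L, linePath_apply, hx']; push_cast; ring
  have hL0 : ∀ t : I, 0 ≤ (t : ℝ) * (ρ / 4) := fun t => mul_nonneg t.2.1 (by linarith)
  have hL1 : ∀ t : I, (t : ℝ) * (ρ / 4) ≤ ρ / 4 := fun t => by nlinarith [t.2.2]
  have hLP : ∀ t, L t ∈ slitPlane V δ r := fun t => by
    rw [hL]; exact add_ray_mem_slitPlane hxP (hL0 t)
  have hLR : ∀ t, ‖L t - v‖ < ρ := fun t => by rw [hL]; exact hball hxR (hL0 t) (hL1 t)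
  have hx'R : ‖x' - v‖ < ρ := by simpa using hLR 1
  have hx're : v.re < x'.re := by
    rw [hx', add_ray_re]
    have := abs_le.1 ((Complex.abs_re_le_norm (x - v)).trans hxR.le)
    rw [Complex.sub_re] at this
    linarith [this.1]
  set m := v + ((ρ / 2 : ℝ) : ℂ) with hm
  let L₁ : Path v m := linePath v m
  let L₂ : Path m x' := linePath m x'
  have hmR : ‖m - v‖ < ρ := by
    rw [hm, add_sub_cancel_left, Complex.norm_real, Real.norm_eq_abs, abs_of_pos (by positivity)]
    linarith
  have hmre : v.re < m.re := by simp [hm, hρ]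
  have hconv : Convex ℝ {z : ℂ | ‖z - v‖ < ρ} := by
    have e : {z : ℂ | ‖z - v‖ < ρ} = Metric.ball v ρ := by ext z; simp [dist_eq_norm]
    rw [e]
    exact convex_ball v ρ
  have hconv2 : Convex ℝ {z : ℂ | v.re < z.re} :=
    (convex_Ioi v.re).linear_preimage Complex.reLm
  have hL₂R : ∀ t, ‖L₂ t - v‖ < ρ := linePath_mem hconv hmR hx'R
  have hL₂re : ∀ t, v.re < (L₂ t).re := linePath_mem hconv2 hmre hx're
  have hL₂P : ∀ t, L₂ t ∈ slitPlane V δ r := fun t =>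
    half_disk_mem_slitPlane h hv hr (hL₂R t) (hL₂re t)
  have hL₁R : ∀ t, ‖L₁ t - v‖ < ρ :=
    linePath_mem hconv (show ‖v - v‖ < ρ by simpa using hρ) hmR
  have hL₁ne : ∀ t, t ≠ 0 → L₁ t ≠ v := fun t ht => by
    simp only [L₁, linePath_apply, hm, add_sub_cancel_left, ne_eq, add_eq_left, mul_eq_zero,
      Complex.ofReal_eq_zero]
    rintro (h' | h')
    · exact (unit_pos ht).ne' h'
    · linarith
  have hvm : ∀ {z : ℂ}, z ∈ slitPlane V δ r → z ≠ v := fun hz e => hz.2 (e ▸ subset_slits hv)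
  -- Both paths from `v` to `x'` leave `v` at once and stay in its disk, so their winding around `v`
  -- is immaterial.
  have key : PinchedHomotopic (puncturedHalfPlane V r) (spherePath (a.trans L))
      (spherePath (L₁.trans L₂)) := by
    refine pinchedHomotopic_of_punctured_disk hU ?_ ?_ ?_ ?_
    · intro t ht
      rw [Path.trans_apply]
      split_ifs with h'
      · refine ha _ fun e => ht (Subtype.ext ?_)
        have : 2 * (t : ℝ) = 0 := congrArg Subtype.val e
        change (t : ℝ) = 0
        linarith
      · exact hvm (hLP _)
    · intro t ht
      rw [Path.trans_apply]
      split_ifs with h'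
      · refine hL₁ne _ fun e => ht (Subtype.ext ?_)
        have : 2 * (t : ℝ) = 0 := congrArg Subtype.val e
        change (t : ℝ) = 0
        linarith
      · exact hvm (hL₂P _)
    · intro t
      rw [Path.trans_apply]
      split_ifs
      exacts [(haR _).trans (by linarith), hLR _]
    · intro t
      rw [Path.trans_apply]
      split_ifs
      exacts [hL₁R _, hL₂R _]
  have hx'P : x' ∈ slitPlane V δ r := by simpa using hLP 1
  have hmP : m ∈ slitPlane V δ r := by simpa using hL₂P 0
  have ia : InteriorIn (puncturedHalfPlane V r) (spherePath a) := fun t h0 _ =>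
    hU _ (ha t h0) ((haR t).trans (by linarith))
  have iL : InteriorIn (puncturedHalfPlane V r) (spherePath L) := fun t _ _ => slitPlane_mem (hLP t)
  have iL₁ : InteriorIn (puncturedHalfPlane V r) (spherePath L₁) := fun t h0 _ =>
    hU _ (hL₁ne t h0) (hL₁R t)
  have iL₂ : InteriorIn (puncturedHalfPlane V r) (spherePath L₂) := fun t _ _ =>
    slitPlane_mem (hL₂P t)
  have ir : ∀ {z : ℂ}, z ∈ slitPlane V δ r → InteriorIn (puncturedHalfPlane V r) (rayPath δ z) :=
    fun hz => .of_mem (rayPath_mem hz)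
  have s1 := PinchedHomotopic.hcomp (slitPlane_mem hxP) (.refl ia) (trans_rayPath L hLP).symm
  have s2 := (PinchedHomotopic.assoc ia (slitPlane_mem hxP) iL (slitPlane_mem hx'P)
    (ir hx'P)).symm
  rw [spherePath_trans, spherePath_trans] at key
  have s3 := PinchedHomotopic.hcomp (slitPlane_mem hx'P) key (.refl (ir hx'P))
  have s4 := PinchedHomotopic.assoc iL₁ (slitPlane_mem hmP) iL₂ (slitPlane_mem hx'P) (ir hx'P)
  have s5 := PinchedHomotopic.hcomp (slitPlane_mem hmP) (.refl iL₁) (trans_rayPath L₂ hL₂P)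
  exact (s1.trans (s2.trans (s3.trans (s4.trans s5)))).trans
    (straightPath_pinchedHomotopic h hv hr).symm

/-- The times at which the path `p` meets the set `S`. -/
def crossingTimes {x y : ℂ} (S : Set ℂ) (p : Path x y) : Set I := {t | t ≠ 0 ∧ p t ∈ S}

/-- If the initial part of `γ` is homotopic to a path with at most `n` crossings, and the rest of
`γ` does not meet the slits, then `γ` has a homotopy word of length at most `n`. -/
theorem exists_isHomotopyWord_of_crossings (h : IsAdmissible V δ ρ) (hr : ∀ v ∈ V, r < v.re - ρ)
    {γ : ℝ≥0 → ℂ} (hγ : IsRCurve γ) (hγr : ∀ t, r < (γ t).re) {v y : ℂ} (hv : v ∈ V)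
    (h0 : γ 0 = v) {T : ℝ≥0} (hT : 0 < T) (hy : γ T = y) (hγV : ∀ t, 0 < t → γ t ∉ V)
    (htail : ∀ t, γ (T + t) ∉ slits V δ) (q : Path v y)
    (hq : ∀ t, t ≠ 0 → r < (q t).re ∧ q t ∉ V)
    (hhom : PinchedHomotopic (puncturedHalfPlane V r) (spherePath (rInitial hγ T h0 hy))
      (spherePath q)) {n : ℕ} (hfin : (crossingTimes (slits V δ) q).Finite)
    (hcard : (crossingTimes (slits V δ) q).ncard ≤ n) :
    ∃ W, IsHomotopyWord V γ W ∧ W.norm ≤ n := by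
  have hρ := h.disk.1
  have e1 : ∀ᶠ t : I in 𝓝 0, ‖q t - v‖ < ρ / 8 := by
    have : ContinuousAt (fun t : I => ‖q t - v‖) 0 := by fun_prop
    refine this.eventually (gt_mem_nhds ?_)
    simpa using hρ
  have e2 : ∀ᶠ t : I in 𝓝 0, t ∉ crossingTimes (slits V δ) q :=
    hfin.isClosed.isOpen_compl.mem_nhds (by simp [crossingTimes])
  obtain ⟨ε, hε, hball⟩ := Metric.eventually_nhds_iff.1 (e1.and e2)
  -- Up to time `τ` there is no crossing and `q` stays within `ρ / 8` of `v`, as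
  -- `start_pinchedHomotopic` requires.
  set τ : ℝ := min (1 / 2) (ε / 2) with hτ
  have hτ0 : 0 < τ := by positivity
  have hτ1 : τ < 1 := (min_le_left _ _).trans_lt (by norm_num)
  have hτε : τ < ε := (min_le_right _ _).trans_lt (by linarith)
  have hext : ∀ t : ℝ, ∀ ht : t ∈ I, q.extend t = q ⟨t, ht⟩ := fun t ht => q.extend_apply ht
  have hsmall : ∀ t : I, (t : ℝ) ≤ τ → ‖q t - v‖ < ρ / 8 ∧ t ∉ crossingTimes (slits V δ) q :=
    fun t ht => hball (by
      rw [Subtype.dist_eq, Real.dist_eq, Icc.coe_zero, sub_zero, abs_of_nonneg t.2.1]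
      exact ht.trans_lt hτε)
  have hfc : Continuous (q.extend : ℝ → ℂ) := q.continuous_extend
  have hf0 : q.extend 0 = v := q.extend_zero
  have hf1 : q.extend 1 = y := q.extend_one
  set x := q.extend τ with hx
  have hτI : τ ∈ I := ⟨hτ0.le, hτ1.le⟩
  have hτne : (⟨τ, hτI⟩ : I) ≠ 0 := fun e => hτ0.ne' (congrArg Subtype.val e)
  have hxS : x ∉ slits V δ := fun hs => (hsmall ⟨τ, hτI⟩ le_rfl).2 ⟨hτne, by
    rw [hx, hext τ hτI] at hs; exact hs⟩
  let a : Path v x := pathOn hfc hf0 rfl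
  let c : Path x y := pathOn hfc rfl hf1
  have haI : ∀ t : I, (0 + t * (τ - 0) : ℝ) ∈ I := fun t => by
    have := pathOn_mem_Icc hτ0.le t
    exact ⟨this.1, this.2.trans hτ1.le⟩
  have hcI : ∀ t : I, (τ + t * (1 - τ) : ℝ) ∈ Icc τ 1 := fun t => pathOn_mem_Icc hτ1.le t
  have hav : ∀ t : I, a t = q ⟨_, haI t⟩ := fun t => hext _ _
  have haR : ∀ t, ‖a t - v‖ < ρ / 8 := fun t => by
    rw [hav]
    exact (hsmall _ (pathOn_mem_Icc hτ0.le t).2).1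
  have hane : ∀ t, t ≠ 0 → a t ≠ v := fun t ht e => by
    rw [hav] at e
    refine (hq ⟨_, haI t⟩ fun e' => ?_).2 (by rw [e]; exact hv)
    have h1 : (0 + t * (τ - 0) : ℝ) = 0 := congrArg Subtype.val e'
    have := mul_pos (unit_pos ht) hτ0
    linarith
  have hqpos : ∀ t ∈ Icc τ 1, r < (q.extend t).re ∧ q.extend t ∉ V := fun t ht => by
    have htI : t ∈ I := ⟨hτ0.le.trans ht.1, ht.2⟩
    rw [hext t htI]
    exact hq _ fun e => by
      have : t = 0 := congrArg Subtype.val e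
      linarith [ht.1]
  have hyS : y ∉ slits V δ := by
    have := htail 0
    rwa [add_zero, hy] at this
  have himg : (fun t : I => (t : ℝ)) '' crossingTimes (slits V δ) q ⊇
      {t ∈ Icc τ 1 | q.extend t ∈ slits V δ} := by
    rintro t ⟨ht, hs⟩
    have htI : t ∈ I := ⟨hτ0.le.trans ht.1, ht.2⟩
    refine ⟨⟨t, htI⟩, ⟨fun e => ?_, ?_⟩, rfl⟩
    · have : t = 0 := congrArg Subtype.val e
      linarith [ht.1]
    · rw [← hext t htI]; exact hs
  have hcard' : {t ∈ Icc τ 1 | q.extend t ∈ slits V δ}.ncard ≤ n :=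
    (Set.ncard_le_ncard himg (hfin.image _)).trans ((Set.ncard_image_le hfin).trans hcard)
  obtain ⟨l, hl, hlw⟩ := exists_word_of_crossings h hr hfc hf1 hyS n hτ1.le rfl hxS hqpos
    ((hfin.image _).subset himg) hcard'
  have hU : ∀ t, 0 < t → (γ t : OnePoint ℂ) ∈ puncturedHalfPlane V r := fun t ht =>
    coe_mem_puncturedHalfPlane.2 ⟨hγr t, hγV t ht⟩
  have hyU : (y : OnePoint ℂ) ∈ puncturedHalfPlane V r := hy ▸ hU T hT
  have hxP : x ∈ slitPlane V δ r := ⟨(hqpos τ ⟨le_rfl, hτ1.le⟩).1, hxS⟩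
  have hyP : y ∈ slitPlane V δ r := ⟨hy ▸ hγr T, hyS⟩
  have ia : InteriorIn (puncturedHalfPlane V r) (spherePath a) := fun t h0 _ =>
    punctured_disk_mem h.disk hv (hr v hv) _ (hane t h0) ((haR t).trans (by linarith))
  have ic : InteriorIn (puncturedHalfPlane V r) (spherePath c) := fun t _ _ =>
    coe_mem_puncturedHalfPlane.2 (hqpos _ (hcI t))
  have ir : ∀ {z : ℂ}, z ∈ slitPlane V δ r → InteriorIn (puncturedHalfPlane V r) (rayPath δ z) :=
    fun hz => .of_mem (rayPath_mem hz)
  -- The curve `γ` becomes `q` followed by a ray, and `q` is cut at `τ`. The part after `τ` with the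
  -- ray gives a ray times the word; the part before `τ` with that ray gives the straight curve.
  have s1 := rPath_split (U := puncturedHalfPlane V r) infty_mem_puncturedHalfPlane hγ hT h0 hy hU
  have s2 := PinchedHomotopic.hcomp hyU hhom (rPath_pinchedHomotopic_rayPath (hγ.shift T)
    (by simpa using hy) (δ := δ) (V := V) (r := r) fun t => ⟨hγr _, htail t⟩)
  have hsplit : PinchedHomotopic (puncturedHalfPlane V r) (spherePath q)
      ((spherePath a).trans (spherePath c)) := by
    have := pathOn_trans_pinchedHomotopic (U := puncturedHalfPlane V r) hfc hf0 rfl hf1 hτ0 hτ1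
      fun t ht => ?_
    · convert this using 1
      ext t
      simp [pathOn_apply]
    · rw [hext t ⟨ht.1.le, ht.2.le⟩]
      exact coe_mem_puncturedHalfPlane.2 (hq _ fun e => ht.1.ne' (congrArg Subtype.val e))
  have s3 := PinchedHomotopic.hcomp hyU hsplit (.refl (ir hyP))
  have s4 := PinchedHomotopic.assoc ia (slitPlane_mem hxP) ic hyU (ir hyP)
  have s5 := PinchedHomotopic.hcomp (slitPlane_mem hxP) (.refl ia) hlw
  have iw : ∀ l, InteriorIn (puncturedHalfPlane V r) (wordLoop V h.disk l) := fun l =>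
    .of_mem (wordLoop_mem h.disk hr l)
  have s6 := (PinchedHomotopic.assoc ia (slitPlane_mem hxP) (ir hxP) infty_mem_puncturedHalfPlane
    (iw l)).symm
  have s7 := PinchedHomotopic.hcomp infty_mem_puncturedHalfPlane
    (start_pinchedHomotopic h hv (hr v hv) a hane haR hxS) (wordLoop_reduce h.disk hr l)
  refine ⟨FreeGroup.mk l, ?_, FreeGroup.norm_mk_le.trans hl⟩
  subst h0
  exact ⟨hγ, hv, r, ρ, h.disk, hr, hγr,
    s1.trans (s2.trans (s3.trans (s4.trans (s5.trans (s6.trans s7)))))⟩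

end Production

end

noncomputable section

/-! ### Existence of homotopy words -/

/-- The contraction of `[0, 1]` onto its first half. -/
def firstHalf (s : I) : I := ⟨s / 2, by have := s.2.1; positivity, by have := s.2.2; linarith⟩

/-- The contraction of `[0, 1]` onto its second half. -/
def secondHalf (s : I) : I :=
  ⟨(s + 1) / 2, by have := s.2.1; positivity, by have := s.2.2; linarith⟩

theorem crossingTimes_trans_subset {x y z : ℂ} (S : Set ℂ) (p : Path x y) (q : Path y z) :
    crossingTimes S (p.trans q) ⊆
      firstHalf '' crossingTimes S p ∪ secondHalf '' crossingTimes S q := by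
  rintro t ⟨h0, hS⟩
  rw [Path.trans_apply] at hS
  split_ifs at hS with h
  · left
    refine ⟨_, ⟨?_, hS⟩, ?_⟩
    · intro e
      have h1 : 2 * (t : ℝ) = 0 := congrArg Subtype.val e
      exact h0 (Subtype.ext (show (t : ℝ) = 0 by linarith))
    · exact Subtype.ext (show 2 * (t : ℝ) / 2 = t by ring)
  · right
    refine ⟨_, ⟨?_, hS⟩, ?_⟩
    · intro e
      have h1 : 2 * (t : ℝ) - 1 = 0 := congrArg Subtype.val e
      exact h (by linarith)
    · exact Subtype.ext (show (2 * (t : ℝ) - 1 + 1) / 2 = t by ring)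

theorem crossingTimes_trans_finite {x y z : ℂ} {S : Set ℂ} {p : Path x y} {q : Path y z}
    (hp : (crossingTimes S p).Finite) (hq : (crossingTimes S q).Finite) :
    (crossingTimes S (p.trans q)).Finite :=
  ((hp.image _).union (hq.image _)).subset (crossingTimes_trans_subset S p q)

theorem IsRCurve.exists_lt_re {γ : ℝ≥0 → ℂ} (hγ : IsRCurve γ) : ∃ r : ℝ, ∀ t, r < (γ t).re := by
  obtain ⟨T, hT⟩ := (hγ.2.eventually (eventually_gt_atTop (0 : ℝ))).exists_forall_of_atTop
  obtain ⟨t₀, -, hmin⟩ := (isCompact_Icc (a := (0 : ℝ≥0)) (b := T)).exists_isMinOn ⟨0, by simp⟩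
    (f := fun t => (γ t).re) (Complex.continuous_re.comp hγ.1).continuousOn
  refine ⟨min 0 ((γ t₀).re) - 1, fun t => ?_⟩
  have h1 := min_le_left 0 (γ t₀).re
  have h2 := min_le_right 0 (γ t₀).re
  rcases le_total T t with h | h
  · linarith [hT t h]
  · have : (γ t₀).re ≤ (γ t).re := hmin ⟨zero_le, h⟩
    linarith

theorem exists_lt_forall_finset (V : Finset ℂ) (f : ℂ → ℝ) (r : ℝ) :
    ∃ s ≤ r, ∀ v ∈ V, s < f v := by
  have h1 : ∀ᶠ s : ℝ in atBot, ∀ v ∈ V, s < f v :=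
    (Finset.eventually_all V).2 fun v _ => eventually_lt_atBot _
  obtain ⟨s, hs, hs'⟩ := ((eventually_le_atBot r).and h1).exists
  exact ⟨s, hs, hs'⟩

theorem IsRCurve.exists_tail {γ : ℝ≥0 → ℂ} (hγ : IsRCurve γ) (V : Finset ℂ) (M : ℝ) :
    ∃ T : ℝ≥0, 0 < T ∧ ∀ t, M < (γ (T + t)).re ∧ ∀ v ∈ V, v.re < (γ (T + t)).re := by
  have h1 : ∀ᶠ t in atTop, ∀ v ∈ V, v.re < (γ t).re :=
    (Finset.eventually_all V).2 fun v _ => hγ.2.eventually (eventually_gt_atTop _)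
  obtain ⟨T, hT⟩ := ((hγ.2.eventually (eventually_gt_atTop M)).and h1).exists_forall_of_atTop
  refine ⟨T + 1, by positivity, fun t => hT _ ?_⟩
  rw [add_assoc]
  exact le_self_add

/-- The curve may meet the slits infinitely often. Away from its start it is perturbed vertically
until its slant height is a polynomial in time, which takes each of the finitely many heights of
points of `V` only finitely often. Near the start it is replaced by a segment, using the punctured
disk. -/
theorem exists_isHomotopyWord {V : Finset ℂ} {γ : ℝ≥0 → ℂ} (h : IsRCurveFrom V γ) :
    ∃ W, IsHomotopyWord V γ W := by
  obtain ⟨hγ, hv, hγV⟩ := h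
  obtain ⟨δ, -, ρ, hρ, hadm⟩ := exists_isAdmissible V Set.finite_empty
  have hA := hadm ρ hρ le_rfl
  obtain ⟨r₀, hr₀⟩ := hγ.exists_lt_re
  obtain ⟨r, hrr₀, hr⟩ := exists_lt_forall_finset V (fun v => v.re - ρ) r₀
  have hγr : ∀ t, r < (γ t).re := fun t => hrr₀.trans_lt (hr₀ t)
  obtain ⟨T, hT, htail⟩ := hγ.exists_tail V 0
  set v := γ 0 with hvdef
  have hT' : (0 : ℝ) < T := hT
  let g : ℝ → ℂ := fun s => γ (Real.toNNReal s)
  have hg : Continuous g := hγ.1.comp continuous_real_toNNReal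
  have hg0 : g 0 = v := by simp [g, hvdef]
  have hgT : g T = γ T := by simp [g]
  have hgV : ∀ s, 0 < s → g s ∉ V := fun s hs => hγV _ (by simpa using hs)
  obtain ⟨ε, hε, hsmall⟩ : ∃ ε > 0, ∀ s, |s| < ε → ‖g s - v‖ < ρ / 16 := by
    have := Metric.continuousAt_iff.1 (hg.continuousAt (x := 0)) (ρ / 16) (by positivity)
    simpa [hg0, dist_eq_norm] using this
  set τ := min (ε / 2) (T / 2) with hτ
  have hτ0 : 0 < τ := by positivity
  have hτε : τ < ε := (min_le_left _ _).trans_lt (by linarith)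
  have hτT : τ < T := (min_le_right _ _).trans_lt (by linarith)
  have hnear : ∀ s ∈ Icc 0 τ, ‖g s - v‖ < ρ / 16 := fun s hs =>
    hsmall s (by rw [abs_of_nonneg hs.1]; linarith [hs.2])
  -- On `[τ, T]` the distance of `g` from `V` is at least `η`, so perturbations by less than `η`
  -- never meet `V`.
  obtain ⟨η, hη, hηρ, hηd⟩ : ∃ η > 0, η ≤ ρ / 16 ∧ ∀ s ∈ Icc τ T, ∀ w ∈ V, η ≤ ‖g s - w‖ := by
    have h1 : ∀ᶠ η in 𝓝[>] (0 : ℝ), ∀ w ∈ V, ∀ s ∈ Icc τ (T : ℝ), η ≤ ‖g s - w‖ := by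
      refine (Finset.eventually_all V).2 fun w hw => ?_
      obtain ⟨s₀, hs₀, hmin⟩ := (isCompact_Icc (a := τ) (b := (T : ℝ))).exists_isMinOn
        ⟨τ, le_rfl, hτT.le⟩ (f := fun s => ‖g s - w‖) (by fun_prop)
      have hpos : 0 < ‖g s₀ - w‖ := by
        refine norm_pos_iff.2 (sub_ne_zero.2 fun e => hgV s₀ (hτ0.trans_le hs₀.1) (e ▸ hw))
      filter_upwards [nhdsWithin_le_nhds (eventually_lt_nhds hpos)] with η hη s hs
      exact hη.le.trans (hmin hs)
    have h2 : ∀ᶠ η in 𝓝[>] (0 : ℝ), η < ρ / 16 :=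
      nhdsWithin_le_nhds (eventually_lt_nhds (by positivity))
    have h3 : ∀ᶠ η in 𝓝[>] (0 : ℝ), 0 < η := self_mem_nhdsWithin
    obtain ⟨η, h1, h2, h3⟩ := (h1.and (h2.and h3)).exists
    exact ⟨η, h3, h2.le, fun s hs w hw => h1 w hw s hs⟩
  have hslc : Continuous (slantHeight δ) := LinearMap.continuous_of_finiteDimensional _
  obtain ⟨P₀, hP₀⟩ := exists_polynomial_near_of_continuousOn τ T (fun s => slantHeight δ (g s))
    (hslc.comp hg).continuousOn (η / 2) (by positivity)
  -- The constant `c` moves the height at `τ` off the heights of all points of `V`. So `P` minus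
  -- such a height is not the zero polynomial, and the new point `x₁` lies on no slit.
  obtain ⟨c, ⟨hc0, hcη⟩, hcV⟩ : ∃ c ∈ Ioo 0 (η / 2),
      c ∉ ((fun w => slantHeight δ w - P₀.eval τ) '' (V : Set ℂ)) :=
    ((Ioo_infinite (by positivity : (0 : ℝ) < η / 2)).sdiff
      (V.finite_toSet.image _)).nonempty
  set P := P₀ + Polynomial.C c with hP
  have hPev : ∀ s, P.eval s = P₀.eval s + c := fun s => by simp [hP]
  have hPnear : ∀ s ∈ Icc τ (T : ℝ), |P.eval s - slantHeight δ (g s)| < η := fun s hs => by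
    have := abs_lt.1 (hP₀ s hs)
    rw [hPev, abs_lt]
    constructor <;> linarith [this.1, this.2]
  have hPτ : ∀ w ∈ V, P.eval τ ≠ slantHeight δ w := fun w hw e => hcV ⟨w, hw, by
    rw [hPev] at e
    dsimp only
    linarith⟩
  -- The motion is vertical: real parts are kept, and at `p.2 = 1` the slant height is `P`.
  let Φ : ℝ × ℝ → ℂ := fun p =>
    g p.1 + ((p.2 * (P.eval p.1 - slantHeight δ (g p.1)) : ℝ) : ℂ) * Complex.I
  have hΦc : Continuous Φ := by
    have h1 : Continuous fun p : ℝ × ℝ => P.eval p.1 := P.continuous.comp continuous_fst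
    have h2 : Continuous fun p : ℝ × ℝ => slantHeight δ (g p.1) :=
      hslc.comp (hg.comp continuous_fst)
    have h3 : Continuous fun p : ℝ × ℝ => g p.1 := hg.comp continuous_fst
    have h4 : Continuous fun p : ℝ × ℝ => p.2 * (P.eval p.1 - slantHeight δ (g p.1)) :=
      continuous_snd.mul (h1.sub h2)
    exact h3.add ((Complex.continuous_ofReal.comp h4).mul continuous_const)
  have hΦre : ∀ p, (Φ p).re = (g p.1).re := fun p => by simp [Φ]
  have hΦht : ∀ s, slantHeight δ (Φ (s, 1)) = P.eval s := fun s => by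
    simp only [Φ, slantHeight_apply]
    simp
    ring
  have hΦd : ∀ p : ℝ × ℝ, p.1 ∈ Icc τ (T : ℝ) → p.2 ∈ Icc (0 : ℝ) 1 → ‖Φ p - g p.1‖ < η :=
    fun p h1 h2 => by
      simp only [Φ, add_sub_cancel_left, norm_mul, Complex.norm_I, mul_one, Complex.norm_real,
        Real.norm_eq_abs, abs_of_nonneg h2.1]
      have := hPnear p.1 h1
      nlinarith [h2.1, h2.2, abs_nonneg (P.eval p.1 - slantHeight δ (g p.1))]
  have hgr : ∀ s, r < (g s).re := fun s => hγr _
  have hΦU : ∀ p : ℝ × ℝ, p.1 ∈ Icc τ (T : ℝ) → p.2 ∈ Icc (0 : ℝ) 1 →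
      r < (Φ p).re ∧ Φ p ∉ V := fun p h1 h2 => by
    refine ⟨by rw [hΦre]; exact hgr _, fun hw => ?_⟩
    have h3 := hηd p.1 h1 _ hw
    rw [norm_sub_rev] at h3
    linarith [hΦd p h1 h2]
  have hΦ0 : ∀ s, Φ (s, 0) = g s := fun s => by simp [Φ]
  set x₁ := Φ (τ, 1) with hx₁
  set z₁ := Φ (T, 1) with hz₁
  have hfc : Continuous fun s : ℝ => Φ (s, 1) := hΦc.comp (by fun_prop)
  let A : Path v (g τ) := pathOn hg hg0 rfl
  let B : Path (g τ) (γ T) := pathOn hg rfl hgT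
  let J : Path (g τ) x₁ := pathOn (f := fun u => Φ (τ, u)) (hΦc.comp (by fun_prop)) (a := 0) (b := 1)
    (hΦ0 τ) rfl
  let M : Path x₁ z₁ := pathOn hfc rfl rfl
  let K : Path z₁ (γ T) := pathOn (f := fun u => Φ (T, u)) (hΦc.comp (by fun_prop)) (a := 1) (b := 0)
    rfl ((hΦ0 T).trans hgT)
  let L : Path v x₁ := linePath v x₁
  have hI : ∀ t : I, (0 : ℝ) + t * (1 - 0) ∈ Icc (0 : ℝ) 1 := fun t =>
    pathOn_mem_Icc zero_le_one t
  have hτI : τ ∈ Icc τ (T : ℝ) := ⟨le_rfl, hτT.le⟩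
  have hTI : (T : ℝ) ∈ Icc τ (T : ℝ) := ⟨hτT.le, le_rfl⟩
  have h1I : (1 : ℝ) ∈ Icc (0 : ℝ) 1 := ⟨zero_le_one, le_rfl⟩
  have hJU : ∀ t, r < (J t).re ∧ J t ∉ V := fun t => hΦU (τ, _) hτI (hI t)
  have hMU : ∀ t, r < (M t).re ∧ M t ∉ V := fun t => hΦU (_, 1) (pathOn_mem_Icc hτT.le t) h1I
  have hKI : ∀ t : I, (1 : ℝ) + t * (0 - 1) ∈ Icc (0 : ℝ) 1 := fun t => by
    have := t.2.1; have := t.2.2; constructor <;> linarith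
  have hKU : ∀ t, r < (K t).re ∧ K t ∉ V := fun t => hΦU (T, _) hTI (hKI t)
  have hx₁R : ‖x₁ - v‖ < ρ / 8 := by
    have h1 := hΦd (τ, 1) hτI h1I
    have h2 := hnear τ ⟨hτ0.le, le_rfl⟩
    have e : x₁ - v = (x₁ - g τ) + (g τ - v) := by ring
    rw [e]
    exact (norm_add_le _ _).trans_lt (by linarith)
  have hx₁S : x₁ ∉ slits V δ := by
    rintro ⟨w, hw, h1, -⟩
    exact hPτ w hw (by rw [← hΦht τ]; exact h1)
  have hLR : ∀ t, ‖L t - v‖ < ρ / 8 := fun t => by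
    have : L t - v = ((t : ℝ) : ℂ) * (x₁ - v) := by simp [L, linePath_apply]
    rw [this, norm_mul, Complex.norm_real, Real.norm_eq_abs, abs_of_nonneg t.2.1]
    nlinarith [t.2.2, norm_nonneg (x₁ - v)]
  -- The slit of `v` is a ray from `v`, so the segment from `v` to `x₁` meets it after time 0 only
  -- if `x₁` lies on it.
  have hLS : ∀ t, t ≠ 0 → L t ∉ slits V δ := fun t ht hs => by
    obtain ⟨h1, h2⟩ := mem_slits_near hA hv ((hLR t).trans (by linarith)) hs
    have ht0 := unit_pos ht
    have e1 : slantHeight δ (L t) = slantHeight δ v + t * (slantHeight δ x₁ - slantHeight δ v) := by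
      simp only [L, linePath_apply, slantHeight_apply]
      simp; ring
    have e2 : (L t).re = v.re + t * (x₁.re - v.re) := by simp [L, linePath_apply]
    rw [e1] at h1
    rw [e2] at h2
    refine hx₁S ⟨v, hv, ?_, ?_⟩
    · have : (t : ℝ) * (slantHeight δ x₁ - slantHeight δ v) = 0 := by linarith
      rcases mul_eq_zero.1 this with h' | h'
      · exact absurd h' ht0.ne'
      · linarith
    · by_contra hcon
      push Not at hcon
      nlinarith
  have hLv : ∀ t, t ≠ 0 → L t ≠ v := fun t ht e => hLS t ht (by rw [e]; exact subset_slits hv)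
  have hU := punctured_disk_mem (r := r) hA.disk hv (hr v hv)
  have mJ : ∀ t, spherePath J t ∈ puncturedHalfPlane V r := fun t =>
    coe_mem_puncturedHalfPlane.2 (hJU t)
  have mM : ∀ t, spherePath M t ∈ puncturedHalfPlane V r := fun t =>
    coe_mem_puncturedHalfPlane.2 (hMU t)
  have mK : ∀ t, spherePath K t ∈ puncturedHalfPlane V r := fun t =>
    coe_mem_puncturedHalfPlane.2 (hKU t)
  have hAR : ∀ t, ‖A t - v‖ < ρ / 16 := fun t => hnear _ (pathOn_mem_Icc hτ0.le t)
  have hAv : ∀ t, t ≠ 0 → A t ∉ V := fun t ht => hgV _ (by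
    have := mul_pos (unit_pos ht) hτ0
    linarith)
  have iA : InteriorIn (puncturedHalfPlane V r) (spherePath A) := fun t h0 _ =>
    coe_mem_puncturedHalfPlane.2 ⟨hgr _, hAv t h0⟩
  have hgτU : (g τ : OnePoint ℂ) ∈ puncturedHalfPlane V r :=
    coe_mem_puncturedHalfPlane.2 ⟨hgr _, hgV τ hτ0⟩
  have hx₁U : (x₁ : OnePoint ℂ) ∈ puncturedHalfPlane V r := by simpa using mM 0
  have hz₁U : (z₁ : OnePoint ℂ) ∈ puncturedHalfPlane V r := by simpa using mK 0
  have iMK : InteriorIn (puncturedHalfPlane V r) ((spherePath M).trans (spherePath K)) :=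
    .of_mem (Path.trans_mem mM mK)
  have s1 : PinchedHomotopic (puncturedHalfPlane V r) (spherePath (rInitial hγ T rfl rfl))
      ((spherePath A).trans (spherePath B)) := by
    have := pathOn_trans_pinchedHomotopic (U := puncturedHalfPlane V r) hg hg0 rfl hgT hτ0 hτT
      fun t ht => coe_mem_puncturedHalfPlane.2 ⟨hgr t, hgV t ht.1⟩
    convert this using 1
    congr 1
    ext t
    rw [rInitial_apply, pathOn_apply]
    simp only [g]
    congr 1
    rw [sub_zero, zero_add, Real.toNNReal_mul t.2.1, Real.toNNReal_coe]
  -- In the parameter rectangle, the side `u = 0` is homotopic to the remaining three sides.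
  have s2 : PinchedHomotopic (puncturedHalfPlane V r) (spherePath B)
      ((spherePath J).trans ((spherePath M).trans (spherePath K))) := by
    let k (a b : ℝ) : Path a b := pathOn continuous_id rfl rfl
    have hconv : Convex ℝ (Icc τ (T : ℝ) ×ˢ Icc (0 : ℝ) 1) := (convex_Icc _ _).prod (convex_Icc _ _)
    let l : Path ((τ, 0) : ℝ × ℝ) (T, 0) := ((Path.refl τ).prod (k 0 1)).trans
      (((k τ T).prod (Path.refl 1)).trans ((Path.refl (T : ℝ)).prod (k 1 0)))
    have hl : ∀ t, l t ∈ Icc τ (T : ℝ) ×ˢ Icc (0 : ℝ) 1 := fun t => by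
      simp only [l]
      rw [Path.trans_apply]
      split_ifs
      · exact ⟨hτI, pathOn_mem_Icc zero_le_one _⟩
      · rw [Path.trans_apply]
        split_ifs
        · exact ⟨pathOn_mem_Icc hτT.le _, h1I⟩
        · exact ⟨hTI, hKI _⟩
    refine pinchedHomotopic_of_convex (E := ℝ × ℝ) (fun p => (Φ p : OnePoint ℂ)) hconv hconv
      (OnePoint.continuous_coe.comp hΦc).continuousOn
      (fun p hp => coe_mem_puncturedHalfPlane.2 (hΦU p hp.1 hp.2))
      (k := (k τ T).prod (Path.refl 0)) (l := l) (Path.continuous _) (Path.continuous _)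
      (by simp) (by simp) ?_ hl ?_ (fun t _ _ => hl t) ?_ ?_
    · exact fun t => ⟨pathOn_mem_Icc hτT.le _, by simp⟩
    · exact fun t _ _ => ⟨pathOn_mem_Icc hτT.le _, by simp⟩
    · intro t
      change ((g _ : ℂ) : OnePoint ℂ) = ((Φ (_, 0) : ℂ) : OnePoint ℂ)
      rw [hΦ0]
      rfl
    · intro t
      simp only [l]
      rw [Path.trans_apply, Path.trans_apply]
      split_ifs
      · rfl
      · rw [Path.trans_apply, Path.trans_apply]
        split_ifs <;> rfl
  have s3 := PinchedHomotopic.hcomp hgτU (.refl iA) s2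
  have s4 := (PinchedHomotopic.assoc iA hgτU (.of_mem mJ) hx₁U iMK).symm
  have s5 : PinchedHomotopic (puncturedHalfPlane V r) ((spherePath A).trans (spherePath J))
      (spherePath L) := by
    rw [← spherePath_trans]
    refine pinchedHomotopic_of_punctured_disk hU ?_ hLv ?_ fun t => (hLR t).trans (by linarith)
    · intro t ht
      rw [Path.trans_apply]
      split_ifs with h'
      · refine fun e => hAv _ (fun e' => ht (Subtype.ext ?_)) (by rw [e]; exact hv)
        have : 2 * (t : ℝ) = 0 := congrArg Subtype.val e'
        change (t : ℝ) = 0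
        linarith
      · exact fun e => (hJU _).2 (by rw [e]; exact hv)
    · intro t
      rw [Path.trans_apply]
      split_ifs with h'
      · exact (hAR _).trans (by linarith)
      · have h1 := hΦd (τ, _) hτI (hI ⟨2 * t - 1,
          unitInterval.two_mul_sub_one_mem_iff.2 ⟨(not_le.1 h').le, t.2.2⟩⟩)
        have h2 := hnear τ ⟨hτ0.le, le_rfl⟩
        rw [← sub_add_sub_cancel _ (g τ) v]
        refine (norm_add_le _ _).trans_lt ?_
        change ‖Φ (τ, _) - g τ‖ + _ < _
        linarith
  have s6 := PinchedHomotopic.hcomp hx₁U s5 (.refl iMK)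
  have hfinL : (crossingTimes (slits V δ) L).Finite := by
    convert Set.finite_empty
    ext t
    simp only [crossingTimes, mem_ofPred_eq, mem_empty_iff_false, iff_false, not_and]
    exact hLS t
  have hfinK : (crossingTimes (slits V δ) K).Finite := by
    convert Set.finite_empty
    ext t
    simp only [crossingTimes, mem_ofPred_eq, mem_empty_iff_false, iff_false, not_and]
    intro _
    refine notMem_slits_of_re fun w hw => ?_
    change w.re < (Φ (T, _)).re
    rw [hΦre]
    have := (htail 0).2 w hw
    simpa [hgT] using this
  have hfinM : (crossingTimes (slits V δ) M).Finite := by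
    have hroots : (⋃ w ∈ V, {s : ℝ | (P - Polynomial.C (slantHeight δ w)).IsRoot s}).Finite := by
      refine V.finite_toSet.biUnion fun w hw => Polynomial.finite_setOfPred_isRoot fun e => ?_
      have := congrArg (Polynomial.eval τ) e
      simp only [Polynomial.eval_sub, Polynomial.eval_C, Polynomial.eval_zero] at this
      exact hPτ w hw (by linarith)
    refine Set.Finite.of_finite_image (f := fun t : I => τ + (t : ℝ) * (T - τ))
      (hroots.subset ?_) ?_
    · rintro _ ⟨t, ⟨-, w, hw, h1, -⟩, rfl⟩
      simp only [mem_iUnion]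
      refine ⟨w, hw, ?_⟩
      have h2 : slantHeight δ (M t) = P.eval (τ + (t : ℝ) * (T - τ)) := hΦht _
      simp only [mem_ofPred_eq, Polynomial.IsRoot, Polynomial.eval_sub, Polynomial.eval_C]
      rw [← h2, h1, sub_self]
    · intro t _ t' _ e
      have h3 : (T : ℝ) - τ ≠ 0 := by linarith
      exact Subtype.ext (mul_right_cancel₀ h3 (by simpa using e))
  have hq : ∀ t, t ≠ 0 → r < ((L.trans (M.trans K)) t).re ∧ (L.trans (M.trans K)) t ∉ V := by
    intro t ht
    rw [Path.trans_apply]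
    split_ifs with h'
    · refine coe_mem_puncturedHalfPlane.1 (hU _ (hLv _ fun e => ht (Subtype.ext ?_))
        ((hLR _).trans (by linarith)))
      have : 2 * (t : ℝ) = 0 := congrArg Subtype.val e
      change (t : ℝ) = 0
      linarith
    · rw [Path.trans_apply]
      split_ifs
      exacts [hMU _, hKU _]
  obtain ⟨W, hW, -⟩ := exists_isHomotopyWord_of_crossings hA hr hγ hγr hv rfl hT rfl hγV
    (fun t => notMem_slits_of_re (htail t).2) (L.trans (M.trans K)) hq
    (by rw [spherePath_trans, spherePath_trans]; exact s1.trans (s3.trans (s4.trans s6)))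
    (crossingTimes_trans_finite hfinL (crossingTimes_trans_finite hfinM hfinK)) le_rfl
  exact ⟨W, hW⟩

theorem exists_isHomotopyWord_norm_eq {V : Finset ℂ} {γ : ℝ≥0 → ℂ} (h : IsRCurveFrom V γ) :
    ∃ W, IsHomotopyWord V γ W ∧ W.norm = homotopyWordLength V γ := by
  obtain ⟨W, hW⟩ := exists_isHomotopyWord h
  exact Nat.sInf_mem (s := {k | ∃ W : FreeGroup V, IsHomotopyWord V γ W ∧ W.norm = k})
    ⟨_, W, hW, rfl⟩

theorem homotopyWordLength_le {V : Finset ℂ} {γ : ℝ≥0 → ℂ} {W : FreeGroup V}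
    (h : IsHomotopyWord V γ W) : homotopyWordLength V γ ≤ W.norm :=
  Nat.sInf_le ⟨W, h, rfl⟩

end

/-! ### Realizing words by polygonal paths. -/

noncomputable section

/-! ### Independence of the radius of the disks -/

section Radius

variable {V : Finset ℂ} {ρ ρ' r : ℝ}

theorem IsDiskRadius.of_le (hρ : IsDiskRadius V ρ) (h0 : 0 < ρ') (h : ρ' ≤ ρ) :
    IsDiskRadius V ρ' :=
  ⟨h0, fun u hu w hw hne => by linarith [hρ.2 u hu w hw hne]⟩

/-- The radii interpolating between `ρ` and `ρ'`. -/
def midRadius (ρ ρ' u : ℝ) : ℝ := ρ + u * (ρ' - ρ)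

theorem midRadius_mem (h : ρ' ≤ ρ) {u : ℝ} (hu : u ∈ Icc (0 : ℝ) 1) :
    midRadius ρ ρ' u ∈ Icc ρ' ρ := by
  unfold midRadius
  constructor <;> nlinarith [hu.1, hu.2]

theorem isDiskRadius_midRadius (hρ : IsDiskRadius V ρ) (h0 : 0 < ρ') (h : ρ' ≤ ρ) {u : ℝ}
    (hu : u ∈ Icc (0 : ℝ) 1) : IsDiskRadius V (midRadius ρ ρ' u) :=
  hρ.of_le (h0.trans_le (midRadius_mem h hu).1) (midRadius_mem h hu).2

/-- A homotopy word comes with some radius, while the slit calculus needs one that is small compared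
with the slope. The half-circles are shrunk continuously. -/
theorem straightPath_radius (hρ : IsDiskRadius V ρ) (hρ' : IsDiskRadius V ρ') (h : ρ' ≤ ρ) {w : ℂ}
    (hw : w ∈ V) (hr : r < w.re) :
    PinchedHomotopic (puncturedHalfPlane V r) (straightPath V hρ hw) (straightPath V hρ' hw) := by
  have hfam : IsRFamily fun (u : I) (s : ℝ≥0) => straightCurve V (midRadius ρ ρ' u) w (0 + s) := by
    refine ⟨by unfold straightCurve midRadius; fun_prop, fun s => w.re + s,
      tendsto_atTop_add_const_left _ _ (NNReal.tendsto_coe_atTop.2 tendsto_id), fun u t => ?_⟩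
    rw [straightCurve_re, zero_add]
  have hd : ∀ u : I, IsDiskRadius V (midRadius ρ ρ' u) := fun u =>
    isDiskRadius_midRadius hρ hρ'.1 h u.2
  refine hfam.pinchedHomotopic infty_mem_puncturedHalfPlane (fun u => ?_) (fun u t ht => ?_)
    _ _ _ _ (by simp [midRadius]) (by simp [midRadius])
  · have := straightCurve_eq (hd u) hw (hd u).1.le
    simpa using this
  · have ht' : (0 : ℝ) < t := ht
    refine coe_mem_puncturedHalfPlane.2 ⟨?_, straightCurve_notMem (hd u) (by linarith)⟩
    rw [straightCurve_re]
    linarith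

/-- Shrinking the radius moves the start of the arm from `w + ρ` to `w + ρ'`, which accounts for the
segment. -/
theorem armPath_radius (hρ : IsDiskRadius V ρ) (hρ' : IsDiskRadius V ρ') (h : ρ' ≤ ρ) {w : ℂ}
    (hw : w ∈ V) (hr : r < w.re) :
    PinchedHomotopic (puncturedHalfPlane V r)
      ((spherePath (linePath (w + ρ) (w + ρ'))).trans (armPath V hρ' hw)) (armPath V hρ hw) := by
  have hfam : IsRFamily fun (u : I) (s : ℝ≥0) =>
      straightCurve V (midRadius ρ ρ' u) w (midRadius ρ ρ' u + s) := by
    refine ⟨by unfold straightCurve midRadius; fun_prop, fun s => w.re + s,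
      tendsto_atTop_add_const_left _ _ (NNReal.tendsto_coe_atTop.2 tendsto_id), fun u t => ?_⟩
    rw [straightCurve_re]
    linarith [(midRadius_mem h u.2).1, hρ'.1]
  have hd : ∀ u : I, IsDiskRadius V (midRadius ρ ρ' u) := fun u =>
    isDiskRadius_midRadius hρ hρ'.1 h u.2
  refine hfam.pinchedHomotopic_moving infty_mem_puncturedHalfPlane (fun u t => ?_) _ (fun u => ?_)
    _ _ _ _ (by simp [midRadius]) (by simp [midRadius])
  · have := (hd u).1
    refine coe_mem_puncturedHalfPlane.2 ⟨?_,
      straightCurve_notMem (hd u) (add_pos_of_pos_of_nonneg this t.2)⟩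
    rw [straightCurve_re]
    linarith [t.2]
  · rw [NNReal.coe_zero, add_zero, straightCurve_eq (hd u) hw le_rfl, linePath_apply]
    simp only [midRadius]
    push_cast; ring

/-- In the coordinates radius and angle the region between the circles is a rectangle; the two paths
are one side and the other three. -/
theorem clockwiseCircle_radius (hρ : IsDiskRadius V ρ) (hρ' : IsDiskRadius V ρ') (h : ρ' ≤ ρ)
    {w : ℂ} (hw : w ∈ V) (hr : r < w.re - ρ) :
    PinchedHomotopic (puncturedHalfPlane V r) (clockwiseCircle ρ w)
      ((spherePath (linePath (w + ρ) (w + ρ'))).trans ((clockwiseCircle ρ' w).trans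
        (spherePath (linePath (w + ρ) (w + ρ'))).symm)) := by
  have hS : Convex ℝ (Icc (0 : ℝ) 1 ×ˢ (univ : Set ℝ)) := (convex_Icc 0 1).prod convex_univ
  let p₀ : Path (0 : ℝ) 1 := ⟨⟨fun t => t, by fun_prop⟩, rfl, rfl⟩
  have hp₀ : ∀ t, p₀ t ∈ Icc (0 : ℝ) 1 := fun t => t.2
  have hl : ∀ t, ((p₀.prod (Path.refl (0 : ℝ))).trans (((Path.refl (1 : ℝ)).prod p₀).trans
      (p₀.symm.prod (Path.refl (1 : ℝ))))) t ∈ Icc (0 : ℝ) 1 ×ˢ (univ : Set ℝ) := fun t => by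
    rw [Path.trans_apply]
    split_ifs
    · exact ⟨hp₀ _, mem_univ _⟩
    · rw [Path.trans_apply]
      split_ifs
      · exact ⟨⟨zero_le_one, le_rfl⟩, mem_univ _⟩
      · exact ⟨hp₀ _, mem_univ _⟩
  have hk : ∀ t, ((Path.refl (0 : ℝ)).prod p₀) t ∈ Icc (0 : ℝ) 1 ×ˢ (univ : Set ℝ) := fun t =>
    ⟨⟨le_rfl, zero_le_one⟩, mem_univ _⟩
  refine pinchedHomotopic_of_convex (E := ℝ × ℝ)
    (fun x : ℝ × ℝ => ((circleCurve (midRadius ρ ρ' x.1) w x.2 : ℂ) : OnePoint ℂ)) hS hS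
    (OnePoint.continuous_coe.comp (by unfold circleCurve midRadius; fun_prop)).continuousOn
    (fun x hx => ?_) (k := (Path.refl (0 : ℝ)).prod p₀)
    (l := (p₀.prod (Path.refl (0 : ℝ))).trans (((Path.refl (1 : ℝ)).prod p₀).trans
      (p₀.symm.prod (Path.refl (1 : ℝ))))) (Path.continuous _) (Path.continuous _) (by simp)
    (by simp) hk hl (fun t _ _ => hk t) (fun t _ _ => hl t) ?_ ?_
  · refine circleCurve_mem (isDiskRadius_midRadius hρ hρ'.1 h hx.1) hw ?_ _
    linarith [(midRadius_mem h hx.1).2]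
  · intro t
    rw [clockwiseCircle_eq]
    simp [pathOn_apply, midRadius, p₀]
  · intro t
    rw [Path.trans_apply, Path.trans_apply]
    split_ifs
    · simp only [spherePath_apply, linePath_apply, Path.prod_coe, Path.refl_apply,
        circleCurve_zero, midRadius, p₀]
      congr 1
      simp
      ring
    · rw [Path.trans_apply, Path.trans_apply]
      split_ifs
      · rw [clockwiseCircle_eq]
        simp [pathOn_apply, midRadius, p₀]
      · simp only [Path.symm_apply, Function.comp, spherePath_apply, linePath_apply,
          Path.prod_coe, Path.refl_apply, circleCurve_one, midRadius, p₀]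
        congr 1
        simp
        ring

/-- The segments joining the two circles cancel between the arms and the circle. -/
theorem generatorLoop_radius (hρ : IsDiskRadius V ρ) (hρ' : IsDiskRadius V ρ') (h : ρ' ≤ ρ) {w : ℂ}
    (hw : w ∈ V) (hr : r < w.re - ρ) :
    PinchedHomotopic (puncturedHalfPlane V r) (generatorLoop V hρ hw)
      (generatorLoop V hρ' hw) := by
  have hr₀ : r < w.re := by linarith [hρ.1]
  have hr' : r < w.re - ρ' := by linarith
  have a := armPath_mem hρ hw hr
  have a' := armPath_mem hρ' hw hr'
  have c := clockwiseCircle_mem hρ hw hr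
  have c' := clockwiseCircle_mem hρ' hw hr'
  have l : ∀ t, spherePath (linePath (w + ρ) (w + ρ')) t ∈ puncturedHalfPlane V r := by
    intro t
    have hd : ∀ z ∈ segment ℝ (w + (ρ : ℂ)) (w + ρ'), r < z.re ∧ z ∉ V := by
      rintro z ⟨α, β, hα, hβ, hαβ, rfl⟩
      have e : α • (w + (ρ : ℂ)) + β • (w + (ρ' : ℂ)) = circleCurve (α * ρ + β * ρ') w 0 := by
        rw [circleCurve_zero, Complex.real_smul, Complex.real_smul]
        have : (α : ℂ) + β = 1 := by exact_mod_cast hαβ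
        push_cast
        linear_combination w * this
      have h1 : α * ρ + β * ρ' ≤ ρ := by nlinarith
      have h2 : ρ' ≤ α * ρ + β * ρ' := by nlinarith
      rw [e]
      exact coe_mem_puncturedHalfPlane.1 (circleCurve_mem
        (hρ.of_le (hρ'.1.trans_le h2) h1) hw (by linarith) 0)
    exact coe_mem_puncturedHalfPlane.2 (hd _ (linePath_mem (convex_segment _ _)
      (left_mem_segment ℝ _ _) (right_mem_segment ℝ _ _) t))
  have as := Path.symm_mem a
  have as' := Path.symm_mem a'
  have ls := Path.symm_mem l
  have hA : pathClass _ a = (pathClass _ l).trans (pathClass _ a') := by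
    rw [← pathClass_trans _ _ (Path.trans_mem l a'), pathClass_eq_iff]
    exact (armPath_radius hρ hρ' h hw hr₀).symm
  have hC : pathClass _ c = (pathClass _ l).trans ((pathClass _ c').trans (pathClass _ ls)) := by
    rw [← pathClass_trans _ _ (Path.trans_mem c' ls),
      ← pathClass_trans _ _ (Path.trans_mem l (Path.trans_mem c' ls)), pathClass_eq_iff]
    exact clockwiseCircle_radius hρ hρ' h hw hr
  have hG : ∀ {ρ : ℝ} (hρ : IsDiskRadius V ρ) (hr : r < w.re - ρ),
      pathClass _ (generatorLoop_mem hρ hw hr) = ((pathClass _ (armPath_mem hρ hw hr)).symm.trans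
        (pathClass _ (clockwiseCircle_mem hρ hw hr))).trans (pathClass _ (armPath_mem hρ hw hr)) := by
    intro ρ hρ hr
    have a := armPath_mem hρ hw hr
    have as : ∀ t, (armPath V hρ hw).symm t ∈ puncturedHalfPlane V r := Path.symm_mem a
    have c := clockwiseCircle_mem hρ hw hr
    rw [← pathClass_symm a as, ← pathClass_trans as c (Path.trans_mem as c),
      ← pathClass_trans _ a (Path.trans_mem (Path.trans_mem as c) a)]
    rfl
  rw [← pathClass_eq_iff (generatorLoop_mem hρ hw hr) (generatorLoop_mem hρ' hw hr'), hG hρ hr,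
    hG hρ' hr', hA, hC, pathClass_symm l]
  simp only [Path.Homotopic.Quotient.trans_assoc, quotient_trans_symm_rev,
    quotient_symm_trans_cancel]

theorem wordLoop_radius (hρ : IsDiskRadius V ρ) (hρ' : IsDiskRadius V ρ') (h : ρ' ≤ ρ)
    (hr : ∀ v ∈ V, r < v.re - ρ) (l : List (V × Bool)) :
    PinchedHomotopic (puncturedHalfPlane V r) (wordLoop V hρ l) (wordLoop V hρ' l) := by
  induction l with
  | nil => exact .refl (.refl infty_mem_puncturedHalfPlane)
  | cons x l ih =>
    rw [wordLoop_cons, wordLoop_cons]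
    refine PinchedHomotopic.hcomp infty_mem_puncturedHalfPlane ?_ ih
    have := generatorLoop_radius hρ hρ' h x.1.2 (hr _ x.1.2)
    rw [letterLoop, letterLoop]
    split_ifs
    exacts [this, this.symm₂]

end Radius

end

noncomputable section

/-! ### Polygonal paths -/

/-- `p` is the concatenation (in any order of bracketing) of the listed segments. -/
inductive IsPolygonal : List (ℂ × ℂ) → ∀ {x y : ℂ}, Path x y → Prop
  | line (x y : ℂ) : IsPolygonal [(x, y)] (linePath x y)
  | trans {l l' : List (ℂ × ℂ)} {x y z : ℂ} {p : Path x y} {q : Path y z} :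
      IsPolygonal l p → IsPolygonal l' q → IsPolygonal (l ++ l') (p.trans q)

section Polygonal

variable {V : Finset ℂ} {δ ρ r M S : ℝ} {b : ℂ}

/-- The ray is the right half of the slit line of `v`, and the slit lines of other points are
parallel to it and distinct from it. -/
theorem add_ray_notMem_slits_of_mem (h : IsAdmissible V δ ρ) {v : ℂ} (hv : v ∈ V) {s : ℝ}
    (hs : 0 < s) : v + s * rayDir δ ∉ slits V δ := by
  rintro ⟨w, hw, h1, h2⟩
  obtain rfl := eq_of_slantHeight h hw hv h1
    (by rw [slantHeight_add_ray, sub_self, abs_zero]; linarith [h.disk.1])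
  rw [add_ray_re] at h2
  linarith

theorem linePath_right_mem_slitPlane (hM : ∀ w ∈ V, w.re ≤ M) (hr : r ≤ M) {x y : ℂ}
    (hx : M < x.re) (hy : M < y.re) (t : I) : linePath x y t ∈ slitPlane V δ r := by
  have : M < (linePath x y t).re :=
    linePath_mem ((convex_Ioi M).linear_preimage Complex.reLm) hx hy t
  exact ⟨hr.trans_lt this, notMem_slits_of_re fun w hw => (hM w hw).trans_lt this⟩

theorem linePath_ray_mem_slitPlane {x : ℂ} (hx : x ∈ slitPlane V δ r) (hS : 0 ≤ S) (t : I) :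
    linePath x (x + S * rayDir δ) t ∈ slitPlane V δ r := by
  have : linePath x (x + S * rayDir δ) t = x + ((t * S : ℝ) : ℂ) * rayDir δ := by
    rw [linePath_apply]; push_cast; ring
  rw [this]
  exact add_ray_mem_slitPlane hx (mul_nonneg t.2.1 hS)

/-- From a point `x` of the slit plane along a ray, and then to `b`. -/
theorem connect_trans_rayPath (hM : ∀ w ∈ V, w.re ≤ M) (hr : r ≤ M) (hb : M < b.re)
    (hS : b.re - r < S) {x : ℂ} (hx : x ∈ slitPlane V δ r) :
    (∀ t, ((linePath x (x + S * rayDir δ)).trans (linePath (x + S * rayDir δ) b)) t ∈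
      slitPlane V δ r) ∧ b ≠ x + S * rayDir δ ∧ x ≠ x + S * rayDir δ := by
  have hS0 : 0 < S := by linarith
  have hre : b.re < (x + S * rayDir δ).re := by rw [add_ray_re]; linarith [hx.1]
  refine ⟨fun t => ?_, fun e => ?_, fun e => ?_⟩
  · rw [Path.trans_apply]
    split_ifs
    · exact linePath_ray_mem_slitPlane hx hS0.le _
    · exact linePath_right_mem_slitPlane hM hr (hb.trans hre) hb _
  · rw [← e] at hre; exact lt_irrefl _ hre
  · have := congrArg Complex.re e
    rw [add_ray_re] at this
    linarith

/-- A polygonal loop at `b` representing a letter. -/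
theorem exists_polygonal_letter (h : IsAdmissible V δ ρ) (hr : ∀ v ∈ V, r < v.re - ρ)
    (hM : ∀ w ∈ V, w.re ≤ M) (hrM : r ≤ M) (hb : M < b.re) (c : V × Bool) :
    ∃ (L : List (ℂ × ℂ)) (q : Path b b), IsPolygonal L q ∧ L.length = 5 ∧
      (∀ s ∈ L, s.1 ≠ s.2) ∧ (∀ t, r < (q t).re ∧ q t ∉ V) ∧
      PinchedHomotopic (puncturedHalfPlane V r) ((spherePath q).trans (rayPath δ b))
        ((rayPath δ b).trans (letterLoop V h.disk c)) := by
  obtain ⟨⟨w, hw⟩, β⟩ := c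
  have hρ := h.disk.1
  -- A point with real part above `r`, moved by `S` along a ray, passes the abscissa of `b`. So the
  -- segment from there to `b` is nondegenerate and lies to the right of `V`.
  set S := b.re - r + 1 with hSdef
  have hS : b.re - r < S := by linarith
  have hbP : b ∈ slitPlane V δ r :=
    ⟨by linarith, notMem_slits_of_re fun w hw => (hM w hw).trans_lt hb⟩
  -- The loop goes from `b` to `y` by two segments, across the slit to `x` by one, and back to `b`
  -- by two. The outer four lie in the slit plane, so only the crossing counts.
  have key : ∀ y x : ℂ, y ∈ slitStrip δ ρ r w → x ∈ slitStrip δ ρ r w → y ≠ x →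
      slantHeight δ y ≠ slantHeight δ w → slantHeight δ x ≠ slantHeight δ w →
      ∀ g : Path (∞ : OnePoint ℂ) ∞, (∀ t, g t ∈ puncturedHalfPlane V r) →
      PinchedHomotopic (puncturedHalfPlane V r) ((spherePath (linePath y x)).trans (rayPath δ x))
        ((rayPath δ y).trans g) →
      ∃ (L : List (ℂ × ℂ)) (q : Path b b), IsPolygonal L q ∧ L.length = 5 ∧
        (∀ s ∈ L, s.1 ≠ s.2) ∧ (∀ t, r < (q t).re ∧ q t ∉ V) ∧
        PinchedHomotopic (puncturedHalfPlane V r) ((spherePath q).trans (rayPath δ b))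
          ((rayPath δ b).trans g) := by
    intro y x hy hx hyx hyw hxw g hg hcross
    have hyP := slitStrip_mem_slitPlane h hw hy hyw
    have hxP := slitStrip_mem_slitPlane h hw hx hxw
    obtain ⟨hcy, hby, hyS⟩ := connect_trans_rayPath hM hrM hb hS hyP
    obtain ⟨hcx, hbx, hxS⟩ := connect_trans_rayPath hM hrM hb hS hxP
    set A := (linePath y (y + S * rayDir δ)).trans (linePath (y + S * rayDir δ) b) with hA
    set C := (linePath x (x + S * rayDir δ)).trans (linePath (x + S * rayDir δ) b) with hC
    have hAs : A.symm = (linePath b (y + S * rayDir δ)).trans (linePath (y + S * rayDir δ) y) := by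
      rw [hA, Path.trans_symm, linePath_symm, linePath_symm]
    have mA : ∀ t, spherePath A.symm t ∈ puncturedHalfPlane V r := fun t => slitPlane_mem (hcy _)
    have mC : ∀ t, spherePath C t ∈ puncturedHalfPlane V r := fun t => slitPlane_mem (hcx _)
    have mL : ∀ t, spherePath (linePath y x) t ∈ puncturedHalfPlane V r := fun t =>
      slitStrip_mem h hw (linePath_mem (convex_slitStrip δ ρ r w) hy hx t)
    refine ⟨[(b, y + S * rayDir δ), (y + S * rayDir δ, y), (y, x), (x, x + S * rayDir δ),
      (x + S * rayDir δ, b)], A.symm.trans ((linePath y x).trans C), ?_, rfl, ?_, ?_, ?_⟩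
    · rw [hAs]
      exact .trans (.trans (.line _ _) (.line _ _))
        (.trans (.line _ _) (.trans (.line _ _) (.line _ _)))
    · simp [hby, hyx, hxS, hyS.symm, hbx.symm]
    · intro t
      have := Path.trans_mem mA (Path.trans_mem mL mC) t
      rw [← spherePath_trans, ← spherePath_trans] at this
      exact coe_mem_puncturedHalfPlane.1 this
    · have mray := rayPath_mem hbP
      have mrayx := rayPath_mem hxP
      have mrayy := rayPath_mem hyP
      have inf := infty_mem_puncturedHalfPlane (V := V) (r := r)
      have mLC := Path.trans_mem mL mC
      rw [spherePath_trans, spherePath_trans]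
      have e1 := trans_rayPath C hcx
      have e2 := trans_rayPath A.symm fun t => hcy _
      rw [← pathClass_eq_iff (Path.trans_mem mC mray) mrayx, pathClass_trans mC mray] at e1
      rw [← pathClass_eq_iff (Path.trans_mem mA mrayy) mray, pathClass_trans mA mrayy] at e2
      rw [← pathClass_eq_iff (Path.trans_mem mL mrayx) (Path.trans_mem mrayy hg),
        pathClass_trans mL mrayx, pathClass_trans mrayy hg] at hcross
      rw [← pathClass_eq_iff (Path.trans_mem (Path.trans_mem mA mLC) mray)
        (Path.trans_mem mray hg), pathClass_trans (Path.trans_mem mA mLC) mray,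
        pathClass_trans mA mLC, pathClass_trans mL mC, pathClass_trans mray hg,
        Path.Homotopic.Quotient.trans_assoc, Path.Homotopic.Quotient.trans_assoc, e1, hcross,
        ← Path.Homotopic.Quotient.trans_assoc, e2]
  have hlow : slantHeight δ (w + (-ρ : ℝ) * rayDir δ - ρ * Complex.I) = slantHeight δ w - ρ := by
    rw [map_sub, slantHeight_add_ray]; simp [slantHeight_apply]
  have hupp : slantHeight δ (w + (-ρ : ℝ) * rayDir δ + ρ * Complex.I) = slantHeight δ w + ρ := by
    rw [map_add, slantHeight_add_ray]; simp [slantHeight_apply]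
  have rel : (w + (-ρ : ℝ) * rayDir δ - ρ * Complex.I).re = w.re - ρ := by
    rw [Complex.sub_re, add_ray_re]; simp; ring
  have reu : (w + (-ρ : ℝ) * rayDir δ + ρ * Complex.I).re = w.re - ρ := by
    rw [Complex.add_re, add_ray_re]; simp; ring
  set y := w + (-ρ : ℝ) * rayDir δ - ρ * Complex.I
  set x := w + (-ρ : ℝ) * rayDir δ + ρ * Complex.I
  have hrw := hr w hw
  have hy : y ∈ slitStrip δ ρ r w := by
    refine ⟨?_, ?_⟩
    · rw [rel]; constructor <;> linarith
    · rw [hlow]; constructor <;> linarith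
  have hx : x ∈ slitStrip δ ρ r w := by
    refine ⟨?_, ?_⟩
    · rw [reu]; constructor <;> linarith
    · rw [hupp]; constructor <;> linarith
  have hyw : slantHeight δ y < slantHeight δ w := by linarith
  have hxw : slantHeight δ w < slantHeight δ x := by linarith
  have hyx : y ≠ x := fun e => by rw [e] at hyw; linarith
  have hline : ∀ {p q : ℂ}, p ∈ slitStrip δ ρ r w → q ∈ slitStrip δ ρ r w →
      ∀ t, linePath p q t ∈ slitStrip δ ρ r w := fun hp hq => linePath_mem (convex_slitStrip _ _ _ _)
        hp hq
  have hm := letterLoop_mem h.disk hr (⟨w, hw⟩, β)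
  cases β with
  | true =>
    exact key y x hy hx hyx hyw.ne hxw.ne' _ hm (crossing_up h hw hrw _ (hline hy hx) hyw hxw)
  | false =>
    exact key x y hx hy hyx.symm hxw.ne' hyw.ne _ hm
      (crossing_down h hw hrw _ (hline hx hy) hyw hxw)

/-- A polygonal path from `v` to `b` replacing the straight curve. -/
theorem exists_polygonal_start (h : IsAdmissible V δ ρ) (hr : ∀ v ∈ V, r < v.re - ρ)
    (hM : ∀ w ∈ V, w.re ≤ M) (hrM : r ≤ M) (hb : M < b.re) {v : ℂ} (hv : v ∈ V) :
    ∃ (L : List (ℂ × ℂ)) (q : Path v b), IsPolygonal L q ∧ L.length = 2 ∧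
      (∀ s ∈ L, s.1 ≠ s.2) ∧ (∀ t, t ≠ 0 → r < (q t).re ∧ q t ∉ V) ∧
      PinchedHomotopic (puncturedHalfPlane V r) ((spherePath q).trans (rayPath δ b))
        (straightPath V h.disk hv) := by
  have hρ := h.disk.1
  have hrv := hr v hv
  set S := b.re - r + 1 with hSdef
  have hvM := hM v hv
  have hS0 : 1 < S := by linarith
  -- As `‖e‖ ≤ 2`, the bound `ρ / 32` keeps the initial piece within `ρ / 8` of `v`, as
  -- `start_pinchedHomotopic` requires; the bound `1 / 2` makes `s₀ < S`.
  set s₀ := min (ρ / 32) (1 / 2) with hs₀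
  have hs₀0 : 0 < s₀ := by positivity
  have hs₀S : s₀ < S := (min_le_right _ _).trans_lt (by linarith)
  set e := rayDir δ
  have ray : ∀ s : ℝ, 0 < s → v + s * e ∈ slitPlane V δ r := fun s hs =>
    ⟨by rw [add_ray_re]; linarith, add_ray_notMem_slits_of_mem h hv hs⟩
  have hbP : b ∈ slitPlane V δ r :=
    ⟨by linarith, notMem_slits_of_re fun w hw => (hM w hw).trans_lt hb⟩
  have hreS : b.re < (v + S * e).re := by rw [add_ray_re]; linarith
  have hne : ‖e‖ ≤ 2 := by
    have := Complex.norm_le_abs_re_add_abs_im e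
    rw [rayDir_re, rayDir_im, abs_one, abs_of_pos h.pos] at this
    linarith [h.lt_one]
  have e0 : ∀ s : ℝ, ∀ t : I, linePath v (v + s * e) t = v + ((t * s : ℝ) : ℂ) * e := fun s t => by
    rw [linePath_apply]; push_cast; ring
  have hstart := start_pinchedHomotopic h hv hrv (linePath v (v + s₀ * e))
    (fun t ht e' => by
      rw [e0] at e'
      refine (ray _ (mul_pos (unit_pos ht) hs₀0)).2 ?_
      rw [e']; exact subset_slits hv)
    (fun t => by
      rw [e0, add_sub_cancel_left, norm_mul, Complex.norm_real, Real.norm_eq_abs,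
        abs_of_nonneg (mul_nonneg t.2.1 hs₀0.le)]
      have h1 : t * s₀ ≤ ρ / 32 := by
        have := min_le_left (ρ / 32) (1 / 2)
        nlinarith [t.2.1, t.2.2]
      nlinarith [norm_nonneg e, mul_nonneg t.2.1 hs₀0.le]) (ray s₀ hs₀0).2
  have mS : ∀ t, linePath (v + s₀ * e) (v + S * e) t ∈ slitPlane V δ r := fun t => by
    have : linePath (v + s₀ * e) (v + S * e) t =
        v + ((s₀ + t * (S - s₀) : ℝ) : ℂ) * e := by
      rw [linePath_apply]; push_cast; ring
    rw [this]
    exact ray _ (by nlinarith [t.2.1])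
  have mB : ∀ t, linePath (v + S * e) b t ∈ slitPlane V δ r :=
    linePath_right_mem_slitPlane hM hrM (hb.trans hreS) hb
  have hsplit : PinchedHomotopic (puncturedHalfPlane V r) (spherePath (linePath v (v + S * e)))
      ((spherePath (linePath v (v + s₀ * e))).trans
        (spherePath (linePath (v + s₀ * e) (v + S * e)))) := by
    have hc : Continuous fun s : ℝ => v + (s : ℂ) * e := by fun_prop
    have := pathOn_trans_pinchedHomotopic (U := puncturedHalfPlane V r) hc (a := 0) (b := s₀)
      (c := S) (x := v) (by simp) rfl rfl hs₀0 hs₀S fun t ht => slitPlane_mem (ray t ht.1)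
    convert this using 2
    · ext t; rw [e0, pathOn_apply]; simp
    · congr 1
      ext t; rw [e0, pathOn_apply]; simp
    · congr 1
      ext t; rw [linePath_apply, pathOn_apply]; push_cast; ring
  have mS' : ∀ t, spherePath (linePath (v + s₀ * e) (v + S * e)) t ∈ puncturedHalfPlane V r :=
    fun t => slitPlane_mem (mS t)
  have mB' : ∀ t, spherePath (linePath (v + S * e) b) t ∈ puncturedHalfPlane V r :=
    fun t => slitPlane_mem (mB t)
  have mR := rayPath_mem hbP
  have mR₀ := rayPath_mem (ray s₀ hs₀0)
  have mRS := rayPath_mem (ray S (by linarith))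
  have iA : InteriorIn (puncturedHalfPlane V r) (spherePath (linePath v (v + s₀ * e))) :=
    fun t h0 _ => by
      rw [spherePath_apply, e0]
      exact slitPlane_mem (ray _ (mul_pos (unit_pos h0) hs₀0))
  have us₀ := slitPlane_mem (ray s₀ hs₀0)
  have uS := slitPlane_mem (ray S (by linarith))
  have ub := slitPlane_mem hbP
  have hq : ∀ t, t ≠ 0 → (((linePath v (v + S * e)).trans (linePath (v + S * e) b) t : ℂ) :
      OnePoint ℂ) ∈ puncturedHalfPlane V r := fun t ht => by
    rw [Path.trans_apply]
    split_ifs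
    · rw [e0]
      exact slitPlane_mem (ray _ (mul_pos (mul_pos two_pos (unit_pos ht)) (by linarith)))
    · exact slitPlane_mem (mB _)
  refine ⟨[(v, v + S * e), (v + S * e, b)], (linePath v (v + S * e)).trans (linePath (v + S * e) b),
    .trans (.line _ _) (.line _ _), rfl, ?_, fun t ht => coe_mem_puncturedHalfPlane.1 (hq t ht), ?_⟩
  · simp only [List.mem_cons, List.not_mem_nil, or_false, forall_eq_or_imp, forall_eq]
    refine ⟨fun e' => ?_, fun e' => ?_⟩
    · have := congrArg Complex.re e'
      rw [add_ray_re] at this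
      linarith
    · rw [e'] at hreS; exact lt_irrefl _ hreS
  · rw [spherePath_trans]
    refine PinchedHomotopic.trans ?_ hstart
    refine (PinchedHomotopic.hcomp ub (.hcomp uS hsplit (.refl (.of_mem mB')))
      (.refl (.of_mem mR))).trans ?_
    refine (PinchedHomotopic.assoc (iA.trans us₀ (.of_mem mS')) uS (.of_mem mB') ub
      (.of_mem mR)).trans ?_
    refine (PinchedHomotopic.hcomp uS (.refl (iA.trans us₀ (.of_mem mS')))
      (trans_rayPath _ mB)).trans ?_
    refine (PinchedHomotopic.assoc iA us₀ (.of_mem mS') uS (.of_mem mRS)).trans ?_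
    exact PinchedHomotopic.hcomp us₀ (.refl iA) (trans_rayPath _ mS)

/-- Letters are appended one at a time at `b`: the ray of `b` followed by a letter is homotopic to a
polygonal loop at `b` followed by the ray, so the ray moves past the whole word. -/
theorem exists_polygonal_word (h : IsAdmissible V δ ρ) (hr : ∀ v ∈ V, r < v.re - ρ)
    (hM : ∀ w ∈ V, w.re ≤ M) (hrM : r ≤ M) (hb : M < b.re) (l : List (V × Bool)) :
    ∀ {v : ℂ} (L : List (ℂ × ℂ)) (q : Path v b), IsPolygonal L q → (∀ s ∈ L, s.1 ≠ s.2) →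
      (∀ t, t ≠ 0 → r < (q t).re ∧ q t ∉ V) →
    ∃ (L' : List (ℂ × ℂ)) (q' : Path v b), IsPolygonal L' q' ∧
      L'.length = L.length + 5 * l.length ∧ (∀ s ∈ L', s.1 ≠ s.2) ∧
      (∀ t, t ≠ 0 → r < (q' t).re ∧ q' t ∉ V) ∧
      PinchedHomotopic (puncturedHalfPlane V r)
        ((spherePath q).trans ((rayPath δ b).trans (wordLoop V h.disk l)))
        ((spherePath q').trans (rayPath δ b)) := by
  have hbP : b ∈ slitPlane V δ r :=
    ⟨by linarith, notMem_slits_of_re fun w hw => (hM w hw).trans_lt hb⟩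
  have ub := slitPlane_mem hbP
  have inf := infty_mem_puncturedHalfPlane (V := V) (r := r)
  have mR := rayPath_mem hbP
  have int : ∀ {v : ℂ} (q : Path v b), (∀ t, t ≠ 0 → r < (q t).re ∧ q t ∉ V) →
      InteriorIn (puncturedHalfPlane V r) (spherePath q) := fun q hq t h0 _ =>
    coe_mem_puncturedHalfPlane.2 (hq t h0)
  induction l with
  | nil =>
    intro v L q hLq hL hq
    exact ⟨L, q, hLq, rfl, hL, hq, .hcomp ub (.refl (int q hq))
      (.trans_refl (.of_mem mR) inf)⟩
  | cons c l ih =>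
    intro v L q hLq hL hq
    obtain ⟨L₁, q₁, hLq₁, hlen, hL₁, hq₁, hhom₁⟩ := exists_polygonal_letter h hr hM hrM hb c
    have hq' : ∀ t, t ≠ 0 → r < ((q.trans q₁) t).re ∧ (q.trans q₁) t ∉ V := fun t ht => by
      rw [Path.trans_apply]
      split_ifs with ht'
      · refine hq _ fun e => ht (Subtype.ext ?_)
        have : 2 * (t : ℝ) = 0 := congrArg Subtype.val e
        change (t : ℝ) = 0
        linarith
      · exact hq₁ _
    obtain ⟨L', q', hLq', hlen', hL', hq'', hhom⟩ := ih (L ++ L₁) (q.trans q₁) (.trans hLq hLq₁)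
      (fun s hs => (List.mem_append.1 hs).elim (hL s) (hL₁ s)) hq'
    refine ⟨L', q', hLq', ?_, hL', hq'', PinchedHomotopic.trans ?_ hhom⟩
    · rw [hlen', List.length_append, hlen, List.length_cons]; ring
    · have mc : InteriorIn (puncturedHalfPlane V r) (letterLoop V h.disk c) :=
        .of_mem (letterLoop_mem h.disk hr c)
      have mw : InteriorIn (puncturedHalfPlane V r) (wordLoop V h.disk l) :=
        .of_mem (wordLoop_mem h.disk hr l)
      have mq₁ : InteriorIn (puncturedHalfPlane V r) (spherePath q₁) :=
        .of_mem fun t => coe_mem_puncturedHalfPlane.2 (hq₁ t)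
      have mR' := InteriorIn.of_mem mR
      rw [wordLoop_cons, spherePath_trans]
      refine PinchedHomotopic.trans ?_
        (PinchedHomotopic.assoc (int q hq) ub mq₁ ub (mR'.trans inf mw)).symm
      refine PinchedHomotopic.hcomp ub (.refl (int q hq)) ?_
      refine (PinchedHomotopic.assoc mR' inf mc inf mw).symm.trans ?_
      exact (PinchedHomotopic.hcomp inf hhom₁.symm (.refl mw)).trans
        (PinchedHomotopic.assoc mq₁ ub mR' inf mw)

end Polygonal

/-- An r-curve with a homotopy word of length `m` is homotopic, up to a far point of it, to a
polygonal path with `5 m + 2` segments. -/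
theorem IsHomotopyWord.exists_polygonal {V : Finset ℂ} {γ : ℝ≥0 → ℂ} {W : FreeGroup V}
    (hγ : IsRCurve γ) (hγV : ∀ t, 0 < t → γ t ∉ V) (hW : IsHomotopyWord V γ W) :
    ∃ (r : ℝ) (T₀ : ℝ≥0), (∀ v ∈ V, r < v.re) ∧ (∀ t, r < (γ t).re) ∧ ∀ T ≥ T₀, 0 < T →
      ∃ (L : List (ℂ × ℂ)) (q : Path (γ 0) (γ T)), IsPolygonal L q ∧ L.length = 5 * W.norm + 2 ∧
        (∀ s ∈ L, s.1 ≠ s.2) ∧ PinchedHomotopic (puncturedHalfPlane V r)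
          (spherePath (rInitial hγ T rfl rfl)) (spherePath q) := by
  obtain ⟨hγ', hv, r, ρ, hρ, hr, hγr, hhom⟩ := hW
  obtain ⟨δ, -, ρ₀, hρ₀, hadm⟩ := exists_isAdmissible V finite_empty
  -- The word has a radius `ρ` of its own. The smaller radius is admissible, and by
  -- `straightPath_radius` and `wordLoop_radius` the same word describes the curve with it.
  have hpos : 0 < min ρ ρ₀ := lt_min hρ.1 hρ₀
  have hA := hadm (min ρ ρ₀) hpos (min_le_right _ _)
  have hle : min ρ ρ₀ ≤ ρ := min_le_left _ _
  have hr' : ∀ v ∈ V, r < v.re - min ρ ρ₀ := fun v hv => by linarith [hr v hv]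
  have hrv : ∀ v ∈ V, r < v.re := fun v hv => by linarith [hr v hv, hρ.1]
  obtain ⟨M, hM⟩ : ∃ M, ∀ w ∈ V, w.re ≤ M := by
    obtain ⟨s, -, hs⟩ := exists_lt_forall_finset V (fun w => -w.re) 0
    exact ⟨-s, fun w hw => by linarith [hs w hw]⟩
  have hrM : r ≤ M := (hrv _ hv).le.trans (hM _ hv)
  obtain ⟨T₀, hT₀⟩ := (hγ.2.eventually (eventually_gt_atTop M)).exists_forall_of_atTop
  refine ⟨r, T₀, hrv, hγr, fun T hT hT0 => ?_⟩
  have hb : M < (γ T).re := hT₀ T hT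
  have htail : ∀ s, γ (T + s) ∈ slitPlane V δ r := fun s =>
    ⟨hγr _, notMem_slits_of_re fun w hw =>
      (hM w hw).trans_lt (hT₀ _ (hT.trans le_self_add))⟩
  have hbP : γ T ∈ slitPlane V δ r := by simpa using htail 0
  have ub := slitPlane_mem hbP
  have inf := infty_mem_puncturedHalfPlane (V := V) (r := r)
  have mR := rayPath_mem hbP
  obtain ⟨L, q, hLq, hlen, hL, hq, hstart⟩ := exists_polygonal_start hA hr' hM hrM hb hv
  obtain ⟨L', q', hLq', hlen', hL', hq', hword⟩ := exists_polygonal_word hA hr' hM hrM hb W.toWord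
    L q hLq hL hq
  have hU : ∀ t, 0 < t → (γ t : OnePoint ℂ) ∈ puncturedHalfPlane V r := fun t ht =>
    coe_mem_puncturedHalfPlane.2 ⟨hγr t, hγV t ht⟩
  refine ⟨L', q', hLq', by rw [hlen', hlen, FreeGroup.norm]; ring, hL', ?_⟩
  have i0 : InteriorIn (puncturedHalfPlane V r) (spherePath (rInitial hγ T rfl rfl)) :=
    fun t h0 _ => hU _ (mul_pos (by simpa using unit_pos h0) hT0)
  have iq : InteriorIn (puncturedHalfPlane V r) (spherePath q) := fun t h0 _ =>
    coe_mem_puncturedHalfPlane.2 (hq t h0)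
  have iq' : InteriorIn (puncturedHalfPlane V r) (spherePath q') := fun t h0 _ =>
    coe_mem_puncturedHalfPlane.2 (hq' t h0)
  have iw : InteriorIn (puncturedHalfPlane V r) (wordLoop V hA.disk W.toWord) :=
    .of_mem (wordLoop_mem hA.disk hr' _)
  -- Beyond `γ T` the curve is homotopic to a ray, so it suffices to compare the two paths with this
  -- ray attached.
  refine PinchedHomotopic.cancel_right i0 iq' ub (.of_mem mR) inf ?_
  refine PinchedHomotopic.trans ?_ hword
  refine PinchedHomotopic.trans ?_ (PinchedHomotopic.assoc iq ub (.of_mem mR) inf iw)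
  refine PinchedHomotopic.trans ?_ (PinchedHomotopic.hcomp inf hstart.symm (.refl iw))
  refine PinchedHomotopic.trans ?_ (PinchedHomotopic.hcomp inf
    (straightPath_radius hρ hA.disk hle hv (hrv _ hv)) (wordLoop_radius hρ hA.disk hle hr _))
  refine PinchedHomotopic.trans ?_ hhom
  refine PinchedHomotopic.trans ?_ (rPath_split inf hγ hT0 rfl rfl hU).symm
  exact PinchedHomotopic.hcomp ub (.refl i0)
    (rPath_pinchedHomotopic_rayPath (hγ.shift T) (by simp) htail).symm

end

/-! ### Lifting: from a polygon downstairs to a crossing count upstairs. -/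

noncomputable section

/-! ### Pushing homotopies off `∞` -/

/-- The inversion `z ↦ 1 / (z - r)` of the sphere. -/
def sphereInv (r : ℝ) (z : OnePoint ℂ) : ℂ := z.elim 0 fun z => (z - r)⁻¹

theorem continuousOn_sphereInv (r : ℝ) : ContinuousOn (sphereInv r) {((r : ℂ) : OnePoint ℂ)}ᶜ := by
  intro z hz
  refine ContinuousAt.continuousWithinAt ?_
  induction z using OnePoint.rec with
  | infty =>
    rw [OnePoint.continuousAt_infty', coclosedCompact_eq_cocompact, ← Metric.cobounded_eq_cocompact]
    exact tendsto_inv₀_cobounded.comp (tendsto_sub_const_cobounded _)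
  | coe z =>
    rw [OnePoint.continuousAt_coe]
    have : z - r ≠ 0 := sub_ne_zero.2 fun e => hz (by rw [e]; rfl)
    exact ContinuousAt.inv₀ (by fun_prop) this

/-- A homotopy in `H_r` between curves in the plane can be pushed off `∞`. -/
theorem exists_plane_homotopy {V : Finset ℂ} {r : ℝ} {x y : ℂ} {p q : Path x y}
    (hV : ∀ v ∈ V, r < v.re) (hx : r < x.re) (hy : r < y.re) (hyV : y ∉ V)
    (h : PinchedHomotopic (puncturedHalfPlane V r) (spherePath p) (spherePath q)) :
    ∃ F : I × I → ℂ, Continuous F ∧ (∀ t, F (0, t) = p t) ∧ (∀ t, F (1, t) = q t) ∧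
      (∀ u, F (u, 0) = x) ∧ (∀ u, F (u, 1) = y) ∧ ∀ u t, t ≠ 0 → F (u, t) ∉ V := by
  obtain ⟨G, hG⟩ := h
  have hGmem : ∀ u t, G (u, t) = x ∨ G (u, t) ∈ puncturedHalfPlane V r := fun u t => by
    by_cases h0 : t = 0
    · left; subst h0; simp
    by_cases h1 : t = 1
    · right; subst h1
      rw [Path.Homotopy.target]
      exact coe_mem_puncturedHalfPlane.2 ⟨hy, hyV⟩
    · exact .inr (hG u t h0 h1)
  have hGmem' : ∀ u t, t ≠ 0 → G (u, t) ∈ puncturedHalfPlane V r := fun u t h0 => by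
    by_cases h1 : t = 1
    · subst h1
      rw [Path.Homotopy.target]
      exact coe_mem_puncturedHalfPlane.2 ⟨hy, hyV⟩
    · exact hG u t h0 h1
  have hGre : ∀ s, ∀ z : ℂ, G s = z → r < z.re := fun s z hz => by
    rcases hGmem s.1 s.2 with h | h
    · rw [h, OnePoint.coe_eq_coe] at hz
      rwa [← hz]
    · rw [hz] at h
      exact (coe_mem_puncturedHalfPlane.1 h).1
  have hcomp : IsCompact (range p ∪ range q ∪ (V : Set ℂ)) :=
    ((isCompact_range p.continuous).union (isCompact_range q.continuous)).union
      V.finite_toSet.isCompact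
  obtain ⟨B, hB⟩ := hcomp.isBounded.subset_closedBall (r : ℂ)
  set ε : ℝ := (|B| + 1)⁻¹ with hε
  have hε0 : 0 < ε := by positivity
  have hlarge : ∀ z ∈ range p ∪ range q ∪ (V : Set ℂ), r < z.re → ε < ‖(z - r)⁻¹‖ := fun z hz hr => by
    have h1 := hB hz
    rw [mem_closedBall_iff_norm] at h1
    have h2 : 0 < ‖z - r‖ := norm_pos_iff.2 (sub_ne_zero.2 fun e => by simp [e] at hr)
    rw [norm_inv]
    exact inv_strictAnti₀ h2 (h1.trans_lt (by linarith [le_abs_self B]))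
  -- In the coordinate `j = 1 / (z - r)` the point `∞` is 0 and the half-plane is `Re j > 0`. The
  -- map `k` pushes small `j` to the right, off 0, and fixes all `j` with `‖j‖ ≥ ε`, hence `p`, `q`
  -- and `V`. Where `‖j‖ < ε` the image has norm at most `ε` and cannot reach `V`.
  let k : ℂ → ℂ := fun j => j + ((max 0 (ε - ‖j‖) : ℝ) : ℂ)
  have hk : Continuous k := by fun_prop
  let J : I × I → ℂ := fun s => sphereInv r (G s)
  have hJc : Continuous J := (continuousOn_sphereInv r).comp_continuous G.continuous fun s e => by
    have := hGre s r e
    simp at this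
  have hJre : ∀ s, J s = 0 ∨ 0 < (J s).re := fun s => by
    rcases hs : G s with _ | z
    · left
      change sphereInv r (G s) = 0
      rw [hs]; rfl
    · right
      have hz := hGre s z hs
      change 0 < (sphereInv r (G s)).re
      rw [hs]
      change 0 < ((z - r)⁻¹).re
      rw [Complex.inv_re]
      have h2 : 0 < Complex.normSq (z - r) :=
        Complex.normSq_pos.2 (sub_ne_zero.2 fun e => by simp [e] at hz)
      exact div_pos (by simpa using hz) h2
  have hkJ : ∀ s, k (J s) ≠ 0 := fun s e => by
    have e' := congrArg Complex.re e
    simp only [k, Complex.add_re, Complex.ofReal_re, Complex.zero_re] at e'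
    rcases hJre s with h | h
    · rw [h] at e'
      simp [max_eq_right hε0.le] at e'
      exact hε0.ne' e'
    · linarith [le_max_left 0 (ε - ‖J s‖)]
  let F : I × I → ℂ := fun s => r + (k (J s))⁻¹
  have hFc : Continuous F := continuous_const.add ((hk.comp hJc).inv₀ hkJ)
  have hFid : ∀ s, ∀ z : ℂ, G s = z → ε ≤ ‖(z - r)⁻¹‖ → F s = z := fun s z hz hle => by
    have hJs : J s = (z - r)⁻¹ := by
      change sphereInv r (G s) = _
      rw [hz]; rfl
    simp only [F, k, hJs, max_eq_left (sub_nonpos.2 hle)]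
    simp
  refine ⟨F, hFc, fun t => ?_, fun t => ?_, fun u => ?_, fun u => ?_, fun u t ht hv => ?_⟩
  · have : G (0, t) = (p t : ℂ) := by simp
    exact hFid _ _ this (hlarge _ (.inl (.inl ⟨t, rfl⟩)) (hGre _ _ this)).le
  · have : G (1, t) = (q t : ℂ) := by simp
    exact hFid _ _ this (hlarge _ (.inl (.inr ⟨t, rfl⟩)) (hGre _ _ this)).le
  · have : G (u, 0) = (x : ℂ) := by simp
    exact hFid _ _ this (hlarge _ (.inl (.inl ⟨0, p.source⟩)) hx).le
  · have : G (u, 1) = (y : ℂ) := by simp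
    exact hFid _ _ this (hlarge _ (.inl (.inl ⟨1, p.target⟩)) hy).le
  · by_cases hle : ε ≤ ‖J (u, t)‖
    · rcases hs : G (u, t) with _ | z
      · have : J (u, t) = 0 := by
          change sphereInv r (G (u, t)) = 0
          rw [hs]; rfl
        rw [this, norm_zero] at hle
        linarith
      · have hJs : J (u, t) = (z - r)⁻¹ := by
          change sphereInv r (G (u, t)) = _
          rw [hs]; rfl
        rw [hFid _ z hs (by rwa [← hJs])] at hv
        have := hGmem' u t ht
        rw [hs] at this
        exact (coe_mem_puncturedHalfPlane.1 this).2 hv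
    · push Not at hle
      have h1 := hlarge _ (.inr hv) (hV _ hv)
      have h2 : (F (u, t) - r)⁻¹ = k (J (u, t)) := by simp [F]
      rw [h2] at h1
      have h3 : ‖k (J (u, t))‖ ≤ ‖J (u, t)‖ + (ε - ‖J (u, t)‖) := by
        simp only [k]
        rw [max_eq_right (sub_nonneg.2 hle.le)]
        refine (norm_add_le _ _).trans (add_le_add le_rfl ?_)
        rw [Complex.norm_real, Real.norm_eq_abs, abs_of_nonneg (sub_nonneg.2 hle.le)]
      linarith

/-! ### Lifting pinched homotopies -/

/-- A homotopy that leaves a branch value only immediately after its start can be lifted if the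
starting point is isolated in its fibre. -/
theorem exists_lift_homotopy {V : Set ℂ} {g : ℂ → ℂ} (hg : Continuous g)
    (hcov : IsCoveringMapOn g Vᶜ) {F : I × I → ℂ} (hF : Continuous F) {x' y' : ℂ} (p' : Path x' y')
    (hiso : ∀ᶠ z in 𝓝[≠] x', g z ≠ g x') (h0 : ∀ t, F (0, t) = g (p' t))
    (hx : ∀ u, F (u, 0) = g x') (hy : ∀ u, F (u, 1) = g y')
    (hV : ∀ u t, t ≠ 0 → F (u, t) ∉ V) :
    ∃ F' : I × I → ℂ, Continuous F' ∧ (∀ s, g (F' s) = F s) ∧ (∀ t, F' (0, t) = p' t) ∧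
      (∀ u, F' (u, 0) = x') ∧ ∀ u, F' (u, 1) = y' := by
  have hE0 : expToUnit 0 = 1 := Subtype.ext (by simp [expToUnit])
  have hproj : Continuous (projIcc (0 : ℝ) 1 zero_le_one) := continuous_projIcc
  have hEc := continuous_expToUnit
  have huniq : ∀ f : C(ℝ, ℂ), (∀ a, f a ∈ Vᶜ) → ∀ A B : C(ℝ, ℂ), A 0 = B 0 → g ∘ A = f →
      g ∘ B = f → A = B := fun f hf A B hAB hA hB => by
    obtain ⟨G, -, hG⟩ := hcov.existsUnique_continuousMap_lifts f (a₀ := 0) (e₀ := B 0)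
      (congrFun hB 0) hf
    rw [hG A ⟨hAB, hA⟩, hG B ⟨rfl, hB⟩]
  -- For `t ≠ 0` the homotopy avoids `V`. With `log t` as coordinate it extends to the simply
  -- connected `ℝ × ℝ`. The lift is anchored at the end `y'`, because the start may lie over a
  -- branch value.
  let f : C(ℝ × ℝ, ℂ) := ⟨fun s => F (projIcc 0 1 zero_le_one s.1, expToUnit s.2), by fun_prop⟩
  have hfV : ∀ a, f a ∈ Vᶜ := fun a => hV _ _ (expToUnit_ne_zero _)
  obtain ⟨G, ⟨hG0, hG⟩, -⟩ := hcov.existsUnique_continuousMap_lifts f (a₀ := (0, 0)) (e₀ := y')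
    (by simp [f, hE0, hy]) hfV
  have hG' : ∀ a b, g (G (a, b)) = F (projIcc 0 1 zero_le_one a, expToUnit b) := fun a b =>
    congrFun hG (a, b)
  -- By uniqueness of lifts, the lift is the given `p'` over `u = 0`, and it stays at `y'` over `t =
  -- 1`.
  have hleft : ∀ b, G (0, b) = p' (expToUnit b) := by
    let A : C(ℝ, ℂ) := ⟨fun b => G (0, b), by fun_prop⟩
    let B : C(ℝ, ℂ) := ⟨fun b => p' (expToUnit b), by fun_prop⟩
    have : A = B := huniq ⟨fun b => f (0, b), by fun_prop⟩ (fun a => hfV _) A B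
      (by simp [A, B, hG0, hE0]) (funext fun b => hG' 0 b)
      (funext fun b => by simp [B, f, ← h0])
    exact fun b => DFunLike.congr_fun this b
  have htop : ∀ a, G (a, 0) = y' := by
    let A : C(ℝ, ℂ) := ⟨fun a => G (a, 0), by fun_prop⟩
    have : A = .const ℝ y' := huniq ⟨fun a => f (a, 0), by fun_prop⟩ (fun a => hfV _) A _
      (by simp [A, hG0]) (funext fun b => hG' b 0)
      (funext fun b => by simp [f, hE0, hy])
    exact fun b => DFunLike.congr_fun this b
  let F' : I × I → ℂ := fun s => if s.2 = 0 then x' else G ((s.1 : ℝ), Real.log s.2)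
  have hF'0 : ∀ u, F' (u, 0) = x' := fun u => by simp [F']
  have hF'1 : ∀ u t, t ≠ 0 → F' (u, t) = G ((u : ℝ), Real.log t) := fun u t ht => by simp [F', ht]
  have hlift : ∀ s, g (F' s) = F s := by
    rintro ⟨u, t⟩
    by_cases ht : t = 0
    · subst ht; rw [hF'0, hx]
    · rw [hF'1 u t ht, hG', expToUnit_log ht, projIcc_val]
  have hbase : ∀ t, F' (0, t) = p' t := fun t => by
    by_cases ht : t = 0
    · subst ht; rw [hF'0]; simp
    · rw [hF'1 0 t ht]
      simp only [Icc.coe_zero]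
      rw [hleft, expToUnit_log ht]
  refine ⟨F', ?_, hlift, hbase, hF'0, fun u => ?_⟩
  · refine continuous_of_pinched hF'0 (fun u t ht => ?_) fun ε hε => ?_
    · have hev : (fun s : I × I => G ((s.1 : ℝ), Real.log s.2)) =ᶠ[𝓝 (u, t)] F' := by
        have : {s : I × I | s.2 ≠ 0} ∈ 𝓝 (u, t) :=
          (isOpen_ne.preimage continuous_snd).mem_nhds ht
        filter_upwards [this] with s hs
        exact (hF'1 s.1 s.2 hs).symm
      refine ContinuousAt.congr ?_ hev
      have hlog : ContinuousAt (fun s : I × I => ((s.1 : ℝ), Real.log s.2)) (u, t) :=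
        ContinuousAt.prodMk (by fun_prop) (ContinuousAt.log (by fun_prop) (unit_pos ht).ne')
      exact ContinuousAt.comp (g := G) G.continuous.continuousAt hlog
    -- Continuity as `t → 0`: on the circle of radius `η` around `x'` the values of `g` keep a
    -- distance `m` from `g x'`, while for small `t` the values of `F` are closer than `m`,
    -- uniformly in `u`. The lift is inside the circle for `u = 0` and cannot cross it as `u`
    -- varies.
    · obtain ⟨R, hR, hball⟩ : ∃ R > 0, ∀ z, z ≠ x' → ‖z - x'‖ < R → g z ≠ g x' := by
        rw [eventually_nhdsWithin_iff, Metric.eventually_nhds_iff] at hiso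
        obtain ⟨R, hR, h⟩ := hiso
        exact ⟨R, hR, fun z hz hd => h (by rwa [dist_eq_norm]) hz⟩
      set η := min ε (R / 2) with hη
      have hη0 : 0 < η := by positivity
      have hηR : η < R := (min_le_right _ _).trans_lt (by linarith)
      obtain ⟨m, hm0, hm⟩ : ∃ m > 0, ∀ z, ‖z - x'‖ = η → m ≤ ‖g z - g x'‖ := by
        have hc : IsCompact (Metric.sphere x' η) := isCompact_sphere _ _
        have hne : (Metric.sphere x' η).Nonempty := NormedSpace.sphere_nonempty.2 hη0.le
        obtain ⟨z₀, hz₀, hmin⟩ := hc.exists_isMinOn hne (f := fun z => ‖g z - g x'‖)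
          (by fun_prop)
        rw [mem_sphere_iff_norm] at hz₀
        refine ⟨‖g z₀ - g x'‖, norm_pos_iff.2 (sub_ne_zero.2 (hball z₀ ?_ ?_)), fun z hz => ?_⟩
        · rintro rfl; simp at hz₀; linarith
        · rw [hz₀]; exact hηR
        · exact hmin (mem_sphere_iff_norm.2 hz)
      have e1 : ∀ᶠ t : I in 𝓝 0, ∀ u ∈ (univ : Set I), ‖F (u, t) - g x'‖ < m := by
        refine isCompact_univ.eventually_forall_of_forall_eventually fun u _ => ?_
        have hc : ContinuousAt (fun z : I × I => ‖F (z.2, z.1) - g x'‖) (0, u) := by fun_prop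
        refine hc.eventually (gt_mem_nhds ?_)
        simpa [hx] using hm0
      have e2 : ∀ᶠ t : I in 𝓝 0, ‖p' t - x'‖ < η := by
        have hc : ContinuousAt (fun t : I => ‖p' t - x'‖) 0 := by fun_prop
        refine hc.eventually (gt_mem_nhds ?_)
        simpa using hη0
      filter_upwards [e1, e2] with t h1 h2 u
      by_cases ht : t = 0
      · subst ht; rw [hF'0]; simpa using hε
      refine lt_of_lt_of_le ?_ (min_le_left ε (R / 2))
      have hcu : Continuous fun a : ℝ => ‖G (a, Real.log t) - x'‖ := by fun_prop
      by_contra hcon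
      push Not at hcon
      rw [hF'1 u t ht] at hcon
      have hstart : ‖G (0, Real.log t) - x'‖ ≤ η := by
        rw [hleft, expToUnit_log ht]; exact h2.le
      obtain ⟨a, -, ha⟩ := intermediate_value_Icc u.2.1 hcu.continuousOn ⟨hstart, hcon⟩
      have h3 := hm _ ha
      rw [hG', expToUnit_log ht] at h3
      linarith [h1 (projIcc 0 1 zero_le_one a) (mem_univ _)]
  · rw [hF'1 u 1 one_ne_zero]
    simp [htop]

end

noncomputable section

/-! ### Words of lifted curves -/

theorem encard_slits_le {V : Finset ℂ} {δ : ℝ} {k : I → ℂ} {D : ℕ}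
    (h : ∀ w ∈ V, {t | k t ∈ slits {w} δ}.encard ≤ D) :
    {t | k t ∈ slits V δ}.encard ≤ (V.card * D : ℕ) := by
  induction V using Finset.induction with
  | empty => simp [slits]
  | insert w V hw ih =>
    have hsub : {t | k t ∈ slits (insert w V) δ} ⊆
        {t | k t ∈ slits {w} δ} ∪ {t | k t ∈ slits V δ} := by
      rintro t ⟨v, hv, h1⟩
      rcases Finset.mem_insert.1 hv with rfl | hv
      · exact .inl ⟨v, by simp, h1⟩
      · exact .inr ⟨v, hv, h1⟩
    refine (encard_le_encard hsub).trans ((encard_union_le _ _).trans ?_)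
    rw [Finset.card_insert_of_notMem hw, add_mul, one_mul, add_comm, Nat.cast_add]
    exact add_le_add (ih fun v hv => h v (Finset.mem_insert_of_mem hv))
      (h w (Finset.mem_insert_self _ _))

theorem trans_firstHalf {x y z : ℂ} (p : Path x y) (q : Path y z) (t : I) :
    p.trans q (firstHalf t) = p t := by
  have h : ((firstHalf t : I) : ℝ) = t / 2 := rfl
  rw [Path.trans_apply]
  split_ifs with h'
  · congr 1
    exact Subtype.ext (show 2 * ((firstHalf t : I) : ℝ) = t by rw [h]; ring)
  · exact absurd (show ((firstHalf t : I) : ℝ) ≤ 1 / 2 by rw [h]; linarith [t.2.2]) h'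

theorem trans_secondHalf {x y z : ℂ} (p : Path x y) (q : Path y z) (t : I) :
    p.trans q (secondHalf t) = q t := by
  have h : ((secondHalf t : I) : ℝ) = (t + 1) / 2 := rfl
  rw [Path.trans_apply]
  split_ifs with h'
  · have ht : t = 0 := Subtype.ext (le_antisymm (show (t : ℝ) ≤ 0 by rw [h] at h'; linarith) t.2.1)
    subst ht
    rw [q.source]
    convert p.target using 2
    exact Subtype.ext (show 2 * ((secondHalf 0 : I) : ℝ) = 1 by rw [h]; simp)
  · congr 1
    exact Subtype.ext (show 2 * ((secondHalf t : I) : ℝ) - 1 = t by rw [h]; ring)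

/-- Restricting `k` to half of the parameter interval gives a lift of the corresponding subpath; the
counts for the single segments add up. -/
theorem IsPolygonal.encard_lift_le {g : ℂ → ℂ} {S : Set ℂ} {N : ℕ} {L : List (ℂ × ℂ)} {x y : ℂ}
    {q : Path x y} (hq : IsPolygonal L q)
    (hS : ∀ s ∈ L, ∀ k : I → ℂ, Continuous k → (∀ t : I, g (k t) = s.1 + (t : ℝ) * (s.2 - s.1)) →
      {t | k t ∈ S}.encard ≤ N)
    {k : I → ℂ} (hk : Continuous k) (hlift : ∀ t, g (k t) = q t) :
    {t | k t ∈ S}.encard ≤ (L.length * N : ℕ) := by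
  induction hq generalizing k with
  | line x y => simpa using hS (x, y) (by simp) k hk hlift
  | @trans l l' x y z p q _ _ ih ih' =>
    have hc1 : Continuous firstHalf := by unfold firstHalf; fun_prop
    have hc2 : Continuous secondHalf := by unfold secondHalf; fun_prop
    have h1 := ih (fun s hs => hS s (List.mem_append_left _ hs)) (k := k ∘ firstHalf)
      (hk.comp hc1) fun t => by rw [Function.comp_apply, hlift, trans_firstHalf]
    have h2 := ih' (fun s hs => hS s (List.mem_append_right _ hs)) (k := k ∘ secondHalf)
      (hk.comp hc2) fun t => by rw [Function.comp_apply, hlift, trans_secondHalf]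
    have hsub : {t | k t ∈ S} ⊆
        firstHalf '' {t | (k ∘ firstHalf) t ∈ S} ∪ secondHalf '' {t | (k ∘ secondHalf) t ∈ S} := by
      intro t ht
      by_cases h : (t : ℝ) ≤ 1 / 2
      · refine .inl ⟨⟨2 * t, by linarith [t.2.1], by linarith⟩, ?_, ?_⟩
        · have : firstHalf ⟨2 * t, by linarith [t.2.1], by linarith⟩ = t :=
            Subtype.ext (show 2 * (t : ℝ) / 2 = t by ring)
          change k (firstHalf _) ∈ S
          rwa [this]
        · exact Subtype.ext (show 2 * (t : ℝ) / 2 = t by ring)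
      · refine .inr ⟨⟨2 * t - 1, by linarith, by linarith [t.2.2]⟩, ?_, ?_⟩
        · have : secondHalf ⟨2 * t - 1, by linarith, by linarith [t.2.2]⟩ = t :=
            Subtype.ext (show (2 * (t : ℝ) - 1 + 1) / 2 = t by ring)
          change k (secondHalf _) ∈ S
          rwa [this]
        · exact Subtype.ext (show (2 * (t : ℝ) - 1 + 1) / 2 = t by ring)
    refine (encard_le_encard hsub).trans ((encard_union_le _ _).trans ?_)
    rw [List.length_append, add_mul, Nat.cast_add]
    exact add_le_add ((encard_image_le _ _).trans h1) ((encard_image_le _ _).trans h2)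

/-- The lifts by `g` of a segment cross the generic slits from the points of `V'` at most `D`
times. -/
def HasLiftCrossingBound (g : ℂ → ℂ) (V' : Finset ℂ) (D : ℕ) : Prop :=
  ∀ A B : ℂ, A ≠ B → ∃ bad : Set ℝ, bad.Finite ∧ ∀ δ ∉ bad, 0 < δ → ∀ w ∈ V', ∀ k : I → ℂ,
    Continuous k → (∀ t : I, g (k t) = A + (t : ℝ) * (B - A)) →
      {t | k t ∈ slits {w} δ}.encard ≤ D

/-- The basic estimate for the words of lifted curves. -/
theorem homotopyWordLength_lift_le {V V' : Finset ℂ} {γ γ' : ℝ≥0 → ℂ} {g : ℂ → ℂ} {D : ℕ}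
    (hg : Continuous g) (hcov : IsCoveringMapOn g (V : Set ℂ)ᶜ) (hγ : IsRCurveFrom V γ)
    (hγ' : IsRCurve γ') (h0 : γ' 0 ∈ V') (hlift : ∀ t, g (γ' t) = γ t) (hV' : MapsTo g V' V)
    (hiso : ∀ᶠ z in 𝓝[≠] (γ' 0), g z ≠ g (γ' 0)) (hD : HasLiftCrossingBound g V' D) :
    homotopyWordLength V' γ' ≤ (5 * homotopyWordLength V γ + 2) * (V'.card * D) := by
  obtain ⟨W, hW, hWn⟩ := exists_isHomotopyWord_norm_eq hγ
  obtain ⟨hγr, hγ0, hγV⟩ := hγ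
  obtain ⟨r, T₀, hrV, hrγ, hpoly⟩ := hW.exists_polygonal hγr hγV
  -- From this time on `γ'` is to the right of `V'` and contributes no crossings.
  obtain ⟨T₁, hT₁, htail⟩ := hγ'.exists_tail V' 0
  set T := T₀ + T₁ with hT
  have hT0 : 0 < T := lt_of_lt_of_le hT₁ le_add_self
  obtain ⟨L, q, hLq, hlen, hL, hhom⟩ := hpoly T le_self_add hT0
  obtain ⟨F, hFc, hF0, hF1, hFs, hFt, hFV⟩ := exists_plane_homotopy hrV (hrγ 0) (hrγ T)
    (hγV T hT0) hhom
  set p' : Path (γ' 0) (γ' T) := rInitial hγ' T rfl rfl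
  obtain ⟨F', hF'c, hF'l, hF'0, hF's, hF't⟩ := exists_lift_homotopy hg hcov hFc p' hiso
    (fun t => by rw [hF0]; simp [p', rInitial_apply, hlift]) (fun u => by rw [hFs, hlift])
    (fun u => by rw [hFt, hlift]) hFV
  have hγ'V : ∀ t, 0 < t → γ' t ∉ V' := fun t ht h => hγV t ht (by
    have := hV' h; rwa [hlift] at this)
  -- The polygon is fixed before the slope of the slits upstairs is chosen, so the slope can avoid
  -- the bad values of all its finitely many segments.
  have hbad : ∃ bad : Set ℝ, bad.Finite ∧ ∀ δ ∉ bad, 0 < δ → ∀ s ∈ L, ∀ w ∈ V', ∀ k : I → ℂ,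
      Continuous k → (∀ t : I, g (k t) = s.1 + (t : ℝ) * (s.2 - s.1)) →
        {t | k t ∈ slits {w} δ}.encard ≤ D := by
    have : ∀ s : ℂ × ℂ, ∃ bad : Set ℝ, bad.Finite ∧ (s ∈ L → ∀ δ ∉ bad, 0 < δ → ∀ w ∈ V',
        ∀ k : I → ℂ, Continuous k → (∀ t : I, g (k t) = s.1 + (t : ℝ) * (s.2 - s.1)) →
          {t | k t ∈ slits {w} δ}.encard ≤ D) := fun s => by
      by_cases hs : s ∈ L
      · obtain ⟨bad, h1, h2⟩ := hD s.1 s.2 (hL s hs)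
        exact ⟨bad, h1, fun _ => h2⟩
      · exact ⟨∅, finite_empty, fun h => absurd h hs⟩
    choose bad h1 h2 using this
    refine ⟨⋃ s ∈ {s | s ∈ L}, bad s, (List.finite_toSet L).biUnion fun s _ => h1 s,
      fun δ hδ hδ0 s hs => h2 s hs δ (fun h => hδ (mem_biUnion hs h)) hδ0⟩
  obtain ⟨bad, hbadfin, hbad⟩ := hbad
  obtain ⟨δ, hδ, ρ₀, hρ₀, hadm⟩ := exists_isAdmissible V' hbadfin
  have hA := hadm ρ₀ hρ₀ le_rfl
  obtain ⟨r₁, hr₁⟩ := hγ'.exists_lt_re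
  obtain ⟨r₂, hr₂⟩ := ((isCompact_range hF'c).image Complex.continuous_re).bddBelow
  -- The half-plane upstairs has to contain `γ'`, the disks around `V'` and the image of `F'`. The
  -- latter is compact because the homotopy was moved off `∞` before lifting.
  obtain ⟨r', hr'le, hr'V⟩ := exists_lt_forall_finset V' (fun v => v.re - ρ₀) (min r₁ (r₂ - 1))
  have hr'1 : r' ≤ r₁ := hr'le.trans (min_le_left _ _)
  have hr'2 : r' ≤ r₂ - 1 := hr'le.trans (min_le_right _ _)
  have hF'r : ∀ s, r' < (F' s).re := fun s => by
    have := hr₂ ⟨F' s, ⟨s, rfl⟩, rfl⟩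
    linarith
  have hF'V : ∀ u t, t ≠ 0 → F' (u, t) ∉ V' := fun u t ht h => hFV u t ht (by
    have := hV' h; rwa [hF'l] at this)
  let q' : Path (γ' 0) (γ' T) := ⟨⟨fun t => F' (1, t), by fun_prop⟩, hF's 1, hF't 1⟩
  have hq' : ∀ t, t ≠ 0 → r' < (q' t).re ∧ q' t ∉ V' := fun t ht => ⟨hF'r _, hF'V 1 t ht⟩
  have hhom' : PinchedHomotopic (puncturedHalfPlane V' r') (spherePath p') (spherePath q') := by
    refine pinchedHomotopic_of_map (fun s => (F' s : OnePoint ℂ))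
      (OnePoint.continuous_coe.comp hF'c) (fun t => ?_) (fun t => rfl) (fun u => ?_) (fun u => ?_)
      fun u t ht _ => coe_mem_puncturedHalfPlane.2 ⟨hF'r _, hF'V u t ht⟩
    · rw [hF'0]; rfl
    · rw [hF's]
    · rw [hF't]
  have hcount : (crossingTimes (slits V' δ) q').encard ≤
      (L.length * (V'.card * D) : ℕ) := by
    refine (encard_le_encard fun t ht => ht.2).trans
      (hLq.encard_lift_le (g := g) (k := q') (fun s hs k hk hkl => encard_slits_le fun w hw =>
        hbad δ hδ hA.pos s hs w hw k hk hkl) q'.continuous fun t => ?_)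
    change g (F' (1, t)) = q t
    rw [hF'l, hF1]
  obtain ⟨hfin, hcard⟩ := encard_le_coe_iff_finite_ncard_le.1 hcount
  obtain ⟨W', hW', hW'n⟩ := exists_isHomotopyWord_of_crossings hA hr'V hγ'
    (fun t => hr'1.trans_lt (hr₁ t)) h0 rfl hT0 rfl hγ'V
    (fun t => notMem_slits_of_re fun w hw => by
      have := (htail (T₀ + t)).2 w hw
      rwa [show T₁ + (T₀ + t) = T + t by rw [hT]; ring] at this) q' hq' hhom' hfin hcard
  refine (homotopyWordLength_le hW').trans (hW'n.trans ?_)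
  rw [hlen, hWn]

end

/-! ### Crossing counts for polynomials, exponentials and their composites. -/

noncomputable section

/-! ### Lifts of segments by polynomials -/

theorem eq_add_ray_of_mem_slits {δ : ℝ} {w z : ℂ} (h : z ∈ slits {w} δ) :
    z = w + ((z.re - w.re : ℝ) : ℂ) * rayDir δ := by
  obtain ⟨v, hv, h1, -⟩ := h
  rw [Finset.mem_singleton] at hv
  subst hv
  rw [slantHeight_apply, slantHeight_apply] at h1
  refine Complex.ext ?_ ?_
  · rw [add_ray_re]; ring
  · simp; linarith

/-- The points `z` of the line through `A` and `B` satisfy `Re (λ z) = Re (λ A)`. -/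
theorem re_mul_eq_of_mem_line (A B : ℂ) (t : ℝ) :
    (Complex.I * (starRingEnd ℂ) (B - A) * (A + t * (B - A))).re =
      (Complex.I * (starRingEnd ℂ) (B - A) * A).re := by
  simp; ring

theorem eval_map_conj_ofReal (P : Polynomial ℂ) (s : ℝ) :
    (P.map (starRingEnd ℂ)).eval (s : ℂ) = (starRingEnd ℂ) (P.eval (s : ℂ)) := by
  rw [Polynomial.eval_map]
  conv_lhs => rw [← Complex.conj_ofReal s]
  exact Polynomial.eval₂_at_apply _ _

/-- Twice this real part is the value at `δ` of a polynomial, which is nonzero: at the point `i` its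
first summand vanishes and the second one is the conjugate of `c` times `2 ^ d`. -/
theorem finite_re_mul_rayDir_pow_eq_zero {c : ℂ} (hc : c ≠ 0) {d : ℕ} (hd : d ≠ 0) :
    {δ : ℝ | (c * rayDir δ ^ d).re = 0}.Finite := by
  let N : Polynomial ℂ := Polynomial.C c * (1 + Polynomial.C Complex.I * Polynomial.X) ^ d +
    Polynomial.C ((starRingEnd ℂ) c) * (1 - Polynomial.C Complex.I * Polynomial.X) ^ d
  have hN : N ≠ 0 := fun h => by
    have := congrArg (Polynomial.eval Complex.I) h
    simp only [N, Polynomial.eval_add, Polynomial.eval_mul, Polynomial.eval_C, Polynomial.eval_pow,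
      Polynomial.eval_one, Polynomial.eval_X, Polynomial.eval_sub, Complex.I_mul_I,
      Polynomial.eval_zero, add_neg_cancel, zero_pow hd, mul_zero, zero_add, sub_neg_eq_add,
      mul_eq_zero, map_eq_zero, hc, false_or] at this
    exact absurd this (pow_ne_zero d (by norm_num))
  refine Set.Finite.of_finite_image (f := fun δ : ℝ => (δ : ℂ))
    ((Polynomial.finite_setOfPred_isRoot hN).subset ?_) Complex.ofReal_injective.injOn
  rintro _ ⟨δ, hδ, rfl⟩
  have e : N.eval (δ : ℂ) = c * rayDir δ ^ d + (starRingEnd ℂ) (c * rayDir δ ^ d) := by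
    simp [N, rayDir, mul_comm Complex.I, sub_eq_add_neg]
  change N.eval (δ : ℂ) = 0
  rw [e, Complex.add_conj]
  have h2 : (c * rayDir δ ^ d).re = 0 := hδ
  rw [h2]; simp

/-- A lift of the segment lies where `Re (c p) = Re (c A)`. On the slit line, parametrized by `w + s
(1 + δ i)`, this is a real polynomial equation in `s` whose leading coefficient is, up to a factor
2, `Re (c (1 + δ i) ^ d)`, nonzero for generic `δ`. So there are at most `d` crossing points, and
each is passed only once because `A ≠ B`. -/
theorem hasLiftCrossingBound_polynomial {p : Polynomial ℂ} (hp : p.natDegree ≠ 0) (hm : p.Monic)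
    (V' : Finset ℂ) : HasLiftCrossingBound (fun z => p.eval z) V' p.natDegree := by
  intro A B hAB
  set c : ℂ := Complex.I * (starRingEnd ℂ) (B - A) with hc
  have hc0 : c ≠ 0 := mul_ne_zero Complex.I_ne_zero
    ((map_ne_zero _).2 (sub_ne_zero.2 hAB.symm))
  refine ⟨_, finite_re_mul_rayDir_pow_eq_zero hc0 hp, fun δ hδ _ w _ k _ hk => ?_⟩
  have hk : ∀ t : I, p.eval (k t) = A + (t : ℝ) * (B - A) := hk
  have he : rayDir δ ≠ 0 := fun h => by
    have := congrArg Complex.re h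
    simp at this
  set l : Polynomial ℂ := Polynomial.C (rayDir δ) * Polynomial.X + Polynomial.C w with hl
  have hl1 : l.natDegree = 1 := Polynomial.natDegree_linear he
  set P := p.comp l with hP
  have hPd : P.natDegree = p.natDegree := by rw [hP, Polynomial.natDegree_comp, hl1, mul_one]
  have hPl : P.coeff p.natDegree = rayDir δ ^ p.natDegree := by
    rw [← hPd, Polynomial.coeff_natDegree, hP, Polynomial.leadingCoeff_comp (by rw [hl1]; simp),
      hm.leadingCoeff, Polynomial.leadingCoeff_linear he, one_mul, ← hP, hPd]
  -- Adding the polynomial with conjugated coefficients gives twice the real part at real points.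
  set Q : Polynomial ℂ := Polynomial.C c * P +
    Polynomial.C ((starRingEnd ℂ) c) * P.map (starRingEnd ℂ) -
      Polynomial.C ((2 * (c * A).re : ℝ) : ℂ) with hQ
  have hQd : Q.natDegree ≤ p.natDegree := by
    refine (Polynomial.natDegree_sub_le _ _).trans (max_le ?_ (by rw [Polynomial.natDegree_C]; exact Nat.zero_le _))
    refine (Polynomial.natDegree_add_le _ _).trans (max_le ?_ ?_)
    · exact (Polynomial.natDegree_C_mul_le _ _).trans hPd.le
    · exact (Polynomial.natDegree_C_mul_le _ _).trans
        (Polynomial.natDegree_map_le.trans hPd.le)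
  have hQ0 : Q ≠ 0 := fun h => by
    have := congrArg (fun R => Polynomial.coeff R p.natDegree) h
    simp only [hQ, Polynomial.coeff_sub, Polynomial.coeff_add, Polynomial.coeff_C_mul,
      Polynomial.coeff_map, hPl, Polynomial.coeff_zero, Polynomial.coeff_C_of_ne_zero hp,
      ← map_mul, sub_zero, Complex.add_conj] at this
    norm_cast at this
    refine hδ (?_ : (c * rayDir δ ^ p.natDegree).re = 0)
    linarith
  have hQe : ∀ s : ℝ, Q.eval (s : ℂ) = ((2 * ((c * p.eval (w + s * rayDir δ)).re - (c * A).re) : ℝ) : ℂ) := by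
    intro s
    have e1 : P.eval (s : ℂ) = p.eval (w + s * rayDir δ) := by
      simp only [hP, hl, Polynomial.eval_comp, Polynomial.eval_add, Polynomial.eval_mul,
        Polynomial.eval_C, Polynomial.eval_X, mul_comm (rayDir δ), add_comm _ w]
    simp only [hQ, Polynomial.eval_sub, Polynomial.eval_add, Polynomial.eval_mul,
      Polynomial.eval_C, eval_map_conj_ofReal, e1, ← map_mul, Complex.add_conj]
    push_cast; ring
  have hinj : InjOn (fun t : I => (((k t).re - w.re : ℝ) : ℂ)) {t | k t ∈ slits {w} δ} := by
    intro t ht t' ht' e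
    have e' : (k t).re - w.re = (k t').re - w.re := Complex.ofReal_injective e
    have hkk : k t = k t' := by
      rw [eq_add_ray_of_mem_slits ht, eq_add_ray_of_mem_slits ht', e']
    have h1 := hk t
    rw [hkk, hk t'] at h1
    have h2 := mul_right_cancel₀ (sub_ne_zero.2 hAB.symm) (add_left_cancel h1)
    exact Subtype.ext (by exact_mod_cast h2.symm)
  have hmaps : MapsTo (fun t : I => (((k t).re - w.re : ℝ) : ℂ)) {t | k t ∈ slits {w} δ}
      (Q.roots.toFinset : Set ℂ) := by
    intro t ht
    rw [Finset.mem_coe, Multiset.mem_toFinset, Polynomial.mem_roots hQ0]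
    change Q.eval _ = 0
    rw [hQe, ← eq_add_ray_of_mem_slits ht, hk t, hc, re_mul_eq_of_mem_line]
    simp
  refine (encard_le_encard_of_injOn hmaps hinj).trans ?_
  rw [encard_coe_eq_coe_finsetCard]
  exact_mod_cast (Multiset.toFinset_card_le _).trans ((Polynomial.card_roots' Q).trans hQd)

theorem eventually_eval_ne {p : Polynomial ℂ} (hp : p.natDegree ≠ 0) (x : ℂ) :
    ∀ᶠ z in 𝓝[≠] x, p.eval z ≠ p.eval x := by
  have hne : p - Polynomial.C (p.eval x) ≠ 0 := fun h => hp (by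
    rw [sub_eq_zero.1 h, Polynomial.natDegree_C])
  have hfin := (Polynomial.finite_setOfPred_isRoot hne).subset (sdiff_subset (t := {x}))
  have h1 : ∀ᶠ z in 𝓝 x, z ∉ {z | (p - Polynomial.C (p.eval x)).IsRoot z} \ {x} :=
    hfin.isClosed.isOpen_compl.mem_nhds (by simp)
  filter_upwards [nhdsWithin_le_nhds h1, self_mem_nhdsWithin] with z hz hzx e
  exact hz ⟨by simp [Polynomial.IsRoot, e], hzx⟩

theorem card_le_of_lift {V V' : Finset ℂ} {g : ℂ → ℂ} (h : MapsTo g V' V) (hinj : InjOn g V') :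
    V'.card ≤ V.card :=
  Finset.card_le_card_of_injOn g h hinj

theorem natDegree_ne_zero_of_lift {p : Polynomial ℂ} {γ γ' : ℝ≥0 → ℂ} (hγ : IsRCurve γ)
    (hlift : ∀ t, p.eval (γ' t) = γ t) : p.natDegree ≠ 0 := fun h => by
  rw [Polynomial.natDegree_eq_zero] at h
  obtain ⟨c, rfl⟩ := h
  obtain ⟨t, ht⟩ := (hγ.2.eventually (eventually_gt_atTop c.re)).exists
  rw [← hlift, Polynomial.eval_C] at ht
  exact lt_irrefl _ ht

/-- Words of lifts by polynomials. -/
theorem homotopyWordLength_polynomial_lt {p : Polynomial ℂ} (hm : p.Monic) {V : Finset ℂ}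
    (hcrit : criticalValues (fun z => p.eval z) ⊆ V) {γ : ℝ≥0 → ℂ} (hγ : IsRCurveFrom V γ)
    {V' : Finset ℂ} (hV' : MapsTo (fun z => p.eval z) V' V) (hinj : InjOn (fun z => p.eval z) V')
    {γ' : ℝ≥0 → ℂ} (hγ' : IsRCurve γ') (h0 : γ' 0 ∈ V') (hlift : ∀ t, p.eval (γ' t) = γ t) :
    homotopyWordLength V' γ' <
      6 * p.natDegree * V.card ^ 2 * (homotopyWordLength V γ + 1) := by
  have hd := natDegree_ne_zero_of_lift hγ.1 hlift
  have hcov : IsCoveringMapOn (fun z => p.eval z) (V : Set ℂ)ᶜ := by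
    refine p.isCoveringMapOn_eval.mono (compl_subset_compl.2 ?_)
    rintro _ ⟨z, hz, rfl⟩
    exact hcrit ⟨z, by simpa using hz, rfl⟩
  have hle := homotopyWordLength_lift_le p.continuous hcov hγ hγ' h0 hlift hV'
    (eventually_eval_ne hd _) (hasLiftCrossingBound_polynomial hd hm V')
  have hcard := card_le_of_lift hV' hinj
  have hn : 0 < V.card := Finset.card_pos.2 ⟨_, hγ.2.1⟩
  have hd' : 0 < p.natDegree := Nat.pos_of_ne_zero hd
  refine hle.trans_lt ?_
  set m := homotopyWordLength V γ
  -- The estimate uses `|V'| ≤ n ≤ n ^ 2` and `5 m + 2 < 6 m + 6`.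
  calc (5 * m + 2) * (V'.card * p.natDegree) ≤ (5 * m + 2) * (V.card ^ 2 * p.natDegree) := by
        gcongr
        exact hcard.trans (Nat.le_self_pow two_ne_zero _)
    _ < (6 * m + 6) * (V.card ^ 2 * p.natDegree) :=
        Nat.mul_lt_mul_of_pos_right (by omega) (by positivity)
    _ = _ := by ring

/-! ### Lifts of segments by exponential functions -/

theorem encard_le_two_of_lt {s : Set ℝ} (h : ∀ x ∈ s, ∀ y ∈ s, ∀ z ∈ s, x < y → ¬ y < z) :
    s.encard ≤ 2 := by
  by_contra hcon
  push Not at hcon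
  have h3 : (3 : ℕ∞) ≤ s.encard := Order.add_one_le_of_lt hcon
  obtain ⟨t, hts, ht⟩ := exists_subset_encard_eq h3
  obtain ⟨x, y, z, hxy, hxz, hyz, rfl⟩ := encard_eq_three.1 ht
  have hx := hts (by simp : x ∈ ({x, y, z} : Set ℝ))
  have hy := hts (by simp : y ∈ ({x, y, z} : Set ℝ))
  have hz := hts (by simp : z ∈ ({x, y, z} : Set ℝ))
  rcases lt_or_gt_of_ne hxy with h1 | h1 <;> rcases lt_or_gt_of_ne hyz with h2 | h2 <;>
    rcases lt_or_gt_of_ne hxz with h3 | h3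
  · exact h x hx y hy z hz h1 h2
  · exact h x hx y hy z hz h1 h2
  · exact h x hx z hz y hy h3 h2
  · exact h z hz x hx y hy h3 h1
  · exact h y hy x hx z hz h1 h3
  · exact h y hy z hz x hx h2 h3
  · exact h z hz y hy x hx h2 h1
  · exact h z hz y hy x hx h2 h1

/-- The function `s ↦ c K cos(δ s + θ) - c² e^{-(s + x)}` does not have three zeros on an interval
on which `c cos(δ s + θ)` is positive. -/
theorem not_three_zeros {c K δ θ x s₁ s₂ s₃ : ℝ} (hK : 0 < K) (hδ : 0 < δ) (h12 : s₁ < s₂)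
    (h23 : s₂ < s₃) (hpos : ∀ s ∈ Icc s₁ s₃, 0 < c * Real.cos (δ * s + θ))
    (hz : ∀ s, s = s₁ ∨ s = s₂ ∨ s = s₃ →
      c * K * Real.cos (δ * s + θ) - c ^ 2 * Real.exp (-(s + x)) = 0) : False := by
  set Ψ : ℝ → ℝ := fun s => c * K * Real.cos (δ * s + θ) - c ^ 2 * Real.exp (-(s + x)) with hΨ
  have hlin : ∀ s, HasDerivAt (fun s : ℝ => δ * s + θ) δ s := fun s => by
    simpa using ((hasDerivAt_id s).const_mul δ).add_const θ
  have hexp : ∀ s, HasDerivAt (fun s : ℝ => Real.exp (-(s + x))) (-Real.exp (-(s + x))) s :=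
    fun s => by simpa using (((hasDerivAt_id s).add_const x).neg).exp
  have d1 : deriv Ψ = fun s =>
      c * K * (-Real.sin (δ * s + θ) * δ) - c ^ 2 * (-Real.exp (-(s + x))) := by
    funext s
    exact (((hlin s).cos.const_mul (c * K)).sub ((hexp s).const_mul (c ^ 2))).deriv
  have d2 : ∀ s, deriv^[2] Ψ s =
      c * K * (-(Real.cos (δ * s + θ) * δ) * δ) - c ^ 2 * (-(-Real.exp (-(s + x)))) := fun s => by
    rw [Function.iterate_succ, Function.iterate_one, Function.comp_apply, d1]
    exact (((((hlin s).sin.neg).mul_const δ).const_mul (c * K)).sub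
      (((hexp s).neg).const_mul (c ^ 2))).deriv
  -- The second derivative is negative where `c cos(δ s + θ) > 0`, and a strictly concave function
  -- has no three zeros.
  have hconc : StrictConcaveOn ℝ (Icc s₁ s₃) Ψ := by
    refine strictConcaveOn_of_deriv2_neg' (convex_Icc _ _) (by fun_prop) fun s hs => ?_
    rw [d2]
    have h1 := hpos s hs
    have h2 : 0 ≤ c ^ 2 * Real.exp (-(s + x)) := by positivity
    have h3 : 0 < c * Real.cos (δ * s + θ) * (K * δ * δ) := by positivity
    nlinarith
  have h13 : s₁ < s₃ := h12.trans h23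
  have hden : 0 < s₃ - s₁ := by linarith
  have ha : 0 < (s₃ - s₂) / (s₃ - s₁) := div_pos (by linarith) hden
  have hb : 0 < (s₂ - s₁) / (s₃ - s₁) := div_pos (by linarith) hden
  have hab : (s₃ - s₂) / (s₃ - s₁) + (s₂ - s₁) / (s₃ - s₁) = 1 := by field_simp; ring
  have := hconc.2 (left_mem_Icc.2 h13.le) (right_mem_Icc.2 h13.le) h13.ne ha hb hab
  have e : ((s₃ - s₂) / (s₃ - s₁)) • s₁ + ((s₂ - s₁) / (s₃ - s₁)) • s₃ = s₂ := by
    simp only [smul_eq_mul]; field_simp; ring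
  rw [e] at this
  have z1 : Ψ s₁ = 0 := hz _ (by simp)
  have z2 : Ψ s₂ = 0 := hz _ (by simp)
  have z3 : Ψ s₃ = 0 := hz _ (by simp)
  rw [z1, z2, z3] at this
  simp at this

/-- A nonconstant continuous `y` would take all values in an interval, but zeros of the cosine are
isolated. -/
theorem eq_of_forall_cos_eq_zero {y : I → ℝ} (hy : Continuous y) (h : ∀ t, Real.cos (y t) = 0)
    (t t' : I) : y t = y t' := by
  by_contra hne
  wlog hlt : y t < y t' generalizing t t'
  · exact this t' t (Ne.symm hne) (lt_of_le_of_ne (not_lt.1 hlt) (Ne.symm hne))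
  set ε := min (y t' - y t) 1 with hε
  have hε0 : 0 < ε := lt_min (by linarith) one_pos
  obtain ⟨s, -, hs⟩ := isPreconnected_univ.intermediate_value (mem_univ t) (mem_univ t')
    hy.continuousOn (⟨by linarith, by linarith [min_le_left (y t' - y t) 1]⟩ :
      y t + ε ∈ Icc (y t) (y t'))
  have h1 := h s
  rw [hs, Real.cos_add, h t, zero_mul, zero_sub, neg_eq_zero, mul_eq_zero] at h1
  have h2 : 0 < Real.sin ε := Real.sin_pos_of_pos_of_lt_pi hε0
    (by linarith [min_le_right (y t' - y t) 1, Real.pi_gt_three])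
  rcases h1 with h1 | h1
  · have := Real.sin_sq_add_cos_sq (y t)
    rw [h1, h t] at this
    norm_num at this
  · exact h2.ne' h1

theorem re_mul_exp (c z : ℂ) :
    (c * Complex.exp z).re = ‖c‖ * Real.exp z.re * Real.cos (z.im + Complex.arg c) := by
  conv_lhs => rw [← Complex.norm_mul_exp_arg_mul_I c]
  rw [mul_assoc, ← Complex.exp_add, Complex.re_ofReal_mul, Complex.exp_re]
  simp [add_comm]; ring

/-- A lift `x + i y` of the segment satisfies `K e^x cos(y + θ) = c`. If `c = 0`, then `y` is
constant along the lift, and a line of positive slope meets it at most once. If `c ≠ 0`, then `cos(y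
+ θ)` has constant sign along the lift; on the slit line `y` is affine in `x`, and `not_three_zeros`
leaves at most two solutions. Every positive slope works, so no slope is bad. -/
theorem hasLiftCrossingBound_exp {a : ℂ} (ha : a ≠ 0) (b : ℂ) (V' : Finset ℂ) :
    HasLiftCrossingBound (fun z => a * Complex.exp z + b) V' 2 := by
  intro A B hAB
  refine ⟨∅, finite_empty, fun δ _ hδ w _ k hkc hk => ?_⟩
  set lam : ℂ := Complex.I * (starRingEnd ℂ) (B - A) with hlam
  have hlam0 : lam ≠ 0 := mul_ne_zero Complex.I_ne_zero
    ((map_ne_zero _).2 (sub_ne_zero.2 hAB.symm))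
  set K := ‖lam * a‖ with hK
  have hK0 : 0 < K := norm_pos_iff.2 (mul_ne_zero hlam0 ha)
  set θ := Complex.arg (lam * a)
  set c := (lam * A).re - (lam * b).re with hc
  have key : ∀ t, K * Real.exp (k t).re * Real.cos ((k t).im + θ) = c := fun t => by
    rw [← re_mul_exp, hc]
    have h1 : lam * a * Complex.exp (k t) = lam * (A + (t : ℝ) * (B - A)) - lam * b := by
      rw [← hk t]; ring
    rw [h1, Complex.sub_re, hlam, re_mul_eq_of_mem_line]
  clear_value c
  have hslit : ∀ t, k t ∈ slits {w} δ → (k t).im = w.im + ((k t).re - w.re) * δ := fun t ht => by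
    have := congrArg Complex.im (eq_add_ray_of_mem_slits ht)
    simpa using this
  have hinj : InjOn (fun t : I => (k t).re) {t | k t ∈ slits {w} δ} := by
    intro t ht t' ht' e
    have e' : (k t).re = (k t').re := e
    have hkk : k t = k t' := Complex.ext e' (by rw [hslit t ht, hslit t' ht', e'])
    have h1 := hk t
    rw [hkk, hk t'] at h1
    have h2 := mul_right_cancel₀ (sub_ne_zero.2 hAB.symm) (add_left_cancel h1)
    exact Subtype.ext (by exact_mod_cast h2.symm)
  rw [← hinj.encard_image]
  have hyc : Continuous fun t : I => (k t).im + θ := by fun_prop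
  refine encard_le_two_of_lt ?_
  rintro _ ⟨t₁, ht₁, rfl⟩ _ ⟨t₂, ht₂, rfl⟩ _ ⟨t₃, ht₃, rfl⟩ h12 h23
  dsimp only at h12 h23
  by_cases hc0 : c = 0
  · have hcos : ∀ t, Real.cos ((k t).im + θ) = 0 := fun t => by
      have := key t
      rw [hc0] at this
      exact (mul_eq_zero.1 this).resolve_left (mul_pos hK0 (Real.exp_pos _)).ne'
    have e := eq_of_forall_cos_eq_zero hyc hcos t₁ t₂
    have e2 : (k t₁).im = (k t₂).im := by linarith
    rw [hslit t₁ ht₁, hslit t₂ ht₂] at e2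
    nlinarith
  · have hpos : ∀ t, 0 < c * Real.cos ((k t).im + θ) := fun t => by
      have h1 := key t
      have h2 : c * c = K * Real.exp (k t).re * (c * Real.cos ((k t).im + θ)) := by
        linear_combination (-c) * h1
      have h3 : 0 < c * c := mul_self_pos.2 hc0
      rw [h2] at h3
      exact (pos_iff_pos_of_mul_pos h3).1 (mul_pos hK0 (Real.exp_pos _))
    refine not_three_zeros (c := c) (K := K) (δ := δ) (θ := w.im - w.re * δ + θ) (x := 0) hK0 hδ
      h12 h23 (fun s hs => ?_) fun s hs => ?_
    · have h1 := hslit t₁ ht₁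
      have h3 := hslit t₃ ht₃
      -- By connectedness `y + θ` takes along the lift all values between those at the outer
      -- crossings. So the sign condition holds on the whole interval of the slit line and not only
      -- at the crossings.
      obtain ⟨t, -, ht⟩ := isPreconnected_univ.intermediate_value (mem_univ t₁) (mem_univ t₃)
        hyc.continuousOn (⟨by nlinarith [hs.1], by nlinarith [hs.2]⟩ :
          δ * s + (w.im - w.re * δ + θ) ∈ Icc ((k t₁).im + θ) ((k t₃).im + θ))
      rw [← ht]
      exact hpos t
    · have aux : ∀ t, k t ∈ slits {w} δ → c * K * Real.cos (δ * (k t).re + (w.im - w.re * δ + θ)) -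
          c ^ 2 * Real.exp (-((k t).re + 0)) = 0 := fun t ht => by
        have e : δ * (k t).re + (w.im - w.re * δ + θ) = (k t).im + θ := by rw [hslit t ht]; ring
        rw [e, add_zero, Real.exp_neg]
        have h1 := key t
        have hx := (Real.exp_pos (k t).re).ne'
        have h2 : K * Real.cos ((k t).im + θ) = c * (Real.exp (k t).re)⁻¹ := by
          rw [← h1]; field_simp
        linear_combination c * h2
      rcases hs with rfl | rfl | rfl
      exacts [aux _ ht₁, aux _ ht₂, aux _ ht₃]

theorem isCoveringMapOn_mul_exp_add {a : ℂ} (ha : a ≠ 0) (b : ℂ) :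
    IsCoveringMapOn (fun z => a * Complex.exp z + b) {b}ᶜ := by
  have := Complex.isCoveringMapOn_exp.homeomorph_comp
    ((Homeomorph.mulLeft₀ a ha).trans (Homeomorph.addRight b))
  refine IsCoveringMapOn.mono this ?_
  intro z hz h
  apply hz
  have h2 : a⁻¹ * (z + -b) = 0 := h
  rcases mul_eq_zero.1 h2 with h3 | h3
  · exact absurd h3 (inv_ne_zero ha)
  · exact add_neg_eq_zero.1 h3

/-- Words of lifts by exponential functions. -/
theorem homotopyWordLength_exp_lt {a b : ℂ} (ha : a ≠ 0) {V : Finset ℂ} (hb : b ∈ V)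
    {γ : ℝ≥0 → ℂ} (hγ : IsRCurveFrom V γ) (hγb : γ 0 ≠ b) {V' : Finset ℂ}
    (hV' : MapsTo (fun z => a * Complex.exp z + b) V' V)
    (hinj : InjOn (fun z => a * Complex.exp z + b) V') {γ' : ℝ≥0 → ℂ} (hγ' : IsRCurve γ')
    (h0 : γ' 0 ∈ V') (hlift : ∀ t, a * Complex.exp (γ' t) + b = γ t) :
    homotopyWordLength V' γ' < 6 * V.card ^ 2 * (homotopyWordLength V γ + 1) := by
  have hcov : IsCoveringMapOn (fun z => a * Complex.exp z + b) (V : Set ℂ)ᶜ :=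
    (isCoveringMapOn_mul_exp_add ha b).mono (compl_subset_compl.2 (by simpa using hb))
  have hiso : ∀ᶠ z in 𝓝[≠] (γ' 0), a * Complex.exp z + b ≠ a * Complex.exp (γ' 0) + b :=
    (((Complex.hasDerivAt_exp (γ' 0)).const_mul a).add_const b).eventually_ne
      (mul_ne_zero ha (Complex.exp_ne_zero _))
  have hle := homotopyWordLength_lift_le (by fun_prop) hcov hγ hγ' h0 hlift hV' hiso
    (hasLiftCrossingBound_exp ha b V')
  have hcard := card_le_of_lift hV' hinj
  -- As `b` and `γ 0` are distinct points of `V`, the crossing number 2 is absorbed by a factor `n`.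
  have hn : 2 ≤ V.card := Finset.one_lt_card.2 ⟨_, hγ.2.1, _, hb, hγb⟩
  refine hle.trans_lt ?_
  set m := homotopyWordLength V γ
  calc (5 * m + 2) * (V'.card * 2) ≤ (5 * m + 2) * (V.card * V.card) := by gcongr
    _ = (5 * m + 2) * V.card ^ 2 := by ring
    _ < (6 * m + 6) * V.card ^ 2 := Nat.mul_lt_mul_of_pos_right (by omega) (by positivity)
    _ = _ := by ring

end

noncomputable section

/-! ### Lifts by polynomials of the exponential -/

theorem tendsto_eval_reverse (p : Polynomial ℂ) {α : Type*} {l : Filter α} {β : α → ℂ}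
    (hβ : Tendsto (fun t => (β t)⁻¹) l (𝓝 0)) :
    Tendsto (fun t => p.reverse.eval (β t)⁻¹) l (𝓝 p.leadingCoeff) := by
  have := (p.reverse.continuous.tendsto 0).comp hβ
  rwa [← Polynomial.coeff_zero_eq_eval_zero, Polynomial.coeff_zero_reverse] at this

/-- Splits `p z` into `z ^ d` and a factor that tends to the leading coefficient as `z → ∞`. -/
theorem eval_reverse_mul_pow (p : Polynomial ℂ) {z : ℂ} (hz : z ≠ 0) :
    p.reverse.eval z⁻¹ * z ^ p.natDegree = p.eval z := by
  let _ := invertibleOfNonzero hz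
  have := Polynomial.eval₂_reverse_mul_pow (RingHom.id ℂ) z p
  simpa [Polynomial.eval₂_id, invOf_eq_inv] using this

/-- A continuous function whose cosine stays above `-1/2` stays near one multiple of `2 π`. -/
theorem exists_int_of_cos {y : ℝ≥0 → ℝ} (hy : Continuous y) {T : ℝ≥0}
    (h : ∀ t ≥ T, -(1 / 2) < Real.cos (y t)) :
    ∃ k : ℤ, ∀ t ≥ T, |y t - 2 * Real.pi * k| < 2 * Real.pi / 3 := by
  have hπ := Real.pi_pos
  have hcos : Real.cos (2 * Real.pi / 3) = -(1 / 2) := by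
    rw [show 2 * Real.pi / 3 = Real.pi - Real.pi / 3 by ring, Real.cos_pi_sub,
      Real.cos_pi_div_three]
  have hshift : ∀ (k : ℤ) t, Real.cos |y t - 2 * Real.pi * k| = Real.cos (y t) := fun k t => by
    rw [Real.cos_abs, show y t - 2 * Real.pi * k = y t - k * (2 * Real.pi) by ring,
      Real.cos_sub_int_mul_two_pi]
  set k : ℤ := round (y T / (2 * Real.pi)) with hk
  have hT : |y T - 2 * Real.pi * k| < 2 * Real.pi / 3 := by
    have h1 : |y T - 2 * Real.pi * k| ≤ Real.pi := by
      have := abs_sub_round (y T / (2 * Real.pi))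
      have e : y T - 2 * Real.pi * k = 2 * Real.pi * (y T / (2 * Real.pi) - k) := by
        field_simp
      rw [e, abs_mul, abs_of_pos (by positivity)]
      nlinarith
    by_contra hcon
    push Not at hcon
    have h2 := Real.cos_le_cos_of_nonneg_of_le_pi (by positivity) h1 hcon
    rw [hshift, hcos] at h2
    linarith [h T le_rfl]
  refine ⟨k, fun t ht => ?_⟩
  by_contra hcon
  push Not at hcon
  obtain ⟨s, hs, hs'⟩ := isPreconnected_Ici.intermediate_value (mem_Ici.2 (le_refl T))
    (mem_Ici.2 ht) (f := fun t => |y t - 2 * Real.pi * k|) (by fun_prop) ⟨hT.le, hcon⟩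
  have h3 := hshift k s
  dsimp only at hs'
  rw [hs', hcos] at h3
  linarith [h s hs]

/-- If `p ∘ exp ∘ γ'` is an r-curve, then so is a rotation of `exp ∘ γ'`. -/
theorem exists_rotation_isRCurve {p : Polynomial ℂ} (hm : p.Monic) (hd : p.natDegree ≠ 0)
    {γ γ' : ℝ≥0 → ℂ} (hγ : IsRCurve γ) (hγ' : IsRCurve γ')
    (hlift : ∀ t, p.eval (Complex.exp (γ' t)) = γ t) :
    ∃ a : ℂ, a ^ p.natDegree = 1 ∧ IsRCurve fun t => a * Complex.exp (γ' t) := by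
  have hcont : ∀ a : ℂ, Continuous fun t => a * Complex.exp (γ' t) := fun a =>
    continuous_const.mul (Complex.continuous_exp.comp hγ'.1)
  -- In degree one `exp ∘ γ'` is a translate of `γ`. The angular estimate used for `d ≥ 2` would
  -- confine the argument only to `2 π / 3`, where the cosine can be negative.
  rcases eq_or_ne p.natDegree 1 with h1 | h1
  · refine ⟨1, by simp, hcont 1, ?_⟩
    have e : ∀ t, (1 * Complex.exp (γ' t)).re = (γ t).re + -(p.coeff 0).re := fun t => by
      rw [← hlift t, hm.eq_X_add_C h1]
      simp
    simp only [e]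
    exact tendsto_atTop_add_const_right _ _ hγ.2
  have hd2 : 2 ≤ p.natDegree := by omega
  set d := p.natDegree with hdd
  have hnorm : Tendsto (fun t => ‖Complex.exp (γ' t)‖) atTop atTop := by
    simp only [Complex.norm_exp]
    exact Real.tendsto_exp_atTop.comp hγ'.2
  have hinv : Tendsto (fun t => (Complex.exp (γ' t))⁻¹) atTop (𝓝 0) :=
    tendsto_inv₀_cobounded.comp (tendsto_norm_atTop_iff_cobounded.1 hnorm)
  have hrev := tendsto_eval_reverse p hinv
  rw [hm.leadingCoeff] at hrev
  have hev1 : ∀ᶠ t in atTop, ‖p.reverse.eval (Complex.exp (γ' t))⁻¹ - 1‖ < 1 / 2 := by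
    have := Metric.tendsto_nhds.1 hrev (1 / 2) (by norm_num)
    simpa [dist_eq_norm] using this
  obtain ⟨T, hT⟩ := (hev1.and (hγ.2.eventually (eventually_gt_atTop 0))).exists_forall_of_atTop
  have hyc : Continuous fun t => d * (γ' t).im :=
    continuous_const.mul (Complex.continuous_im.comp hγ'.1)
  -- With `γ = (1 + η) e^{d γ'}` and `‖η‖ < 1 / 2`, positivity of `Re γ` forces `cos(d Im γ') >
  -- -1/2`.
  obtain ⟨k, hk⟩ := exists_int_of_cos hyc (T := T) fun t ht => by
    obtain ⟨h2, h3⟩ := hT t ht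
    set η := p.reverse.eval (Complex.exp (γ' t))⁻¹ - 1 with hη
    have e1 : γ t = (1 + η) * Complex.exp (d * γ' t) := by
      rw [← hlift t, ← eval_reverse_mul_pow p (Complex.exp_ne_zero _), hη, Complex.exp_nat_mul]
      ring
    have e2 : (γ t).re = (Complex.exp (d * γ' t)).re + (η * Complex.exp (d * γ' t)).re := by
      rw [e1, add_mul, one_mul, Complex.add_re]
    have e3 : (η * Complex.exp (d * γ' t)).re ≤ 1 / 2 * Real.exp (d * (γ' t).re) := by
      refine (Complex.re_le_norm _).trans ?_
      rw [norm_mul, Complex.norm_exp]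
      have : ((d : ℂ) * γ' t).re = d * (γ' t).re := by simp
      rw [this]
      gcongr
    have e4 : (Complex.exp (d * γ' t)).re = Real.exp (d * (γ' t).re) * Real.cos (d * (γ' t).im) := by
      rw [Complex.exp_re]; simp
    have h5 := Real.exp_pos (d * (γ' t).re)
    have h6 : 0 < Real.exp (d * (γ' t).re) * (Real.cos (d * (γ' t).im) + 1 / 2) := by
      rw [e2, e4] at h3
      linarith
    have := pos_of_mul_pos_right h6 h5.le
    linarith
  have hdpos : (0 : ℝ) < d := by exact_mod_cast Nat.pos_of_ne_zero hd
  -- From time `T` on, the imaginary part of `γ'` is within `2 π / (3 d) ≤ π / 3` of `y₀`. Rotation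
  -- by `-y₀`, a multiple of `2 π / d`, makes the real part of the exponential at least half of its
  -- modulus.
  set y₀ : ℝ := 2 * Real.pi * k / d with hy₀
  refine ⟨Complex.exp (-(y₀ * Complex.I)), ?_, hcont _, ?_⟩
  · rw [← Complex.exp_nat_mul]
    have : (d : ℂ) * -(y₀ * Complex.I) = ((-k : ℤ) : ℂ) * (2 * Real.pi * Complex.I) := by
      have hdc : (d : ℂ) ≠ 0 := by exact_mod_cast hd
      rw [hy₀]; push_cast; field_simp
    rw [this]
    exact Complex.exp_int_mul_two_pi_mul_I _
  · have hre : ∀ t, (Complex.exp (-(y₀ * Complex.I)) * Complex.exp (γ' t)).re =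
        Real.exp (γ' t).re * Real.cos ((γ' t).im - y₀) := fun t => by
      rw [← Complex.exp_add, Complex.exp_re]
      simp [neg_add_eq_sub]
    simp only [hre]
    have hlow : Tendsto (fun t => Real.exp (γ' t).re * (1 / 2)) atTop atTop :=
      (Real.tendsto_exp_atTop.comp hγ'.2).atTop_mul_const (by norm_num)
    refine tendsto_atTop_mono' _ ?_ hlow
    filter_upwards [eventually_ge_atTop T] with t ht
    have h2 := hk t ht
    have e : d * (γ' t).im - 2 * Real.pi * k = d * ((γ' t).im - y₀) := by
      rw [hy₀]; field_simp
    rw [e, abs_mul, abs_of_pos hdpos] at h2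
    have hd2' : (2 : ℝ) ≤ d := by exact_mod_cast hd2
    have h3 : |(γ' t).im - y₀| ≤ Real.pi / 3 := by
      by_contra hcon
      push Not at hcon
      nlinarith [Real.pi_pos, abs_nonneg ((γ' t).im - y₀)]
    have h4 := Real.cos_le_cos_of_nonneg_of_le_pi (abs_nonneg _) (by linarith [Real.pi_pos]) h3
    rw [Real.cos_abs, Real.cos_pi_div_three] at h4
    exact mul_le_mul_of_nonneg_left h4 (Real.exp_pos _).le

/-- It is the asymptotic value along the negative real axis. -/
theorem eval_zero_mem_singularValues (p : Polynomial ℂ) :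
    p.eval 0 ∈ singularValues fun z => p.eval (Complex.exp z) := by
  refine subset_closure (.inr ⟨fun t => ((-(t : ℝ) : ℝ) : ℂ), by fun_prop, ?_, ?_⟩)
  · rw [← Metric.cobounded_eq_cocompact, ← tendsto_norm_atTop_iff_cobounded]
    simpa using NNReal.tendsto_coe_atTop.2 tendsto_id
  · have h1 : Tendsto (fun t : ℝ≥0 => Real.exp (-(t : ℝ))) atTop (𝓝 0) :=
      Real.tendsto_exp_neg_atTop_nhds_zero.comp (NNReal.tendsto_coe_atTop.2 tendsto_id)
    have h2 : Tendsto (fun t : ℝ≥0 => Complex.exp ((-(t : ℝ) : ℝ) : ℂ)) atTop (𝓝 0) := by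
      have := (Complex.continuous_ofReal.tendsto 0).comp h1
      simpa [Function.comp_def] using this
    exact (p.continuous.tendsto 0).comp h2

/-- Critical points other than 0 are in the image of `exp`; if 0 is critical, its value is still an
asymptotic value. -/
theorem criticalValues_subset_singularValues (p : Polynomial ℂ) :
    criticalValues (fun z => p.eval z) ⊆ singularValues fun z => p.eval (Complex.exp z) := by
  rintro _ ⟨c, hc, rfl⟩
  by_cases h0 : c = 0
  · subst h0; exact eval_zero_mem_singularValues p
  refine subset_closure (.inl ⟨Complex.log c, ?_, by simp [Complex.exp_log h0]⟩)
  have h1 : HasDerivAt (fun z => p.eval z) 0 (Complex.exp (Complex.log c)) := by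
    rw [Complex.exp_log h0]
    have h2 : deriv (fun z => p.eval z) c = 0 := hc
    rw [← h2]
    exact p.differentiable.differentiableAt.hasDerivAt
  have := h1.comp _ (Complex.hasDerivAt_exp (Complex.log c))
  rw [zero_mul] at this
  exact this.deriv

/-- Words of lifts by `p ∘ exp`. -/
theorem homotopyWordLength_polynomial_exp_lt {p : Polynomial ℂ} (hm : p.Monic) {g : ℂ → ℂ}
    (hg : g = fun z => p.eval (Complex.exp z)) {V : Finset ℂ} (hS : singularValues g ⊆ V)
    {γ : ℝ≥0 → ℂ} (hγ : IsRCurveFrom V γ) {V' : Finset ℂ}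
    (hV' : MapsTo g V' (V \ singularValues g)) (hinj : InjOn g V') {γ' : ℝ≥0 → ℂ}
    (hγ' : IsRCurve γ') (h0 : γ' 0 ∈ V') (hlift : ∀ t, g (γ' t) = γ t) :
    homotopyWordLength V' γ' <
      42 * p.natDegree * V.card ^ 4 * (homotopyWordLength V γ + 1) := by
  subst hg
  have hd := natDegree_ne_zero_of_lift hγ.1 hlift
  obtain ⟨a, ha, hβ⟩ := exists_rotation_isRCurve hm hd hγ.1 hγ' hlift
  have ha0 : a ≠ 0 := fun h => by rw [h, zero_pow hd] at ha; exact zero_ne_one ha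
  set β : ℝ≥0 → ℂ := fun t => a * Complex.exp (γ' t) with hβdef
  -- The rotation is compensated in the polynomial, so that `P ∘ β = γ`; `P` is again monic because
  -- `a ^ d = 1`.
  set P : Polynomial ℂ := p.comp (Polynomial.C a⁻¹ * Polynomial.X) with hP
  have hl1 : (Polynomial.C a⁻¹ * Polynomial.X).natDegree = 1 :=
    Polynomial.natDegree_C_mul_X _ (inv_ne_zero ha0)
  have hPd : P.natDegree = p.natDegree := by rw [hP, Polynomial.natDegree_comp, hl1, mul_one]
  have hPm : P.Monic := by
    rw [Polynomial.Monic, hP, Polynomial.leadingCoeff_comp (by rw [hl1]; simp), hm.leadingCoeff,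
      Polynomial.leadingCoeff_C_mul_X, one_mul, inv_pow, ha, inv_one]
  have hPe : ∀ z, P.eval z = p.eval (a⁻¹ * z) := fun z => by simp [hP, Polynomial.eval_comp]
  have hPa : ∀ z, P.eval (a * z) = p.eval z := fun z => by
    rw [hPe, inv_mul_cancel_left₀ ha0]
  -- The omitted value 0 of the exponential has to be marked. Injectivity survives since `P 0 = p 0`
  -- is singular while `g` maps `V'` to nonsingular values.
  set V'' : Finset ℂ := insert 0 (V'.image fun z => a * Complex.exp z) with hV''
  have hmem : ∀ z ∈ V', a * Complex.exp z ∈ V'' := fun z hz =>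
    Finset.mem_insert_of_mem (Finset.mem_image_of_mem _ hz)
  have hP0 : P.eval 0 ∈ singularValues fun z => p.eval (Complex.exp z) := by
    rw [hPe, mul_zero]; exact eval_zero_mem_singularValues p
  have hPV : MapsTo (fun z => P.eval z) V'' V := by
    intro z hz
    rcases Finset.mem_insert.1 hz with rfl | hz
    · exact hS hP0
    · obtain ⟨v, hv, rfl⟩ := Finset.mem_image.1 hz
      dsimp only
      rw [hPa]
      exact (hV' hv).1
  have hPinj : InjOn (fun z => P.eval z) V'' := by
    intro z hz z' hz' e
    dsimp only at e
    rcases Finset.mem_insert.1 hz with rfl | hz <;> rcases Finset.mem_insert.1 hz' with rfl | hz'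
    · rfl
    · obtain ⟨v, hv, rfl⟩ := Finset.mem_image.1 hz'
      rw [hPa] at e
      exact absurd (by rw [e] at hP0; exact hP0) (hV' hv).2
    · obtain ⟨v, hv, rfl⟩ := Finset.mem_image.1 hz
      rw [hPa] at e
      exact absurd (by rw [← e] at hP0; exact hP0) (hV' hv).2
    · obtain ⟨v, hv, rfl⟩ := Finset.mem_image.1 hz
      obtain ⟨v', hv', rfl⟩ := Finset.mem_image.1 hz'
      rw [hPa, hPa] at e
      rw [hinj hv hv' e]
  have hPcrit : criticalValues (fun z => P.eval z) ⊆ V := by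
    refine subset_trans ?_ ((criticalValues_subset_singularValues p).trans hS)
    rintro _ ⟨z, hz, rfl⟩
    refine ⟨a⁻¹ * z, ?_, (hPe z).symm⟩
    have hz : deriv (fun z => P.eval z) z = 0 := hz
    change deriv (fun z => p.eval z) (a⁻¹ * z) = 0
    rw [Polynomial.deriv] at hz ⊢
    rw [hP, Polynomial.derivative_comp] at hz
    simpa [Polynomial.eval_comp, ha0] using hz
  have hβlift : ∀ t, P.eval (β t) = γ t := fun t => by rw [hβdef, hPa]; exact hlift t
  have hβV : IsRCurveFrom V'' β := ⟨hβ, hmem _ h0, fun t ht h => hγ.2.2 t ht (by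
    have := hPV h
    dsimp only at this
    rwa [hβlift] at this)⟩
  have b1 := homotopyWordLength_polynomial_lt hPm hPcrit hγ hPV hPinj hβ (hmem _ h0) hβlift
  have b2 := homotopyWordLength_exp_lt (b := 0) ha0 (Finset.mem_insert_self _ _) hβV
    (mul_ne_zero ha0 (Complex.exp_ne_zero _)) (V' := V') (γ' := γ')
    (fun z hz => by dsimp only; rw [add_zero]; exact hmem z hz)
    (fun z hz z' hz' e => hinj hz hz' (by
      have e' : a * Complex.exp z + 0 = a * Complex.exp z' + 0 := e
      rw [add_zero, add_zero] at e'
      dsimp only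
      rw [mul_left_cancel₀ ha0 e'])) hγ' h0 (fun t => add_zero _)
  have hcard := card_le_of_lift hPV hPinj
  rw [hPd] at b1
  have hn : 0 < V.card := Finset.card_pos.2 ⟨_, hγ.2.1⟩
  have hd' : 0 < p.natDegree := Nat.pos_of_ne_zero hd
  set m := homotopyWordLength V γ
  -- The strict bound `b1` absorbs the `+ 1`, and the constant obtained is `6 · 6 = 36`.
  calc homotopyWordLength V' γ' < 6 * V''.card ^ 2 * (homotopyWordLength V'' β + 1) := b2
    _ ≤ 6 * V.card ^ 2 * (6 * p.natDegree * V.card ^ 2 * (m + 1)) := by gcongr; exact b1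
    _ = 36 * (p.natDegree * V.card ^ 4 * (m + 1)) := by ring
    _ ≤ 42 * (p.natDegree * V.card ^ 4 * (m + 1)) := by gcongr; norm_num
    _ = _ := by ring

end

/-! ### The pullback step for captured exponential functions. -/

noncomputable section

/-! ### Entire functions topologically conjugate to the exponential -/

theorem exists_continuous_log {f : ℂ → ℂ} (hf : Continuous f) (h0 : ∀ z, f z ≠ 0) :
    ∃ h : ℂ → ℂ, Continuous h ∧ ∀ z, Complex.exp (h z) = f z := by
  obtain ⟨F, ⟨-, hF⟩, -⟩ := Complex.isCoveringMapOn_exp.existsUnique_continuousMap_lifts ⟨f, hf⟩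
    (a₀ := 0) (e₀ := Complex.log (f 0)) (Complex.exp_log (h0 0)) h0
  exact ⟨F, F.continuous, fun z => congrFun hF z⟩

/-- The difference is a lift of the constant 1 through `exp`, hence constant. -/
theorem eq_add_const_of_exp_eq {A B : ℂ → ℂ} (hA : Continuous A) (hB : Continuous B)
    (h : ∀ z, Complex.exp (A z) = Complex.exp (B z)) : ∃ k, ∀ z, A z = B z + k := by
  obtain ⟨G, -, hG⟩ := Complex.isCoveringMapOn_exp.existsUnique_continuousMap_lifts
    (⟨fun _ => 1, continuous_const⟩ : C(ℂ, ℂ)) (a₀ := 0) (e₀ := A 0 - B 0)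
    (by simp [Complex.exp_sub, h]) (fun _ => by simp)
  have e1 := hG ⟨fun z => A z - B z, hA.sub hB⟩
    ⟨rfl, funext fun z => by simp [Complex.exp_sub, h]⟩
  have e2 := hG (.const ℂ (A 0 - B 0))
    ⟨rfl, funext fun z => by simp [Complex.exp_sub, h]⟩
  refine ⟨A 0 - B 0, fun z => ?_⟩
  have := DFunLike.congr_fun (e1.trans e2.symm) z
  simp only [ContinuousMap.coe_mk, ContinuousMap.const_apply] at this
  rw [← this]; ring

/-- Near `z` the function `h` is a branch of `log f`, expressed by the principal branch near 1. -/
theorem differentiable_of_exp_eq {f h : ℂ → ℂ} (hf : Differentiable ℂ f) (hh : Continuous h)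
    (he : ∀ z, Complex.exp (h z) = f z) : Differentiable ℂ h := by
  intro z
  have hfz : f z ≠ 0 := by rw [← he]; exact Complex.exp_ne_zero _
  have hev : (fun w => h z + Complex.log (f w / f z)) =ᶠ[𝓝 z] h := by
    have hc : ContinuousAt (fun w => ‖h w - h z‖) z := by fun_prop
    filter_upwards [hc.eventually (gt_mem_nhds (by simpa using Real.pi_pos))] with w hw
    have him := abs_lt.1 ((Complex.abs_im_le_norm (h w - h z)).trans_lt hw)
    rw [← he w, ← he z, ← Complex.exp_sub, Complex.log_exp him.1 him.2.le]
    ring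
  refine DifferentiableAt.congr_of_eventuallyEq ?_ hev.symm
  refine (differentiableAt_const _).add (DifferentiableAt.clog (hf.differentiableAt.div_const _) ?_)
  rw [div_self hfz]
  exact Complex.one_mem_slitPlane

/-- An entire function of at most linear growth without zeros is constant. -/
theorem exists_eq_const_of_linear_growth {F : ℂ → ℂ} (hF : Differentiable ℂ F) (h0 : ∀ z, F z ≠ 0)
    {C M : ℝ} (hC : ∀ z, M < ‖z‖ → ‖F z‖ ≤ C * ‖z‖) : ∃ c, ∀ z, F z = c := by
  have hD : Differentiable ℂ (dslope F 0) := by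
    rw [← differentiableOn_univ] at hF ⊢
    exact (Complex.differentiableOn_dslope univ_mem).2 hF
  have hslope : ∀ z, F z = F 0 + z * dslope F 0 z := fun z => by
    have := sub_smul_dslope F 0 z
    rw [sub_zero, smul_eq_mul] at this
    rw [this]; ring
  -- Linear growth bounds the difference quotient, which is then constant by Liouville; and an
  -- affine function without zeros is constant.
  have hb : Bornology.IsBounded (range (dslope F 0)) := by
    obtain ⟨B, hB⟩ := ((isCompact_closedBall (0 : ℂ) (max M 1)).image
      hD.continuous).isBounded.exists_norm_le
    refine isBounded_iff_forall_norm_le.2 ⟨max B (C + ‖F 0‖), ?_⟩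
    rintro _ ⟨z, rfl⟩
    by_cases hz : ‖z‖ ≤ max M 1
    · exact (hB _ ⟨z, by simpa using hz, rfl⟩).trans (le_max_left _ _)
    · push Not at hz
      have hz1 : 1 < ‖z‖ := (le_max_right _ _).trans_lt hz
      have h1 := hC z ((le_max_left _ _).trans_lt hz)
      refine le_trans ?_ (le_max_right _ _)
      have h2 : ‖z‖ * ‖dslope F 0 z‖ ≤ C * ‖z‖ + ‖F 0‖ := by
        rw [← norm_mul, show z * dslope F 0 z = F z - F 0 by rw [hslope z]; ring]
        exact (norm_sub_le _ _).trans (by linarith)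
      have h3 := norm_nonneg (F 0)
      have h4 : ‖z‖ * ‖dslope F 0 z‖ ≤ ‖z‖ * (C + ‖F 0‖) := by nlinarith
      exact le_of_mul_le_mul_left h4 (by linarith)
  have hconst : ∀ z, dslope F 0 z = dslope F 0 0 := fun z => hD.apply_eq_apply_of_bounded hb z 0
  by_cases hd : dslope F 0 0 = 0
  · exact ⟨F 0, fun z => by rw [hslope z, hconst z, hd, mul_zero, add_zero]⟩
  · exfalso
    refine h0 (-F 0 / dslope F 0 0) ?_
    rw [hslope (-F 0 / dslope F 0 0), hconst (-F 0 / dslope F 0 0), div_mul_cancel₀ _ hd, add_neg_cancel]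

/-- Injective proper entire functions are affine. -/
theorem exists_affine_of_injective_proper {h : ℂ → ℂ} (hh : Differentiable ℂ h)
    (hinj : Function.Injective h) (hprop : Tendsto h (cocompact ℂ) (cocompact ℂ)) :
    ∃ α β : ℂ, ∀ z, h z = α * z + β := by
  obtain ⟨z₀, hz₀⟩ : ∃ z₀, deriv h z₀ ≠ 0 := by
    by_contra hcon
    push Not at hcon
    exact zero_ne_one (hinj (is_const_of_deriv_eq_zero hh hcon 0 1))
  have hD : Differentiable ℂ (dslope h z₀) := by
    rw [← differentiableOn_univ] at hh ⊢
    exact (Complex.differentiableOn_dslope univ_mem).2 hh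
  have hslope : ∀ z, (z - z₀) * dslope h z₀ z = h z - h z₀ := fun z => by
    simpa using sub_smul_dslope h z₀ z
  -- The difference quotient at `z₀` has no zeros: away from `z₀` by injectivity, at `z₀` by the
  -- choice of `z₀`. Properness bounds it below by a multiple of `1 / ‖z‖` for large `z`, so its
  -- inverse has at most linear growth.
  have hne : ∀ z, dslope h z₀ z ≠ 0 := fun z hz => by
    by_cases hzz : z = z₀
    · rw [hzz, dslope_same] at hz; exact hz₀ hz
    · have := hslope z
      rw [hz, mul_zero] at this
      exact hzz (hinj (sub_eq_zero.1 this.symm))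
  have hFd : Differentiable ℂ fun z => (dslope h z₀ z)⁻¹ := hD.inv hne
  rw [← Metric.cobounded_eq_cocompact, ← tendsto_norm_atTop_iff_cobounded] at hprop
  obtain ⟨M, hM⟩ : ∃ M, ∀ z, M < ‖z‖ → ‖h z₀‖ + 1 < ‖h z‖ := by
    have h1 := hprop.eventually (eventually_gt_atTop (‖h z₀‖ + 1))
    rw [← comap_norm_atTop] at h1
    obtain ⟨s, hs, hsub⟩ := h1
    obtain ⟨M, hM⟩ := mem_atTop_sets.1 hs
    exact ⟨M, fun z hz => hsub (hM _ hz.le)⟩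
  obtain ⟨c, hc⟩ := exists_eq_const_of_linear_growth hFd (fun z => inv_ne_zero (hne z))
    (C := 1 + ‖z₀‖) (M := max M 1) fun z hz => by
      have hz1 : 1 < ‖z‖ := (le_max_right _ _).trans_lt hz
      have h1 := hM z ((le_max_left _ _).trans_lt hz)
      have h2 : 1 ≤ ‖h z - h z₀‖ := by
        have := norm_sub_norm_le (h z) (h z₀)
        linarith
      have h3 : ‖z - z₀‖ ≤ (1 + ‖z₀‖) * ‖z‖ := by
        have := norm_sub_le z z₀
        nlinarith [norm_nonneg z₀]
      have h4 := hslope z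
      have h5 : 0 < ‖dslope h z₀ z‖ := norm_pos_iff.2 (hne z)
      rw [← h4, norm_mul] at h2
      rw [norm_inv, inv_le_iff_one_le_mul₀ h5]
      exact h2.trans (mul_le_mul_of_nonneg_right h3 h5.le)
  refine ⟨c⁻¹, h z₀ - c⁻¹ * z₀, fun z => ?_⟩
  have h1 := hslope z
  have h2 : dslope h z₀ z = c⁻¹ := by rw [← hc z, inv_inv]
  rw [h2] at h1
  linear_combination -h1

/-- As `T` fixes only 0 over 0, the entire function has no zeros and has an entire logarithm `h`.
Lifts through `exp` are unique up to constants, so a logarithm of `T.symm ∘ exp` composed with `θ`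
inverts `h` up to translations. Hence `h` is an entire homeomorphism of the plane, and therefore
affine. -/
theorem exists_exp_affine {T θ : ℂ ≃ₜ ℂ} (hT : T 0 = 0)
    (hd : Differentiable ℂ fun z => T (Complex.exp (θ.symm z))) :
    ∃ α β : ℂ, ∀ z, T (Complex.exp (θ.symm z)) = Complex.exp (α * z + β) := by
  have hT0 : ∀ z, z ≠ 0 → T z ≠ 0 := fun z hz e => hz (T.injective (e.trans hT.symm))
  have hTs0 : ∀ z, z ≠ 0 → T.symm z ≠ 0 := fun z hz e => hz (by
    rw [← T.apply_symm_apply z, e, hT])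
  obtain ⟨h, hhc, hh⟩ := exists_continuous_log hd.continuous fun z => hT0 _ (Complex.exp_ne_zero _)
  obtain ⟨H', hH'c, hH'⟩ := exists_continuous_log (f := fun w => T.symm (Complex.exp w))
    (T.symm.continuous.comp Complex.continuous_exp) fun w => hTs0 _ (Complex.exp_ne_zero _)
  have hH : ∀ w, Complex.exp (h (θ w)) = T (Complex.exp w) := fun w => by rw [hh]; simp
  obtain ⟨k, hk⟩ := eq_add_const_of_exp_eq (A := fun w => H' (h (θ w))) (B := fun w => w)
    (hH'c.comp (hhc.comp θ.continuous)) continuous_id fun w => by rw [hH', hH]; simp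
  obtain ⟨k', hk'⟩ := eq_add_const_of_exp_eq (A := fun w => h (θ (H' w))) (B := fun w => w)
    (hhc.comp (θ.continuous.comp hH'c)) continuous_id fun w => by rw [hH, hH']; simp
  have hinj : Function.Injective h := fun z z' e => by
    have h1 := hk (θ.symm z)
    have h2 := hk (θ.symm z')
    simp only [Homeomorph.apply_symm_apply] at h1 h2
    rw [e, h2] at h1
    exact θ.symm.injective (add_right_cancel h1).symm
  have hleft : Function.LeftInverse (fun w => θ (H' w - k)) h := fun z => by
    have h1 := hk (θ.symm z)
    simp only [Homeomorph.apply_symm_apply] at h1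
    simp [h1]
  have hsurj : Function.Surjective h := fun w => ⟨θ (H' (w - k')), by rw [hk']; ring⟩
  let Φ : ℂ ≃ₜ ℂ :=
    { toFun := h
      invFun := fun w => θ (H' w - k)
      left_inv := hleft
      right_inv := hleft.rightInverse_of_surjective hsurj
      continuous_toFun := hhc
      continuous_invFun := θ.continuous.comp (hH'c.sub continuous_const) }
  obtain ⟨α, β, hαβ⟩ := exists_affine_of_injective_proper
    (differentiable_of_exp_eq hd hhc hh) hinj Φ.isClosedEmbedding.tendsto_cocompact
  exact ⟨α, β, fun z => by rw [← hαβ, hh]⟩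

/-- If `e^{(α - 1) z + β} → 1` along a curve with `Re z → +∞` and bounded imaginary part, then
`α = 1`. -/
theorem eq_one_of_tendsto_exp {α β : ℂ} {z : ℝ≥0 → ℂ} (hz : IsRCurve z) {B : ℝ}
    (hB : ∀ᶠ t in atTop, |(z t).im| ≤ B)
    (h : Tendsto (fun t => Complex.exp ((α - 1) * z t + β)) atTop (𝓝 1)) : α = 1 := by
  set c := α - 1 with hc
  have hre : ∀ t, (c * z t + β).re = c.re * (z t).re - c.im * (z t).im + β.re := fun t => by
    simp
  have him : ∀ t, (c * z t + β).im = c.re * (z t).im + c.im * (z t).re + β.im := fun t => by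
    simp
  have hlog : Tendsto (fun t => (c * z t + β).re) atTop (𝓝 0) := by
    have h1 := (h.norm).log (by simp)
    simpa [Complex.norm_exp] using h1
  have hbd : ∀ {b : ℝ}, ∀ᶠ t in atTop, |b * (z t).im| ≤ |b| * B := fun {b} => by
    filter_upwards [hB] with t ht
    rw [abs_mul]
    exact mul_le_mul_of_nonneg_left ht (abs_nonneg _)
  -- The modulus of the exponential decides this: `Im z` is bounded, so a nonzero `c.re` would make
  -- it tend to 0 or to infinity.
  have hcre : c.re = 0 := by
    by_contra hne
    have h1 : Tendsto (fun t => |c.re| * (z t).re) atTop atTop :=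
      hz.2.const_mul_atTop (abs_pos.2 hne)
    have h2 := h1.eventually (eventually_gt_atTop (|c.im| * B + |β.re| + 1))
    have h3 := Metric.tendsto_nhds.1 hlog 1 one_pos
    have h4 := hz.2.eventually (eventually_gt_atTop 0)
    obtain ⟨t, h2, h3, h4, h5⟩ := (h2.and (h3.and (h4.and (hbd (b := c.im))))).exists
    rw [Real.dist_eq, sub_zero, hre] at h3
    have e : |c.re| * (z t).re = |c.re * (z t).re| := by rw [abs_mul, abs_of_pos h4]
    rw [e] at h2
    have h6 : |c.re * (z t).re| ≤
        |c.re * (z t).re - c.im * (z t).im + β.re| + |c.im * (z t).im| + |β.re| := by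
      have := abs_add_le (c.re * (z t).re - c.im * (z t).im + β.re) (c.im * (z t).im - β.re)
      rw [show c.re * (z t).re - c.im * (z t).im + β.re + (c.im * (z t).im - β.re) =
        c.re * (z t).re by ring] at this
      linarith [abs_sub (c.im * (z t).im) β.re]
    linarith
  -- Now the argument is `c.im · Re z` up to a constant. If it were unbounded, its cosine could not
  -- stay positive.
  have hcim : c.im = 0 := by
    by_contra hne
    have hcos : ∀ᶠ t in atTop, 0 < Real.cos (c.im * (z t).re + β.im) := by
      have h1 : Tendsto (fun t => (Complex.exp (c * z t + β)).re) atTop (𝓝 1) := by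
        have := (Complex.continuous_re.tendsto 1).comp h
        rwa [Complex.one_re] at this
      filter_upwards [h1.eventually (lt_mem_nhds one_pos)] with t ht
      rw [Complex.exp_re, him, hcre, zero_mul, zero_add] at ht
      exact pos_of_mul_pos_right ht (Real.exp_pos _).le
    obtain ⟨T, hT⟩ := hcos.exists_forall_of_atTop
    obtain ⟨k, hk⟩ := exists_int_of_cos (y := fun t => c.im * (z t).re + β.im)
      ((continuous_const.mul (Complex.continuous_re.comp hz.1)).add continuous_const) (T := T)
      fun t ht => by linarith [hT t ht]
    have h1 : Tendsto (fun t => |c.im| * (z t).re) atTop atTop :=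
      hz.2.const_mul_atTop (abs_pos.2 hne)
    have h2 := h1.eventually (eventually_gt_atTop (|β.im| + |2 * Real.pi * k| + 2 * Real.pi / 3))
    have h4 := hz.2.eventually (eventually_gt_atTop 0)
    obtain ⟨t, h2, h4, h5⟩ := (h2.and (h4.and (eventually_ge_atTop T))).exists
    have h6 := hk t h5
    have e : |c.im| * (z t).re = |c.im * (z t).re| := by rw [abs_mul, abs_of_pos h4]
    rw [e] at h2
    have h7 : |c.im * (z t).re| ≤
        |c.im * (z t).re + β.im - 2 * Real.pi * k| + |β.im| + |2 * Real.pi * k| := by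
      have := abs_add_le (c.im * (z t).re + β.im - 2 * Real.pi * k) (2 * Real.pi * k - β.im)
      rw [show c.im * (z t).re + β.im - 2 * Real.pi * k + (2 * Real.pi * k - β.im) =
        c.im * (z t).re by ring] at this
      linarith [abs_sub (2 * Real.pi * k) β.im]
    linarith
  have : c = 0 := Complex.ext hcre hcim
  rw [hc] at this
  exact sub_eq_zero.1 this

end

noncomputable section

/-! ### Legs of captured exponential functions -/

namespace CapturedExponential

variable (E : CapturedExponential)

theorem isRayTail : IsRayTail (expMap E.κ) fun x : ℝ≥0 => E.ray (E.t₀ + x) :=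
  E.isDynamicRay.1.2 E.t₀ E.t₀_pos

theorem R_add (k n : ℕ) (x : ℝ≥0) : E.R (k + n) x = (expMap E.κ)^[k] (E.R n x) :=
  Function.iterate_add_apply _ k n _

theorem R_succ (n : ℕ) (x : ℝ≥0) : E.R (n + 1) x = Complex.exp (E.R n x) + E.κ :=
  Function.iterate_succ_apply' _ n _

theorem a_zero : E.a 0 = E.ray E.t₀ := by simp [a, R]

theorem continuous_R (n : ℕ) : Continuous (E.R n) := by
  induction n with
  | zero => exact E.isRayTail.1
  | succ n ih =>
    rw [funext (E.R_succ n)]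
    exact (Complex.continuous_exp.comp ih).add continuous_const

theorem R_injective (n : ℕ) : Function.Injective (E.R n) := (E.isRayTail.2.2.1 n).1

theorem tendsto_norm_R (n : ℕ) : Tendsto (fun x => ‖E.R n x‖) atTop atTop := by
  rw [tendsto_norm_atTop_iff_cobounded, Metric.cobounded_eq_cocompact]
  exact (E.isRayTail.2.2.1 n).2

theorem exp_re_R (n : ℕ) (x : ℝ≥0) : Real.exp (E.R n x).re = ‖E.R (n + 1) x - E.κ‖ := by
  rw [R_succ, add_sub_cancel_right, Complex.norm_exp]

theorem isRCurve_R (n : ℕ) : IsRCurve (E.R n) := by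
  refine ⟨E.continuous_R n, Real.tendsto_exp_comp_atTop.1 ?_⟩
  simp only [exp_re_R]
  refine tendsto_atTop_mono (fun x => norm_sub_norm_le _ _) ?_
  simpa only [sub_eq_add_neg] using tendsto_atTop_add_const_right _ (-‖E.κ‖) (E.tendsto_norm_R (n + 1))

theorem eventually_abs_im_R (n : ℕ) :
    ∀ᶠ x in atTop, |(E.R n x).im - 2 * Real.pi * E.s n| < Real.pi := by
  obtain ⟨r, -, h⟩ := E.hasExternalAddress
  filter_upwards [h n] with x hx
  have h1 : 2 * Real.pi * (E.s n - 1 / 2) < (E.R n x).im := hx.2.1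
  have h2 : (E.R n x).im < 2 * Real.pi * (E.s n + 1 / 2) := hx.2.2
  rw [abs_lt]
  constructor <;> linarith

/-- From some moment on, the whole tail `R_n` lies in the strip given by the external address. -/
theorem exists_forall_abs_im_R :
    ∃ N, ∀ n, N ≤ n → ∀ x, |(E.R n x).im - 2 * Real.pi * E.s n| < Real.pi := by
  obtain ⟨N, hN⟩ := E.isRayTail.2.2.2 (‖E.κ‖ + Real.exp E.κ.re)
  refine ⟨N, fun n hn => ?_⟩
  -- Late tails avoid a disk so large that `exp(Re R_{n+1}) = ‖R_{n+2} - κ‖` exceeds `exp(Re κ)`.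
  -- The inequality says that `e^{R_n}` has positive real part, so `Im R_n` cannot leave its strip.
  have hre : ∀ x, E.κ.re < (E.R (n + 1) x).re := fun x => by
    have h1 : ‖E.κ‖ + Real.exp E.κ.re < ‖E.R (n + 2) x‖ := hN _ (by lia) x
    rw [← Real.exp_lt_exp, exp_re_R]
    linarith [norm_sub_norm_le (E.R (n + 2) x) E.κ]
  have hcos : ∀ x, 0 < Real.cos (E.R n x).im := fun x => by
    have h1 := hre x
    rw [R_succ, Complex.add_re, Complex.exp_re, lt_add_iff_pos_left] at h1
    exact pos_of_mul_pos_right h1 (Real.exp_pos _).le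
  obtain ⟨k, hk⟩ := exists_int_of_cos (y := fun x => (E.R n x).im)
    (Complex.continuous_im.comp (E.continuous_R n)) (T := 0) fun x _ => by linarith [hcos x]
  have hπ := Real.pi_pos
  have hks : k = E.s n := by
    obtain ⟨x, hx⟩ := (E.eventually_abs_im_R n).exists
    have h1 := abs_lt.1 (hk x zero_le)
    have h2 := abs_lt.1 hx
    have h3 : (k : ℝ) < E.s n + 1 := by
      by_contra hcon
      nlinarith
    have h4 : (E.s n : ℝ) < k + 1 := by
      by_contra hcon
      nlinarith
    have h5 : k < E.s n + 1 := by exact_mod_cast h3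
    have h6 : E.s n < k + 1 := by exact_mod_cast h4
    lia
  intro x
  have := hk x zero_le
  rw [hks] at this
  linarith

/-- A common point of `R_i` and `R_j` has a single orbit, which at late times lies in the strips of
both addresses. So `s_n = s_{n + j - i}` for large `n`, and the address would be preperiodic. -/
theorem R_ne_of_lt {i j : ℕ} (hij : i < j) (x y : ℝ≥0) : E.R i x ≠ E.R j y := by
  intro h
  obtain ⟨N, hN⟩ := E.exists_forall_abs_im_R
  refine E.not_preperiodic ⟨N + i, j - i, by lia, fun n hn => ?_⟩
  have e : E.R n x = E.R (n + (j - i)) y := by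
    have h1 := E.R_add (n - i) i x
    have h2 := E.R_add (n - i) j y
    rw [show n - i + i = n by lia] at h1
    rw [show n - i + j = n + (j - i) by lia] at h2
    rw [h1, h2, h]
  have h1 := abs_lt.1 (hN n (by lia) x)
  have h2 := abs_lt.1 (hN (n + (j - i)) (by lia) y)
  rw [← e] at h2
  have hπ := Real.pi_pos
  have h3 : (E.s n : ℝ) < E.s (n + (j - i)) + 1 := by
    by_contra hcon
    nlinarith
  have h4 : (E.s (n + (j - i)) : ℝ) < E.s n + 1 := by
    by_contra hcon
    nlinarith
  have h5 : E.s n < E.s (n + (j - i)) + 1 := by exact_mod_cast h3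
  have h6 : E.s (n + (j - i)) < E.s n + 1 := by exact_mod_cast h4
  lia

theorem R_ne {i j : ℕ} (hij : i ≠ j) (x y : ℝ≥0) : E.R i x ≠ E.R j y := by
  rcases hij.lt_or_gt with h | h
  · exact E.R_ne_of_lt h x y
  · exact (E.R_ne_of_lt h y x).symm

/-- The tails `R_1, R_2, …` avoid the support `U` of the capture, so `f` and `f₀` agree on every
`R_n`. -/
theorem f_R (n : ℕ) (x : ℝ≥0) : E.f (E.R n x) = E.R (n + 1) x := by
  rw [f, show expMap E.κ (E.R n x) = E.R (n + 1) x from (E.R_succ n x).symm]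
  exact E.c_eq_self 1 _ (E.U_disjoint (n + 1) n.succ_pos x)

variable {E} {φ φhat : ℂ ≃ₜ ℂ}

theorem tendsto_leg_sub_R (hφ : IsIdType E.standardSpider φ) (n : ℕ) :
    Tendsto (fun x => E.leg φ n x - E.R n x) atTop (𝓝 0) := by
  obtain ⟨-, h, -, -, h1, hε⟩ := hφ
  rw [Metric.tendsto_nhds]
  intro ε hε0
  obtain ⟨M, hM⟩ := hε ε hε0
  filter_upwards [(E.tendsto_norm_R n).eventually (eventually_gt_atTop M)] with x hx
  have := hM _ (mem_iUnion.2 ⟨n, x, rfl⟩) hx 1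
  rwa [h1, ← dist_zero_right] at this

theorem isRCurve_leg (hφ : IsIdType E.standardSpider φ) (n : ℕ) : IsRCurve (E.leg φ n) := by
  refine ⟨φ.continuous.comp (E.continuous_R n), ?_⟩
  have h1 : Tendsto (fun x => (E.leg φ n x - E.R n x).re) atTop (𝓝 0) :=
    (Complex.continuous_re.tendsto 0).comp (tendsto_leg_sub_R hφ n)
  refine (h1.add_atTop (E.isRCurve_R n).2).congr fun x => ?_
  simp

theorem mem_markedPoints {n : ℕ} {z : ℂ} :
    z ∈ E.markedPoints φ n ↔ ∃ i ≤ n, φ (E.a i) = z := by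
  simp [markedPoints]

theorem isRCurveFrom_leg (hφ : IsIdType E.standardSpider φ) (n : ℕ) :
    IsRCurveFrom (E.markedPoints φ n) (E.leg φ n) := by
  refine ⟨isRCurve_leg hφ n, mem_markedPoints.2 ⟨n, le_rfl, rfl⟩, fun x hx hmem => ?_⟩
  obtain ⟨i, -, hi⟩ := mem_markedPoints.1 hmem
  have hi : E.R i 0 = E.R n x := φ.injective hi
  by_cases hin : i = n
  · subst hin
    exact hx.ne (E.R_injective i hi)
  · exact E.R_ne hin _ _ hi

theorem card_markedPoints_le (n : ℕ) : (E.markedPoints φ n).card ≤ n + 1 :=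
  Finset.card_image_le.trans (Finset.card_range _).le

/-- The entire function conjugate to `f` in one step of the Thurston iteration is an exponential. -/
theorem exists_eq_exp (hφ : IsIdType E.standardSpider φ) (hp : E.IsPullback φ φhat) :
    ∃ b : ℂ, b ≠ 0 ∧ ∀ z, φ (E.f z) = b * Complex.exp (φhat z) + φ (E.a 0) := by
  -- `T` collects everything that `φ ∘ f` does after `exp`, translated so that the image `φ (a_0)`
  -- of the singular value becomes 0.
  let T : ℂ ≃ₜ ℂ := (((Homeomorph.addRight E.κ).trans (E.c 1)).trans φ).trans
    (Homeomorph.addRight (-φ (E.a 0)))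
  have hT : ∀ z, T z = φ (E.c 1 (z + E.κ)) + -φ (E.a 0) := fun z => rfl
  have hTf : ∀ z, T (Complex.exp z) = φ (E.f z) + -φ (E.a 0) := fun z => hT _
  obtain ⟨α, β, h⟩ := exists_exp_affine (T := T) (θ := φhat)
    (by rw [hT, zero_add, E.c_one, a_zero, add_neg_cancel])
    (by simp only [hTf]; exact hp.2.add_const _)
  have hf : ∀ z, φ (E.f z) = Complex.exp (α * φhat z + β) + φ (E.a 0) := fun z => by
    rw [← h, hTf, Homeomorph.symm_apply_apply, neg_add_cancel_right]
  have hleg := isRCurve_leg hp.1 0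
  -- The legs of `φhat` at `R_0` and of `φ` at `R_1` are asymptotic to these tails, and `R_1 =
  -- e^{R_0} + κ`. Comparison gives `e^{(α - 1) z + β} → 1` along the leg of `φhat`, whose imaginary
  -- part is bounded thanks to the external address.
  have hα : α = 1 := by
    have hsub := tendsto_leg_sub_R hp.1 0
    refine eq_one_of_tendsto_exp (β := β) hleg
      (B := 1 + (Real.pi + |2 * Real.pi * E.s 0|)) ?_ ?_
    · filter_upwards [Metric.tendsto_nhds.1 hsub 1 one_pos, E.eventually_abs_im_R 0] with x h1 h2
      rw [dist_zero_right] at h1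
      have h3 := (Complex.abs_im_le_norm _).trans_lt h1
      rw [Complex.sub_im] at h3
      have h4 := abs_add_le ((E.leg φhat 0 x).im - (E.R 0 x).im) (E.R 0 x).im
      have h5 := abs_add_le ((E.R 0 x).im - 2 * Real.pi * E.s 0) (2 * Real.pi * E.s 0)
      rw [sub_add_cancel] at h4 h5
      linarith
    · have hexp : Tendsto (fun x => Complex.exp (-E.leg φhat 0 x)) atTop (𝓝 0) := by
        rw [tendsto_zero_iff_norm_tendsto_zero]
        simp only [Complex.norm_exp, Complex.neg_re]
        exact Real.tendsto_exp_neg_atTop_nhds_zero.comp hleg.2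
      have h1 : Tendsto (fun x => Complex.exp (-(E.leg φhat 0 x - E.R 0 x))) atTop (𝓝 1) := by
        have := (Complex.continuous_exp.tendsto _).comp hsub.neg
        rwa [neg_zero, Complex.exp_zero] at this
      have h2 := ((((tendsto_leg_sub_R hφ 1).add_const (E.κ - φ (E.a 0))).mul hexp).add h1)
      rw [mul_zero, zero_add] at h2
      refine h2.congr fun x => ?_
      have h3 := hf (E.R 0 x)
      rw [f_R] at h3
      have h3 : E.leg φ 1 x = Complex.exp (α * E.leg φhat 0 x + β) + φ (E.a 0) := h3
      have h4 : E.R 1 x = Complex.exp (E.R 0 x) + E.κ := E.R_succ 0 x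
      rw [show (α - 1) * E.leg φhat 0 x + β = (α * E.leg φhat 0 x + β) + -E.leg φhat 0 x by ring,
        Complex.exp_add _ (-E.leg φhat 0 x), h3, h4,
        show -(E.leg φhat 0 x - E.R 0 x) = E.R 0 x + -E.leg φhat 0 x by ring,
        Complex.exp_add (E.R 0 x)]
      ring
  refine ⟨Complex.exp β, Complex.exp_ne_zero β, fun z => ?_⟩
  rw [hf, hα, one_mul, Complex.exp_add, mul_comm]

/-- The exponential estimate applies with omitted value `φ (a_0)`, itself a marked point. The map
shifts marked points by one step of the dynamics, and there are at most `n + 2` of them in the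
target. -/
theorem legWordLength_pullback_lt (hφ : IsIdType E.standardSpider φ) (hp : E.IsPullback φ φhat)
    (n : ℕ) : E.legWordLength φhat n < 6 * (n + 2) ^ 2 * (E.legWordLength φ (n + 1) + 1) := by
  obtain ⟨b, hb, hexp⟩ := exists_eq_exp hφ hp
  have hR : ∀ i x, b * Complex.exp (φhat (E.R i x)) + φ (E.a 0) = φ (E.R (i + 1) x) :=
    fun i x => by rw [← hexp, f_R]
  refine (homotopyWordLength_exp_lt (V := E.markedPoints φ (n + 1)) (γ := E.leg φ (n + 1)) hb
    (mem_markedPoints.2 ⟨0, Nat.zero_le _, rfl⟩) (isRCurveFrom_leg hφ (n + 1))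
    (fun h => E.R_ne n.succ_ne_zero _ _ (φ.injective h)) (V' := E.markedPoints φhat n) ?_ ?_
    (isRCurve_leg hp.1 n) (isRCurveFrom_leg hp.1 n).2.1 (hR n)).trans_le ?_
  · intro z hz
    obtain ⟨i, hi, rfl⟩ := mem_markedPoints.1 hz
    exact mem_markedPoints.2 ⟨i + 1, by lia, (hR i 0).symm⟩
  · intro z hz w hw h
    obtain ⟨i, hi, rfl⟩ := mem_markedPoints.1 hz
    obtain ⟨j, hj, rfl⟩ := mem_markedPoints.1 hw
    by_contra hne
    have hij : i + 1 ≠ j + 1 := fun e => hne (by rw [Nat.succ_injective e])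
    exact E.R_ne hij 0 0 (φ.injective (((hR i 0).symm.trans h).trans (hR j 0)))
  · have := card_markedPoints_le (E := E) (φ := φ) (n + 1)
    unfold legWordLength
    gcongr

end CapturedExponential

end

theorem mainTheorem7 :
    -- every admissible r-curve has a homotopy word
    (∀ (V : Finset ℂ) (γ : ℝ≥0 → ℂ), IsRCurveFrom V γ → ∃ W, IsHomotopyWord V γ W) ∧
    -- lifts by monic polynomials
    (∀ (p : Polynomial ℂ), p.Monic →
      ∀ V : Finset ℂ, criticalValues (fun z => p.eval z) ⊆ V →
      ∀ γ : ℝ≥0 → ℂ, IsRCurveFrom V γ →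
      ∀ V' : Finset ℂ, MapsTo (fun z => p.eval z) V' V → InjOn (fun z => p.eval z) V' →
      ∀ γ' : ℝ≥0 → ℂ, IsRCurve γ' → γ' 0 ∈ V' → (∀ t, p.eval (γ' t) = γ t) →
        homotopyWordLength V' γ' <
          6 * p.natDegree * V.card ^ 2 * (homotopyWordLength V γ + 1)) ∧
    -- lifts by the exponential
    (∀ V : Finset ℂ, (0 : ℂ) ∈ V →
      ∀ γ : ℝ≥0 → ℂ, IsRCurveFrom V γ → γ 0 ≠ 0 →
      ∀ V' : Finset ℂ, MapsTo Complex.exp V' V → InjOn Complex.exp V' →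
      ∀ γ' : ℝ≥0 → ℂ, IsRCurve γ' → γ' 0 ∈ V' → (∀ t, Complex.exp (γ' t) = γ t) →
        homotopyWordLength V' γ' < 6 * V.card ^ 2 * (homotopyWordLength V γ + 1)) ∧
    -- lifts by `g = p ∘ exp`
    (∀ (p : Polynomial ℂ), p.Monic →
      ∀ g : ℂ → ℂ, (g = fun z => p.eval (Complex.exp z)) →
      ∀ V : Finset ℂ, singularValues g ⊆ V →
      ∀ γ : ℝ≥0 → ℂ, IsRCurveFrom V γ → γ 0 ∉ singularValues g →
      ∀ V' : Finset ℂ, MapsTo g V' (V \ singularValues g) → InjOn g V' →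
      ∀ γ' : ℝ≥0 → ℂ, IsRCurve γ' → γ' 0 ∈ V' → (∀ t, g (γ' t) = γ t) →
        homotopyWordLength V' γ' <
          42 * p.natDegree * V.card ^ 4 * (homotopyWordLength V γ + 1)) ∧
    -- leg homotopy words under Thurston iteration
    (∃ A : ℝ, 0 < A ∧ ∀ (E : CapturedExponential) (φ φhat : ℂ ≃ₜ ℂ),
      IsIdType E.standardSpider φ → E.IsPullback φ φhat → ∀ n : ℕ,
        (∃ W, E.IsLegWord φ (n + 1) W) ∧ (∃ W, E.IsLegWord φhat n W) ∧
        (E.legWordLength φhat n : ℝ) <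
          A * ((n : ℝ) + 2) ^ 4 * max 1 (E.legWordLength φ (n + 1) : ℝ)) := by
  refine ⟨fun V γ h => exists_isHomotopyWord h,
    fun p hp V hV γ hγ V' hV' hinj γ' hγ' h0 hlift =>
      homotopyWordLength_polynomial_lt hp hV hγ hV' hinj hγ' h0 hlift,
    fun V h0V γ hγ hγ0 V' hV' hinj γ' hγ' h0 hlift => ?_,
    fun p hp g hg V hV γ hγ _ V' hV' hinj γ' hγ' h0 hlift =>
      homotopyWordLength_polynomial_exp_lt hp hg hV hγ hV' hinj hγ' h0 hlift, ?_⟩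
  · have e : (fun z => 1 * Complex.exp z + 0) = Complex.exp := by funext z; simp
    exact homotopyWordLength_exp_lt one_ne_zero h0V hγ hγ0 (by rwa [e]) (by rwa [e]) hγ' h0
      fun t => by rw [one_mul, add_zero]; exact hlift t
  -- Here `12 = 6 · 2`, the factor 2 coming from `m + 1 ≤ 2 max 1 m`; the quadratic bound is
  -- weakened to the fourth power.
  · refine ⟨12, by norm_num, fun E φ φhat hφ hp n =>
      ⟨exists_isHomotopyWord (CapturedExponential.isRCurveFrom_leg hφ (n + 1)),
        exists_isHomotopyWord (CapturedExponential.isRCurveFrom_leg hp.1 n), ?_⟩⟩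
    have h1 : (E.legWordLength φhat n : ℝ) <
        6 * ((n : ℝ) + 2) ^ 2 * (E.legWordLength φ (n + 1) + 1) := by
      exact_mod_cast CapturedExponential.legWordLength_pullback_lt hφ hp n
    refine h1.trans_le ?_
    set m : ℝ := (E.legWordLength φ (n + 1) : ℝ)
    have h2 : m + 1 ≤ 2 * max 1 m := by linarith [le_max_left 1 m, le_max_right 1 m]
    have h3 : ((n : ℝ) + 2) ^ 2 ≤ ((n : ℝ) + 2) ^ 4 :=
      pow_le_pow_right₀ (by linarith [n.cast_nonneg (α := ℝ)]) (by norm_num)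
    calc 6 * ((n : ℝ) + 2) ^ 2 * (m + 1) ≤ 6 * ((n : ℝ) + 2) ^ 4 * (2 * max 1 m) := by gcongr
      _ = 12 * ((n : ℝ) + 2) ^ 4 * max 1 m := by ring
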